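/- Let $\Omega$ be an algebraically closed field of characteristic zero, and let $k$ be a subfield of $\Omega$ over which $\Omega$ has infinite transcendence degree. For a field $L$ with $k\subset L\subset\Omega$, write $A(\Omega/L)$ for the group of automorphisms of $\Omega$ fixing every element of $L$. A variety over a field is a geometrically reduced scheme of finite type over that field (not necessarily irreducible). For $\sigma\in A(\Omega/k)$, a scheme $V$ over $\Omega$, a morphism $f$ of schemes over $\Omega$ and a point $P\in V(\Omega)$, write $\sigma V$, $\sigma f$ and $\sigma P\in(\sigma V)(\Omega)$ for their base changes along $\sigma\colon\Omega\to\Omega$; identify $\sigma(\tau V)=(\sigma\tau)V$ canonically, and $\sigma(V_{0,\Omega})=V_{0,\Omega}$ for every scheme $V_0$ over $k$, where $V_{0,\Omega}$ is the base change of $V_0$ to $\Omega$. Let $V$ be a quasi-projective variety over $\Omega$, and let $(f_\sigma)_{\sigma\in A(\Omega/k)}$ be a descent system on $V$, that is, a family of isomorphisms $f_\sigma\colon\sigma V\to V$ over $\Omega$ such that $f_{\sigma\tau}=f_\sigma\circ\sigma f_\tau$ for all $\sigma,\tau\in A(\Omega/k)$. Suppose that there is a finite set $\Sigma\subset V(\Omega)$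 such that (a) every automorphism of $V$ (over $\Omega$) that fixes all $P\in\Sigma$ is the identity map, and (b) there is a subfield $L$ of $\Omega$, containing $k$ and finitely generated as a field over $k$, such that $f_\sigma(\sigma P)=P$ for all $P\in\Sigma$ and all $\sigma\in A(\Omega/L)$. Then $(f_\sigma)_{\sigma\in A(\Omega/k)}$ is effective: there are a variety $V_0$ over $k$ and an isomorphism $f\colon V_{0,\Omega}\to V$ over $\Omega$ such that $f_\sigma=f\circ(\sigma f)^{-1}$ for all $\sigma\in A(\Omega/k)$. -/

import Mathlib

open CategoryTheory CategoryTheory.Limits AlgebraicGeometry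

universe u

namespace DescentOfVarieties

noncomputable section

/-- Schemes over (the spectrum of) a field `K`. -/
abbrev SchemeOver (K : Type u) [Field K] : Type (u + 1) :=
  Over (Spec (CommRingCat.of K))

/-- A variety over a field `K`: a geometrically reduced scheme of finite type over `Spec K`,
not necessarily irreducible. -/
structure IsVariety {K : Type u} [Field K] (V : SchemeOver K) : Prop where
  geometricallyReduced : GeometricallyReduced V.hom
  locallyOfFiniteType : LocallyOfFiniteType V.hom
  quasiCompact : QuasiCompact V.hom

/-- Projective `n`-space over a field `K`, namely `Proj K[X₀, …, Xₙ]`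
with its structure morphism to `Spec K`. -/
def projectiveSpace (n : ℕ) (K : Type u) [Field K] : SchemeOver K :=
  letI := MvPolynomial.gradedAlgebra (σ := Fin (n + 1)) (R := K)
  Over.mk (Proj.toSpecZero (MvPolynomial.homogeneousSubmodule (Fin (n + 1)) K) ≫
    Spec.map (CommRingCat.ofHom
      (algebraMap K (MvPolynomial.homogeneousSubmodule (Fin (n + 1)) K 0))))

/-- A scheme over `K` is quasi-projective if it has a (locally closed) immersion over `K`
into some projective space over `K`. -/
def IsQuasiprojective {K : Type u} [Field K] (V : SchemeOver K) : Prop :=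
  ∃ (n : ℕ) (i : V ⟶ projectiveSpace n K), IsImmersion i.left

/-- Base change `V ↦ φV` of schemes along a homomorphism of fields `φ : K → K'`:
`φV` is the fibre product of `V` and `Spec K'` over `Spec K`. -/
abbrev baseChange {K K' : Type u} [Field K] [Field K'] (φ : K →+* K') :
    SchemeOver K ⥤ SchemeOver K' :=
  Over.pullback (Spec.map (CommRingCat.ofHom φ))

/-- The canonical isomorphism `ψ(φV) ≅ (ψ ∘ φ)V`; it is the one compatible with the
projections of both sides to `V`. -/
def baseChangeComp {K K' K'' : Type u} [Field K] [Field K'] [Field K'']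
    (φ : K →+* K') (ψ : K' →+* K'') (χ : K →+* K'') (h : ψ.comp φ = χ) (V : SchemeOver K) :
    (baseChange ψ).obj ((baseChange φ).obj V) ≅ (baseChange χ).obj V :=
  have hχ : Spec.map (CommRingCat.ofHom ψ) ≫ Spec.map (CommRingCat.ofHom φ) =
      Spec.map (CommRingCat.ofHom χ) := by
    rw [← Spec.map_comp, ← CommRingCat.ofHom_comp, h]
  have hp : IsPullback
      (pullback.fst (pullback.snd V.hom (Spec.map (CommRingCat.ofHom φ)))
          (Spec.map (CommRingCat.ofHom ψ)) ≫
        pullback.fst V.hom (Spec.map (CommRingCat.ofHom φ)))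
      (pullback.snd (pullback.snd V.hom (Spec.map (CommRingCat.ofHom φ)))
          (Spec.map (CommRingCat.ofHom ψ)))
      V.hom (Spec.map (CommRingCat.ofHom χ)) :=
    hχ ▸ ((IsPullback.of_hasPullback
        (pullback.snd V.hom (Spec.map (CommRingCat.ofHom φ)))
        (Spec.map (CommRingCat.ofHom ψ))).paste_horiz
      (IsPullback.of_hasPullback V.hom (Spec.map (CommRingCat.ofHom φ))))
  Over.isoMk hp.isoPullback hp.isoPullback_hom_snd

section Descent

variable {k Ω : Type u} [Field k] [Field Ω] [Algebra k Ω]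

/-- The functor `V ↦ σV`, `f ↦ σf` given by base change along an automorphism `σ` of `Ω`
over `k`. -/
abbrev conj (σ : Ω ≃ₐ[k] Ω) : SchemeOver Ω ⥤ SchemeOver Ω :=
  baseChange (σ : Ω →+* Ω)

/-- The canonical identification `σ(τV) = (στ)V`. -/
def conjConj (σ τ : Ω ≃ₐ[k] Ω) (V : SchemeOver Ω) :
    (conj σ).obj ((conj τ).obj V) ≅ (conj (σ * τ)).obj V :=
  baseChangeComp (τ : Ω →+* Ω) (σ : Ω →+* Ω) ((σ * τ : Ω ≃ₐ[k] Ω) : Ω →+* Ω) rfl V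

/-- The canonical identification `σ(V_Ω) = V_Ω` for a scheme `V` over `k`. -/
def conjBaseChange (σ : Ω ≃ₐ[k] Ω) (V : SchemeOver k) :
    (conj σ).obj ((baseChange (algebraMap k Ω)).obj V) ≅ (baseChange (algebraMap k Ω)).obj V :=
  baseChangeComp (algebraMap k Ω) (σ : Ω →+* Ω) (algebraMap k Ω) (RingHom.ext fun x => σ.commutes x) V

/-- `V(Ω)`: the set of `Ω`-valued points, i.e. the sections of `V → Spec Ω` over `Ω`. -/
abbrev Point (V : SchemeOver Ω) : Type u :=
  Over.mk (𝟙 (Spec (CommRingCat.of Ω))) ⟶ V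

/-- The point `σP` of `σV` attached to a point `P` of `V`: the base change of the section `P`
along `σ`. -/
def conjPoint (σ : Ω ≃ₐ[k] Ω) {V : SchemeOver Ω} (P : Point V) : Point ((conj σ).obj V) :=
  have hP : P.left ≫ V.hom = 𝟙 (Spec (CommRingCat.of Ω)) := Over.w P
  Over.homMk (pullback.lift (Spec.map (CommRingCat.ofHom (σ : Ω →+* Ω)) ≫ P.left)
      (𝟙 (Spec (CommRingCat.of Ω)))
      (by rw [Category.assoc, hP, Category.comp_id]; exact (Category.id_comp _).symm))
    (pullback.lift_snd _ _ _)

variable (k) in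
/-- A descent system on `V`, relative to the subfield `k` of `Ω`: isomorphisms
`f_σ : σV → V`, one for each automorphism `σ` of `Ω` over `k`, such that
`f_{στ} = f_σ ∘ σf_τ` for all `σ` and `τ`. -/
structure DescentSystem (V : SchemeOver Ω) where
  iso (σ : Ω ≃ₐ[k] Ω) : (conj σ).obj V ≅ V
  iso_mul (σ τ : Ω ≃ₐ[k] Ω) :
    (conjConj σ τ V).hom ≫ (iso (σ * τ)).hom = (conj σ).map (iso τ).hom ≫ (iso σ).hom

/-- The model `(V₀, f : V₀_Ω ≅ V)` of `V` over `k` splits the descent system: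
`f_σ = f ∘ (σf)⁻¹` for all `σ`. -/
def DescentSystem.IsSplitBy {V : SchemeOver Ω} (D : DescentSystem k V) (V₀ : SchemeOver k)
    (f : (baseChange (algebraMap k Ω)).obj V₀ ≅ V) : Prop :=
  ∀ σ : Ω ≃ₐ[k] Ω,
    (D.iso σ).hom = ((conj σ).mapIso f).inv ≫ (conjBaseChange σ V₀).hom ≫ f.hom

/-- A descent system is effective if it is split by some model of `V` over `k`, the model
being a variety over `k`. -/
def DescentSystem.IsEffective {V : SchemeOver Ω} (D : DescentSystem k V) : Prop :=
  ∃ (V₀ : SchemeOver k) (f : (baseChange (algebraMap k Ω)).obj V₀ ≅ V),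
    IsVariety V₀ ∧ D.IsSplitBy V₀ f

end Descent

end

end DescentOfVarieties

/-!
A descent system on `V` is the same thing as a semilinear action of `Aut(Ω/k)` on the scheme `V`:
the automorphism `σ` acts by the inverse of `f_σ` followed by the projection `σV → V`
(`DescentSystem.toSemilinearAction`). The theorem asserts that the quotient of `V` by this action
exists as a variety over `k` and has `V` as its base change. The quotient of an affine scheme by
such an action is a model as soon as the invariant functions generate all functions over `Ω`, by
the usual independence argument (`isPushout_of_invariant`); call an invariant affine open subset
with this property *good*. The spectra of the rings of invariants of the good open subsets glue
(`exists_isPullback_of_isGood`), so the point is to cover `V` by good open subsets. For a projective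
embedding of `V` on which the action is, over some finite extension `k₁` of `k`, induced by the
action on the coordinates, this is classical: Galois descent for homogeneous ideals and prime
avoidance give good open subsets over `k₁`, and intersecting their finitely many translates gives
good open subsets over `k` (`isGood_preimage`, `mem_range_sup_of_invariant`, `exists_mem_isGood`).

It remains to produce such an embedding, and this is where the finite set of points enters. Given
any embedding `i`, an automorphism `σ` that fixes the coefficients of `i` and of the points, and
that is compatible with the descent datum at the points, moves `V` in two ways, through the action
and through the coordinates. These differ by an automorphism of `V` that fixes the points, so they
agree (`exists_equivariantUnder`). Every embedding is therefore equivariant over some finitely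
generated extension of `k`, which depends on the embedding.

Let `κ` be the algebraic closure of `k` in `Ω`. The embedding and `V` are defined over a finitely
generated `κ`-algebra `R ⊆ Ω` (`exists_finset_immersion_model`), by a model over `R` whose
projection from `V` is invariant under `Aut(Ω/R)`. Comparing it with its conjugate under an
automorphism `σ` for which `R` and `σR` are linearly disjoint gives, by Galois descent of morphisms
to the fraction field of `R · σR ≅ R ⊗ R` and by passage to a limit, an isomorphism between the two
pullbacks of the model to a localization of `R ⊗ R` (`exists_spread`). Specializing the second
factor at a `κ`-point of `R` identifies `V` with a fibre of the model over that point. This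
identification is invariant under all of `Aut(Ω/κ)`: the comparison isomorphisms are compatible at
all generic points of the second factor, hence everywhere (`exists_invariant_specialization`). The
coordinates of the fibre provide an embedding of `V` that is equivariant over `κ`
(`exists_equivariant_immersion`). By rigidity again, the group of automorphisms for which it
is equivariant also contains the stabilizer of a finitely generated extension of `k`, and a
subgroup with these two properties contains the stabilizer of a finite normal extension of `k`
(`exists_finite_normal_fixingSubgroup_le`).
-/

open scoped TensorProduct

namespace DescentOfVarieties

/-! ### Specialization over algebraically closed fields -/

section Specialization

variable {κ R : Type u} [Field κ] [CommRing R] [Algebra κ R]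

/-- Nullstellensatz: a nonzero function on an affine variety over an algebraically closed field does
not vanish at some rational point. -/
lemma exists_algHom_apply_ne_zero [IsAlgClosed κ] [IsDomain R] [Algebra.FiniteType κ R]
    {r : R} (hr : r ≠ 0) : ∃ φ : R →ₐ[κ] κ, φ r ≠ 0 := by
  have : Algebra.FiniteType R (Localization.Away r) := inferInstance
  have : Algebra.FiniteType κ (Localization.Away r) := Algebra.FiniteType.trans ‹_› this
  have : Nontrivial (Localization.Away r) :=
    (IsLocalization.injective (Localization.Away r) (M := Submonoid.powers r)
      (powers_le_nonZeroDivisors_of_noZeroDivisors hr)).nontrivial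
  obtain ⟨m, hm⟩ := Ideal.exists_maximal (Localization.Away r)
  let := Ideal.Quotient.field m
  have : Algebra.FiniteType κ (Localization.Away r ⧸ m) := inferInstance
  have : Module.Finite κ (Localization.Away r ⧸ m) := finite_of_finite_type_of_isJacobsonRing _ _
  let e : (Localization.Away r ⧸ m) →ₐ[κ] κ := IsAlgClosed.lift
  refine ⟨e.comp ((Ideal.Quotient.mkₐ κ m).comp (IsScalarTower.toAlgHom κ R _)), ?_⟩
  have h : IsUnit (algebraMap R (Localization.Away r) r) :=
    IsLocalization.Away.algebraMap_isUnit r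
  exact ((h.map (Ideal.Quotient.mkₐ κ m)).map e).ne_zero

/-- A nonzero element of `M ⊗ R` stays nonzero under a general specialization `R → κ`. -/
lemma exists_forall_lTensor_ne_zero {M : Type u} [AddCommGroup M] [Module κ M]
    {x : M ⊗[κ] R} (hx : x ≠ 0) :
    ∃ r : R, r ≠ 0 ∧ ∀ φ : R →ₗ[κ] κ, φ r ≠ 0 → φ.lTensor M x ≠ 0 := by
  classical
  let b := Module.Basis.ofVectorSpace κ M
  let e := TensorProduct.equivFinsuppOfBasisLeft (N := R) b
  let e' := TensorProduct.equivFinsuppOfBasisLeft (N := κ) b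
  have hex : e x ≠ 0 := fun h ↦ hx (e.map_eq_zero_iff.mp h)
  obtain ⟨i, hi⟩ := Finsupp.ne_iff.mp hex
  refine ⟨e x i, hi, fun φ hφ h0 ↦ hφ ?_⟩
  have key : ∀ y : M ⊗[κ] R, e' (φ.lTensor M y) i = φ (e y i) := by
    intro y
    induction y with
    | zero => simp
    | add a b ha hb => simp [ha, hb]
    | tmul m r => simp [e, e']
  rw [← key, h0]; simp

/-- Evaluation of the second factor of `B ⊗ R` at a point `φ : R → κ`, as a homomorphism of
`B`-algebras. -/
noncomputable def specialize {B : Type u} [CommRing B] [Algebra κ B] (φ : R →ₐ[κ] κ) :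
    B ⊗[κ] R →ₐ[B] B :=
  Algebra.TensorProduct.lift (AlgHom.id B B) ((Algebra.ofId κ B).comp φ) fun _ _ ↦ .all _ _

@[simp]
lemma specialize_tmul {B : Type u} [CommRing B] [Algebra κ B] (φ : R →ₐ[κ] κ) (b : B) (r : R) :
    specialize φ (b ⊗ₜ[κ] r) = b * algebraMap κ B (φ r) := by
  simp [specialize, Algebra.ofId_apply]

lemma exists_forall_specialize_ne_zero {B : Type u} [CommRing B] [Algebra κ B]
    {x : B ⊗[κ] R} (hx : x ≠ 0) :
    ∃ r : R, r ≠ 0 ∧ ∀ φ : R →ₐ[κ] κ, φ r ≠ 0 → specialize φ x ≠ 0 := by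
  obtain ⟨r, hr, H⟩ := exists_forall_lTensor_ne_zero hx
  refine ⟨r, hr, fun φ hφ h ↦ H φ.toLinearMap hφ ?_⟩
  have key : ∀ y : B ⊗[κ] R,
      specialize φ y = TensorProduct.rid κ B (φ.toLinearMap.lTensor B y) := by
    intro y
    induction y with
    | zero => simp
    | add a b ha hb => simp [ha, hb]
    | tmul m r => simp [Algebra.smul_def, mul_comm]
  rw [key] at h
  exact (LinearEquiv.map_eq_zero_iff _).mp h

/-- Over an algebraically closed field the tensor product of two domains, one of them finitely
generated, is a domain: general specializations of the second factor detect zero divisors. -/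
lemma isDomain_tensorProduct [IsAlgClosed κ] [IsDomain R] [Algebra.FiniteType κ R]
    (B : Type u) [CommRing B] [Algebra κ B] [IsDomain B] : IsDomain (B ⊗[κ] R) := by
  have : Nontrivial (B ⊗[κ] R) := by
    obtain ⟨φ, -⟩ := exists_algHom_apply_ne_zero (κ := κ) (one_ne_zero (α := R))
    exact (specialize (B := B) φ).toRingHom.domain_nontrivial
  have : NoZeroDivisors (B ⊗[κ] R) := by
    refine ⟨fun {x y} hxy ↦ ?_⟩
    by_contra! h
    obtain ⟨r, hr, H⟩ := exists_forall_specialize_ne_zero h.1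
    obtain ⟨s, hs, H'⟩ := exists_forall_specialize_ne_zero h.2
    obtain ⟨φ, hφ⟩ := exists_algHom_apply_ne_zero (κ := κ) (mul_ne_zero hr hs)
    rw [map_mul] at hφ
    refine mul_ne_zero (H φ (left_ne_zero_of_mul hφ)) (H' φ (right_ne_zero_of_mul hφ)) ?_
    rw [← map_mul, hxy, map_zero]
  exact NoZeroDivisors.to_isDomain _

end Specialization

/-! ### Automorphisms of extensions of infinite transcendence degree -/

section Extension

open Cardinal

/-- Two algebraically closed fields of the same transcendence degree over a domain are isomorphic
over it. -/
lemma exists_ringEquiv_of_trdeg_eq {P K L : Type u} [CommRing P] [IsDomain P] [Field K] [Field L]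
    [Algebra P K] [Algebra P L] [FaithfulSMul P K] [FaithfulSMul P L]
    [IsAlgClosed K] [IsAlgClosed L] (h : Algebra.trdeg P K = Algebra.trdeg P L) :
    ∃ e : K ≃+* L, ∀ p, e (algebraMap P K p) = algebraMap P L p := by
  obtain ⟨s, hs⟩ := exists_isTranscendenceBasis P K
  obtain ⟨t, ht⟩ := exists_isTranscendenceBasis P L
  have hst : #s = #t := by rw [hs.cardinalMk_eq_trdeg, ht.cardinalMk_eq_trdeg, h]
  obtain ⟨e⟩ := Cardinal.eq.mp hst
  let := IsAlgClosed.isAlgClosure_of_transcendence_basis _ hs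
  let := IsAlgClosed.isAlgClosure_of_transcendence_basis _ ht
  let f : Algebra.adjoin P (Set.range ((↑) : s → K)) ≃ₐ[P]
      Algebra.adjoin P (Set.range ((↑) : t → L)) :=
    hs.1.aevalEquiv.symm.trans ((MvPolynomial.renameEquiv P e).trans ht.1.aevalEquiv)
  refine ⟨IsAlgClosure.equivOfEquiv K L f.toRingEquiv, fun p ↦ ?_⟩
  have h1 : algebraMap P K p = algebraMap (Algebra.adjoin P (Set.range ((↑) : s → K))) K
      (algebraMap P _ p) := rfl
  have h2 : algebraMap P L p = algebraMap (Algebra.adjoin P (Set.range ((↑) : t → L))) L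
      (algebraMap P _ p) := rfl
  rw [h1, h2]
  refine (IsAlgClosure.equivOfEquiv_algebraMap K L f.toRingEquiv _).trans ?_
  exact congrArg _ (f.commutes p)

variable {k Ω : Type u} [Field k] [Field Ω] [Algebra k Ω]

lemma trdeg_eq_of_trdeg_lt {P : Type u} [CommRing P] [IsDomain P]
    [Algebra k P] [Algebra P Ω] [IsScalarTower k P Ω] [FaithfulSMul P Ω]
    (htr : ℵ₀ ≤ Algebra.trdeg k Ω) (hP : Algebra.trdeg k P < ℵ₀) :
    Algebra.trdeg P Ω = Algebra.trdeg k Ω := by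
  have := trdeg_add_eq k P (A := Ω)
  have h2 : ℵ₀ ≤ Algebra.trdeg P Ω := by
    by_contra! h
    exact (this ▸ htr).not_gt (Cardinal.add_lt_aleph0 hP h)
  rw [← this, Cardinal.add_eq_right h2 (hP.le.trans h2)]

/-- Two embeddings into `Ω` of a domain of finite transcendence degree over `k` differ by an
automorphism of `Ω` over `k`. -/
lemma exists_algEquiv_comp_eq [IsAlgClosed Ω] (htr : ℵ₀ ≤ Algebra.trdeg k Ω)
    {P : Type u} [CommRing P] [IsDomain P] [Algebra k P] (hP : Algebra.trdeg k P < ℵ₀)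
    (u v : P →ₐ[k] Ω) (hu : Function.Injective u) (hv : Function.Injective v) :
    ∃ ρ : Ω ≃ₐ[k] Ω, ∀ p, ρ (u p) = v p := by
  have key : ∀ w : P →ₐ[k] Ω, Function.Injective w →
      @Algebra.trdeg P Ω _ _ w.toRingHom.toAlgebra = Algebra.trdeg k Ω := by
    intro w hw
    let := w.toRingHom.toAlgebra
    have : IsScalarTower k P Ω := .of_algebraMap_eq fun x ↦ (w.commutes x).symm
    have : FaithfulSMul P Ω := (faithfulSMul_iff_algebraMap_injective P Ω).mpr hw
    exact trdeg_eq_of_trdeg_lt htr hP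
  have key2 : ∀ w : P →ₐ[k] Ω, Function.Injective w →
      @FaithfulSMul P Ω w.toRingHom.toAlgebra.toSMul := by
    intro w hw
    let := w.toRingHom.toAlgebra
    exact (faithfulSMul_iff_algebraMap_injective P Ω).mpr hw
  obtain ⟨e, he⟩ := @exists_ringEquiv_of_trdeg_eq P Ω Ω _ _ _ _ u.toRingHom.toAlgebra
    v.toRingHom.toAlgebra (key2 u hu) (key2 v hv) inferInstance inferInstance
    ((key u hu).trans (key v hv).symm)
  have he' : ∀ p, e (u p) = v p := he
  refine ⟨AlgEquiv.ofRingEquiv (f := e) fun x ↦ ?_, he'⟩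
  have h := he' (algebraMap k P x)
  rwa [u.commutes, v.commutes] at h

/-- The field `k` is the fixed field of the automorphisms of `Ω` over `k`: an algebraic element
outside `k` has another conjugate, and a transcendental element `x` is conjugate to `x + 1`. -/
lemma isInvariant_of_trdeg [IsAlgClosed Ω] [CharZero Ω] (htr : ℵ₀ ≤ Algebra.trdeg k Ω) :
    Algebra.IsInvariant k Ω (Ω ≃ₐ[k] Ω) := by
  have : CharZero k := (algebraMap k Ω).charZero_iff (algebraMap k Ω).injective |>.mpr ‹_›
  refine ⟨fun x hx ↦ ?_⟩
  by_contra hxk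
  by_cases halg : IsIntegral k x
  · -- another root of the minimal polynomial of `x`
    have hsep : (minpoly k x).Separable := (minpoly.irreducible halg).separable
    have hspl : ((minpoly k x).map (algebraMap k Ω)).Splits := IsAlgClosed.splits _
    have hcard := Polynomial.card_rootSet_eq_natDegree hsep hspl
    have hdeg : 1 < (minpoly k x).natDegree := by
      have h1 := minpoly.natDegree_pos halg
      rcases lt_or_eq_of_le (Nat.succ_le_of_lt h1) with h | h
      · exact h
      · exact absurd (minpoly.mem_range_of_degree_eq_one k x (by
          rw [Polynomial.degree_eq_natDegree (minpoly.ne_zero halg), ← h]; rfl)) hxk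
    rw [← hcard, Fintype.one_lt_card_iff] at hdeg
    obtain ⟨a, b, hab⟩ := hdeg
    obtain ⟨y, hy, hyx⟩ : ∃ y, y ∈ (minpoly k x).rootSet Ω ∧ y ≠ x := by
      by_cases ha : (a : Ω) = x
      · exact ⟨b, b.2, fun hb ↦ hab (Subtype.ext (ha.trans hb.symm))⟩
      · exact ⟨a, a.2, ha⟩
    let P := AdjoinRoot (minpoly k x)
    have : Fact (Irreducible (minpoly k x)) := ⟨minpoly.irreducible halg⟩
    have hy0 : Polynomial.aeval y (minpoly k x) = 0 := (Polynomial.mem_rootSet.mp hy).2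
    let u : P →ₐ[k] Ω := AdjoinRoot.liftAlgHom _ (Algebra.ofId k Ω) x (minpoly.aeval k x)
    let v : P →ₐ[k] Ω := AdjoinRoot.liftAlgHom _ (Algebra.ofId k Ω) y hy0
    have : FiniteDimensional k P := (AdjoinRoot.powerBasis (minpoly.ne_zero halg)).finite
    have hP : Algebra.trdeg k P < ℵ₀ := trdeg_lt_aleph0_of_finiteType
    obtain ⟨ρ, hρ⟩ := exists_algEquiv_comp_eq htr hP u v u.toRingHom.injective
      v.toRingHom.injective
    refine hyx ?_
    have h1 := hρ (AdjoinRoot.root _)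
    have h2 : u (AdjoinRoot.root _) = x := AdjoinRoot.liftAlgHom_root ..
    have h3 : v (AdjoinRoot.root _) = y := AdjoinRoot.liftAlgHom_root ..
    rw [h2, h3] at h1
    rw [← h1]
    exact hx ρ
  · have htx : Transcendental k x := fun h ↦ halg h.isIntegral
    have htx1 : Transcendental k (x + 1) := fun h ↦ htx (by
      simpa using h.sub (isAlgebraic_one (R := k) (A := Ω)))
    have hP : Algebra.trdeg k (Polynomial k) < ℵ₀ := trdeg_lt_aleph0_of_finiteType
    obtain ⟨ρ, hρ⟩ := exists_algEquiv_comp_eq htr hP (Polynomial.aeval x)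
      (Polynomial.aeval (x + 1)) (transcendental_iff_injective.mp htx)
      (transcendental_iff_injective.mp htx1)
    have h1 := hρ Polynomial.X
    simp only [Polynomial.aeval_X] at h1
    have h2 : ρ x = x := hx ρ
    rw [h2] at h1
    simp at h1

/-- A finitely generated domain over a field `E` embeds over `E` into every algebraically closed
field of infinite transcendence degree. -/
lemma exists_algHom_injective_of_trdeg {E : Type u} [Field E] [Algebra E Ω] [IsAlgClosed Ω]
    (htr : ℵ₀ ≤ Algebra.trdeg E Ω) {Q : Type u} [CommRing Q] [IsDomain Q] [Algebra E Q]
    (hQ : Algebra.trdeg E Q < ℵ₀) : ∃ f : Q →ₐ[E] Ω, Function.Injective f := by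
  obtain ⟨s, hs⟩ := exists_isTranscendenceBasis E Q
  obtain ⟨t, ht⟩ := exists_isTranscendenceBasis E Ω
  have hst : #s ≤ #t := by
    rw [hs.cardinalMk_eq_trdeg, ht.cardinalMk_eq_trdeg]
    exact hQ.le.trans htr
  obtain ⟨e⟩ := Cardinal.le_def _ _ |>.mp hst
  let A := Algebra.adjoin E (Set.range ((↑) : s → Q))
  let g : A →ₐ[E] Ω :=
    (MvPolynomial.aeval fun i ↦ (e i : Ω)).comp hs.1.aevalEquiv.symm.toAlgHom
  have he : Function.Injective (MvPolynomial.aeval fun i ↦ (e i : Ω) : MvPolynomial s E →ₐ[E] Ω) :=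
    ht.1.comp e e.injective
  have hg : Function.Injective g := he.comp hs.1.aevalEquiv.symm.injective
  let := g.toRingHom.toAlgebra
  have : IsScalarTower E A Ω := .of_algebraMap_eq fun x ↦ (g.commutes x).symm
  have : Algebra.IsAlgebraic A Q := hs.isAlgebraic
  have : FaithfulSMul A Ω := (faithfulSMul_iff_algebraMap_injective A Ω).mpr hg
  have : Module.IsTorsionFree A Ω := Module.isTorsionFree_iff_algebraMap_injective.mpr hg
  let f : Q →ₐ[A] Ω := IsAlgClosed.lift
  refine ⟨f.restrictScalars E, ?_⟩
  have : Function.Injective f := by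
    rw [injective_iff_map_eq_zero]
    intro q hq
    by_contra hq0
    obtain ⟨a, ha0, ha⟩ := (Algebra.IsAlgebraic.isAlgebraic (R := A) q).exists_nonzero_dvd
      (mem_nonZeroDivisors_of_ne_zero hq0)
    obtain ⟨c, hc⟩ := ha
    have h1 : f (algebraMap A Q a) = 0 := by rw [hc, map_mul, hq, zero_mul]
    rw [f.commutes] at h1
    exact ha0 (hg (h1.trans (map_zero g).symm))
  exact this

/-- An automorphism `σ` moving a finitely generated algebra `R ⊆ Ω` to one that is linearly
disjoint from a given field `E` of finite transcendence degree. -/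
lemma exists_algEquiv_productMap_injective_of_field [IsAlgClosed k] [IsAlgClosed Ω]
    (htr : ℵ₀ ≤ Algebra.trdeg k Ω) (E : IntermediateField k Ω) (hE : Algebra.trdeg k E < ℵ₀)
    (R : Subalgebra k Ω) (hR : R.FG) :
    ∃ σ : Ω ≃ₐ[k] Ω, Function.Injective
      (Algebra.TensorProduct.productMap E.val (σ.toAlgHom.comp R.val)) := by
  have : Algebra.FiniteType k R := R.fg_iff_finiteType.mp hR
  have := isDomain_tensorProduct (κ := k) (R := R) E
  have hE' : Algebra.trdeg E Ω = Algebra.trdeg k Ω := trdeg_eq_of_trdeg_lt htr hE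
  obtain ⟨f, hf⟩ := exists_algHom_injective_of_trdeg (E := E) (Ω := Ω) (hE' ▸ htr)
    (Q := E ⊗[k] R) trdeg_lt_aleph0_of_finiteType
  let j : R →ₐ[k] Ω := (f.restrictScalars k).comp Algebra.TensorProduct.includeRight
  have hj : Function.Injective j := hf.comp
    (Algebra.TensorProduct.includeRight_injective (algebraMap k E).injective)
  obtain ⟨σ, hσ⟩ := exists_algEquiv_comp_eq htr (P := R) trdeg_lt_aleph0_of_finiteType R.val j
    Subtype.val_injective hj
  refine ⟨σ, ?_⟩
  convert hf using 1
  ext x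
  induction x with
  | zero => simp
  | add a b ha hb => simp [ha, hb]
  | tmul a r =>
    have h1 : σ (r : Ω) = f (1 ⊗ₜ r) := hσ r
    have h2 : (a ⊗ₜ[k] r : E ⊗[k] R) = a • (1 ⊗ₜ[k] r) := by simp [TensorProduct.smul_tmul']
    have h3 : f (a ⊗ₜ[k] r) = a • σ (r : Ω) := by rw [h2, h1]; exact f.toLinearMap.map_smul _ _
    rw [h3, Algebra.smul_def]
    simp

/-- An automorphism `σ` moving a finitely generated algebra `R ⊆ Ω` to one that is linearly
disjoint from a given finitely generated algebra `A`. -/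
lemma exists_algEquiv_productMap_injective [IsAlgClosed k] [IsAlgClosed Ω]
    (htr : ℵ₀ ≤ Algebra.trdeg k Ω) (A R : Subalgebra k Ω) (hA : A.FG) (hR : R.FG) :
    ∃ σ : Ω ≃ₐ[k] Ω, Function.Injective
      (Algebra.TensorProduct.productMap A.val (σ.toAlgHom.comp R.val)) := by
  let E : IntermediateField k Ω := IntermediateField.adjoin k (A : Set Ω)
  have hE : E.FG := by
    obtain ⟨s, rfl⟩ := hA
    refine ⟨s, le_antisymm (IntermediateField.adjoin.mono _ _ _ Algebra.subset_adjoin) ?_⟩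
    rw [IntermediateField.adjoin_le_iff]
    exact IntermediateField.algebra_adjoin_le_adjoin _ _
  have : Algebra.EssFiniteType k E := (IntermediateField.essFiniteType_iff).mpr hE
  obtain ⟨σ, hσ⟩ := exists_algEquiv_productMap_injective_of_field htr E (trdeg_lt_aleph0 k E) R hR
  refine ⟨σ, ?_⟩
  have hAE : A ≤ E.toSubalgebra := IntermediateField.subset_adjoin k (A : Set Ω)
  let i : A →ₐ[k] E := Subalgebra.inclusion hAE
  have hi : Function.Injective (Algebra.TensorProduct.map i (AlgHom.id k R)) :=
    Module.Flat.rTensor_preserves_injective_linearMap i.toLinearMap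
      (Subalgebra.inclusion_injective hAE)
  convert hσ.comp hi using 1
  ext x
  induction x with
  | zero => simp
  | add a b ha hb => simp_all
  | tmul a r => simp [i, show ((Subalgebra.inclusion hAE a : E.toSubalgebra) : Ω) = a from rfl]

lemma trdeg_lt_aleph0_of_isAlgebraic {K P : Type u} [Field K] [CommRing P] [IsDomain P]
    [Algebra k K] [Algebra K P] [Algebra k P] [IsScalarTower k K P] [Algebra.IsAlgebraic k K]
    [Algebra.FiniteType K P] : Algebra.trdeg k P < ℵ₀ := by
  have : FaithfulSMul K P := (faithfulSMul_iff_algebraMap_injective K P).mpr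
    (algebraMap K P).injective
  rw [← trdeg_add_eq k K (A := P), trdeg_eq_zero, zero_add]
  exact trdeg_lt_aleph0_of_finiteType

/-- Let `K` be a normal extension of `k` in `Ω`. An automorphism `τ` that fixes the coefficients of
generators of the ideal of relations over `K` between the elements of `S` preserves that ideal.
Hence some automorphism agrees with `τ` on `K` and fixes `S`. These coefficients lie in a finite
normal extension `k₁` of `k`. -/
lemma exists_finite_normal_forall_exists [IsAlgClosed Ω] (htr : ℵ₀ ≤ Algebra.trdeg k Ω)
    (K : Type u) [Field K] [Algebra k K] [Algebra K Ω] [IsScalarTower k K Ω] [Normal k K]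
    (S : Finset Ω) :
    ∃ k₁ : IntermediateField k Ω, FiniteDimensional k k₁ ∧ Normal k k₁ ∧
      ∀ τ ∈ k₁.fixingSubgroup, ∃ ρ : Ω ≃ₐ[k] Ω, (∀ s ∈ S, ρ s = s) ∧
        ∀ c : K, ρ (algebraMap K Ω c) = τ (algebraMap K Ω c) := by
  classical
  let ev : MvPolynomial S K →ₐ[K] Ω := MvPolynomial.aeval fun s ↦ (s : Ω)
  let I : Ideal (MvPolynomial S K) := RingHom.ker ev
  obtain ⟨G, hG⟩ : I.FG := IsNoetherian.noetherian I
  let C : Set Ω := ⋃ g ∈ G, (fun m ↦ algebraMap K Ω (MvPolynomial.coeff m g)) ''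
    (g.support : Set (S →₀ ℕ))
  have hC : C.Finite := G.finite_toSet.biUnion fun g _ ↦ g.support.finite_toSet.image _
  have hint : ∀ x ∈ C, IsIntegral k x := by
    intro x hx
    simp only [C, Set.mem_iUnion] at hx
    obtain ⟨g, -, m, -, rfl⟩ := hx
    exact (Normal.isIntegral (F := k) (K := K) inferInstance _).algebraMap
  let q : Polynomial k := ∏ c ∈ hC.toFinset, minpoly k c
  have hq : q ≠ 0 := Finset.prod_ne_zero_iff.mpr fun c hc ↦
    minpoly.ne_zero (hint c (hC.mem_toFinset.mp hc))
  let k₁ : IntermediateField k Ω := IntermediateField.adjoin k (q.rootSet Ω)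
  have hsplit : Polynomial.IsSplittingField k k₁ q :=
    IntermediateField.adjoin_rootSet_isSplittingField (IsAlgClosed.splits _)
  have hfin : FiniteDimensional k k₁ := Polynomial.IsSplittingField.finiteDimensional k₁ q
  have hnorm : Normal k k₁ := Normal.of_isSplittingField q
  have hle : ∀ c ∈ C, c ∈ k₁ := fun c hc ↦ by
    refine IntermediateField.subset_adjoin _ _ ?_
    rw [Polynomial.mem_rootSet]
    refine ⟨hq, ?_⟩
    rw [map_prod]
    exact Finset.prod_eq_zero (hC.mem_toFinset.mpr hc) (minpoly.aeval k c)
  refine ⟨k₁, hfin, hnorm, fun τ hτ ↦ ?_⟩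
  let m (τ : Ω ≃ₐ[k] Ω) : MvPolynomial S K →+* MvPolynomial S K :=
    MvPolynomial.map (τ.restrictNormal K : K →+* K)
  have hfix : ∀ τ ∈ k₁.fixingSubgroup, ∀ g ∈ G, m τ g = g := by
    intro τ hτ g hg
    ext n
    rw [MvPolynomial.coeff_map]
    by_cases hn : n ∈ g.support
    · refine (algebraMap K Ω).injective ?_
      refine (AlgEquiv.restrictNormal_commutes τ K (MvPolynomial.coeff n g)).trans ?_
      refine (IntermediateField.mem_fixingSubgroup_iff _ _).mp hτ _ (hle _ ?_)
      exact Set.mem_biUnion hg ⟨n, hn, rfl⟩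
    · rw [MvPolynomial.notMem_support_iff.mp hn, map_zero]
  have hmI : ∀ τ ∈ k₁.fixingSubgroup, I ≤ I.comap (m τ) := by
    intro τ hτ
    rw [← hG, Ideal.span_le]
    intro g hg
    change m τ g ∈ Ideal.span _
    rw [hfix τ hτ g hg]
    exact Ideal.subset_span hg
  have hinv : ∀ p, m τ⁻¹ (m τ p) = p := by
    intro p
    simp only [m, MvPolynomial.map_map]
    convert MvPolynomial.map_id p
    ext c
    have h1 := AlgEquiv.restrictNormal_commutes τ⁻¹ K (τ.restrictNormal K c)
    have h2 := AlgEquiv.restrictNormal_commutes τ K c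
    refine (algebraMap K Ω).injective ?_
    refine h1.trans ?_
    refine (congrArg _ h2).trans ?_
    exact τ.symm_apply_apply _
  -- the two embeddings of `K[S]`: the inclusion, and the one that is `τ` on `K` and fixes `S`
  let v₀ : MvPolynomial S K →ₐ[k] Ω :=
    { (ev : MvPolynomial S K →+* Ω).comp (m τ) with
      commutes' := fun c ↦ by
        have : m τ (algebraMap k _ c) = algebraMap k _ c := by
          rw [IsScalarTower.algebraMap_apply k K, MvPolynomial.algebraMap_eq,
            MvPolynomial.map_C]
          congr 1
          exact (τ.restrictNormal K).commutes c
        change ev (m τ (algebraMap k _ c)) = _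
        rw [this]
        exact (ev.restrictScalars k).commutes c }
  let P := MvPolynomial S K ⧸ I
  let u : P →ₐ[K] Ω := Ideal.kerLiftAlg ev
  have hu : Function.Injective u := Ideal.kerLiftAlg_injective ev
  have hv₀ : ∀ p, p ∈ I ↔ v₀ p = 0 := by
    refine fun p ↦ ⟨fun hp ↦ hmI τ hτ hp, fun hp ↦ ?_⟩
    have : m τ⁻¹ (m τ p) ∈ I := hmI τ⁻¹ (inv_mem hτ) hp
    rwa [hinv] at this
  let v : P →ₐ[k] Ω := Ideal.Quotient.liftₐ I v₀ fun p hp ↦ (hv₀ p).mp hp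
  have hv : Function.Injective v := by
    rw [injective_iff_map_eq_zero]
    intro p hp
    obtain ⟨p, rfl⟩ := Ideal.Quotient.mk_surjective p
    exact Ideal.Quotient.eq_zero_iff_mem.mpr ((hv₀ p).mpr hp)
  have : IsDomain P := hu.isDomain (u : P →+* Ω)
  have hP : Algebra.trdeg k P < ℵ₀ := trdeg_lt_aleph0_of_isAlgebraic (K := K)
  obtain ⟨ρ, hρ⟩ := exists_algEquiv_comp_eq htr hP (u.restrictScalars k) v hu hv
  refine ⟨ρ, fun s hs ↦ ?_, fun c ↦ ?_⟩
  · have := hρ (Ideal.Quotient.mk I (MvPolynomial.X ⟨s, hs⟩))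
    have h1 : u (Ideal.Quotient.mk I (MvPolynomial.X ⟨s, hs⟩)) = s :=
      MvPolynomial.aeval_X _ _
    have h2 : v (Ideal.Quotient.mk I (MvPolynomial.X ⟨s, hs⟩)) = s := by
      change ev (m τ (MvPolynomial.X ⟨s, hs⟩)) = s
      rw [MvPolynomial.map_X]
      exact MvPolynomial.aeval_X _ _
    exact (congrArg ρ h1).symm.trans (this.trans h2)
  · have := hρ (Ideal.Quotient.mk I (MvPolynomial.C c))
    have h1 : u (Ideal.Quotient.mk I (MvPolynomial.C c)) = algebraMap K Ω c :=
      MvPolynomial.aeval_C _ _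
    have h2 : v (Ideal.Quotient.mk I (MvPolynomial.C c)) = τ (algebraMap K Ω c) := by
      change ev (m τ (MvPolynomial.C c)) = _
      rw [MvPolynomial.map_C]
      refine (MvPolynomial.aeval_C _ _).trans ?_
      exact AlgEquiv.restrictNormal_commutes τ K c
    exact (congrArg ρ h1).symm.trans (this.trans h2)

/-- A group of automorphisms containing the stabilizers of the algebraic closure of `k` and of a
finitely generated extension of `k` contains the stabilizer of a finite normal extension of `k`. -/
lemma exists_finite_normal_fixingSubgroup_le [IsAlgClosed Ω] (htr : ℵ₀ ≤ Algebra.trdeg k Ω)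
    (H : Subgroup (Ω ≃ₐ[k] Ω)) (hκ : (algebraicClosure k Ω).fixingSubgroup ≤ H)
    (L : IntermediateField k Ω) (hL : L.FG) (hLH : L.fixingSubgroup ≤ H) :
    ∃ k₁ : IntermediateField k Ω, FiniteDimensional k k₁ ∧ Normal k k₁ ∧
      k₁.fixingSubgroup ≤ H := by
  obtain ⟨S, rfl⟩ := hL
  have : Normal k (algebraicClosure k Ω) := IsAlgClosure.normal k _
  obtain ⟨k₁, h1, h2, h3⟩ := exists_finite_normal_forall_exists htr (algebraicClosure k Ω) S
  refine ⟨k₁, h1, h2, fun τ hτ ↦ ?_⟩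
  obtain ⟨ρ, hS, hρ⟩ := h3 τ hτ
  have hρS : ρ ∈ (IntermediateField.adjoin k (S : Set Ω)).fixingSubgroup := by
    rw [IntermediateField.mem_fixingSubgroup_iff]
    intro x hx
    induction hx using IntermediateField.adjoin_induction with
    | mem x hx => exact hS x hx
    | algebraMap x => exact ρ.commutes x
    | add x y _ _ hx hy => simp_all
    | inv x _ hx => simp_all
    | mul x y _ _ hx hy => simp_all
  -- `τ` is the product of `ρ`, which fixes `L`, and an automorphism that fixes the closure of `k`
  have hρκ : ρ⁻¹ * τ ∈ (algebraicClosure k Ω).fixingSubgroup := by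
    rw [IntermediateField.mem_fixingSubgroup_iff]
    intro c hc
    change ρ.symm (τ c) = c
    rw [ρ.symm_apply_eq]
    exact (hρ ⟨c, hc⟩).symm
  have := H.mul_mem (hLH hρS) (hκ hρκ)
  rwa [mul_inv_cancel_left] at this

end Extension

/-! ### Projective space over a ring -/

section ProjectiveSpace

open HomogeneousLocalization MvPolynomial

attribute [local instance] MvPolynomial.gradedAlgebra

variable (n : ℕ)

/-- The homogeneous polynomials in `X₀, …, Xₙ`, as a grading. -/
abbrev homog (A : Type u) [CommRing A] : ℕ → Submodule A (MvPolynomial (Fin (n + 1)) A) :=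
  homogeneousSubmodule (Fin (n + 1)) A

/-- Projective space `Proj A[X₀, …, Xₙ]` over a ring. -/
noncomputable abbrev Pn (A : Type u) [CommRing A] : Scheme.{u} := Proj (homog n A)

/-- The structure morphism of projective space. -/
noncomputable def Pn.toSpec (A : Type u) [CommRing A] : Pn n A ⟶ Spec (.of A) :=
  Proj.toSpecZero (homog n A) ≫ Spec.map (CommRingCat.ofHom (algebraMap A (homog n A 0)))

variable {n}

/-- A ring homomorphism applied to the coefficients of polynomials, as a graded homomorphism. -/
noncomputable def homogMap {A B : Type u} [CommRing A] [CommRing B] (φ : A →+* B) :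
    homog n A →+*ᵍ homog n B where
  __ := MvPolynomial.map φ
  map_mem hx := IsHomogeneous.map hx φ

@[simp]
lemma homogMap_apply {A B : Type u} [CommRing A] [CommRing B] (φ : A →+* B)
    (p : MvPolynomial (Fin (n + 1)) A) : homogMap φ p = MvPolynomial.map φ p := rfl

lemma irrelevant_le_span_X (A : Type u) [CommRing A] :
    (HomogeneousIdeal.irrelevant (homog n A)).toIdeal ≤
      Ideal.span (Set.range (X : Fin (n + 1) → MvPolynomial (Fin (n + 1)) A)) := by
  rw [HomogeneousIdeal.toIdeal_irrelevant_le]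
  intro i hi p hp
  rw [← Set.image_univ]
  refine (mem_ideal_span_X_image (s := Set.univ)).mpr fun m hm ↦ ?_
  by_contra! h
  have h0 : m = 0 := Finsupp.ext fun j ↦ h j trivial
  have := (mem_homogeneousSubmodule _ _).mp hp (mem_support_iff.mp hm)
  rw [h0, map_zero] at this
  omega

lemma X_mem_homog (A : Type u) [CommRing A] (i : Fin (n + 1)) :
    (X i : MvPolynomial (Fin (n + 1)) A) ∈ homog n A 1 := isHomogeneous_X A i

lemma irrelevant_le_map {A B : Type u} [CommRing A] [CommRing B] (φ : A →+* B) :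
    HomogeneousIdeal.irrelevant (homog n B) ≤
      (HomogeneousIdeal.irrelevant (homog n A)).map (homogMap φ) := by
  change (HomogeneousIdeal.irrelevant (homog n B)).toIdeal ≤ Ideal.map (homogMap φ) _
  refine (irrelevant_le_span_X B).trans (Ideal.span_le.mpr ?_)
  rintro _ ⟨i, rfl⟩
  have : (homogMap φ) (X i) = (X i : MvPolynomial (Fin (n + 1)) B) := map_X _ _
  rw [← this]
  exact Ideal.mem_map_of_mem _
    (HomogeneousIdeal.mem_irrelevant_of_mem _ one_pos (X_mem_homog A i))

/-- Functoriality of projective space in the base ring: `φ : A → B` induces `Pⁿ_B ⟶ Pⁿ_A`. For an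
automorphism of `A` this is the action on projective space through the coefficients. -/
noncomputable def Pn.map {A B : Type u} [CommRing A] [CommRing B] (φ : A →+* B) :
    Pn n B ⟶ Pn n A :=
  Proj.map (homogMap φ) (irrelevant_le_map φ)

lemma Pn.map_comp {A B C : Type u} [CommRing A] [CommRing B] [CommRing C] (φ : A →+* B)
    (ψ : B →+* C) : Pn.map (n := n) (ψ.comp φ) = Pn.map ψ ≫ Pn.map φ := by
  refine Eq.trans ?_ (Proj.map_comp (homogMap φ) (homogMap ψ) (irrelevant_le_map φ)
    (irrelevant_le_map ψ))
  have : homogMap (n := n) (ψ.comp φ) = (homogMap ψ).comp (homogMap φ) := by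
    ext p
    simp [MvPolynomial.map_map]
  unfold Pn.map
  congr 1

lemma Pn.map_id (A : Type u) [CommRing A] : Pn.map (n := n) (RingHom.id A) = 𝟙 _ := by
  refine Eq.trans ?_ (Proj.map_id (𝒜 := homog n A))
  have : homogMap (n := n) (RingHom.id A) = .id _ := by
    ext p
    simp [MvPolynomial.map_id]
  unfold Pn.map
  congr 1

/-- The structure map from the base ring to the ring of degree zero fractions with denominators
powers of `f`. -/
noncomputable def awayC {A : Type u} [CommRing A] (f : MvPolynomial (Fin (n + 1)) A) :
    A →+* Away (homog n A) f :=
  (fromZeroRingHom (homog n A) _).comp (algebraMap A (homog n A 0))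

lemma awayι_toSpec {A : Type u} [CommRing A] (f : MvPolynomial (Fin (n + 1)) A) {d : ℕ}
    (hf : f ∈ homog n A d) (hd : 0 < d) :
    Proj.awayι (homog n A) f hf hd ≫ Pn.toSpec n A = Spec.map (CommRingCat.ofHom (awayC f)) := by
  rw [Pn.toSpec, ← Category.assoc, Proj.awayι_toSpecZero, ← Spec.map_comp, ← CommRingCat.ofHom_comp]
  rfl

lemma val_awayC {A : Type u} [CommRing A] (f : MvPolynomial (Fin (n + 1)) A) (a : A) :
    (awayC f a).val = algebraMap (MvPolynomial (Fin (n + 1)) A) (Localization.Away f) (C a) := by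
  rw [← Localization.mk_one_eq_algebraMap]
  rfl

lemma eval₂_mul_of_isHomogeneous {σ : Type*} {A B : Type*} [CommRing A] [CommRing B]
    {p : MvPolynomial σ A} {N : ℕ} (hp : p.IsHomogeneous N) (g : A →+* B) (u : B) (y : σ → B) :
    eval₂ g (fun j ↦ u * y j) p = u ^ N * eval₂ g y p := by
  rw [eval₂_eq, eval₂_eq, Finset.mul_sum]
  refine Finset.sum_congr rfl fun m hm ↦ ?_
  have h1 := hp (mem_support_iff.mp hm)
  simp only [mul_pow, Finset.prod_mul_distrib, Finset.prod_pow_eq_pow_sum]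
  have h2 : ∑ i ∈ m.support, m i = N := by
    rw [← h1]; simp [Finsupp.weight_apply, Finsupp.sum]
  rw [h2]
  ring

/-- A degree zero fraction is a polynomial in the fractions `Xⱼ / Xᵢ`. -/
lemma away_mk_eq_eval₂ {A : Type u} [CommRing A] (i : Fin (n + 1)) (N : ℕ)
    (p : MvPolynomial (Fin (n + 1)) A) (hp : p ∈ homog n A (N • 1)) :
    Away.mk (homog n A) (X_mem_homog A i) N p hp =
      eval₂ (awayC (X i)) (fun j ↦ Away.mk (homog n A) (X_mem_homog A i) 1 (X j)
        (X_mem_homog A j)) p := by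
  apply val_injective
  let L := Localization.Away (X i : MvPolynomial (Fin (n + 1)) A)
  change _ = algebraMap (Away (homog n A) (X i)) L _
  rw [eval₂_comp_left]
  have h1 : (algebraMap (Away (homog n A) (X i)) L).comp (awayC (X i)) =
      (algebraMap (MvPolynomial (Fin (n + 1)) A) L).comp C := by
    ext a; exact val_awayC _ _
  have h2 : (algebraMap (Away (homog n A) (X i)) L) ∘
      (fun j ↦ Away.mk (homog n A) (X_mem_homog A i) 1 (X j) (X_mem_homog A j)) =
      fun j ↦ IsLocalization.Away.invSelf (S := L) (X i : MvPolynomial (Fin (n + 1)) A) *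
        algebraMap (MvPolynomial (Fin (n + 1)) A) L (X j) := by
    ext j
    refine (Away.val_mk (homog n A) 1 (X_mem_homog A i) (X j) (X_mem_homog A j)).trans ?_
    rw [Localization.mk_eq_mk'_apply, mul_comm, IsLocalization.Away.invSelf]
    refine (IsLocalization.mk'_eq_mul_mk'_one (X j) _).trans ?_
    simp only [pow_one]
    rfl
  rw [h1, h2, eval₂_mul_of_isHomogeneous (N := N) (by simpa using hp)]
  have h3 : eval₂ ((algebraMap (MvPolynomial (Fin (n + 1)) A) L).comp C)
      (fun j ↦ algebraMap (MvPolynomial (Fin (n + 1)) A) L (X j)) p =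
      algebraMap (MvPolynomial (Fin (n + 1)) A) L p := by
    exact (eval₂_comp_left (algebraMap (MvPolynomial (Fin (n + 1)) A) L)
      C X p).symm.trans (congrArg _ (eval₂_eta p))
  rw [h3, Away.val_mk, Localization.mk_eq_mk'_apply, mul_comm, IsLocalization.mk'_eq_iff_eq_mul,
    mul_assoc]
  rw [map_pow, ← mul_pow, mul_comm _ (algebraMap _ _ (X i)), IsLocalization.Away.mul_invSelf,
    one_pow, mul_one]

/-- The ring of the standard chart `Xᵢ ≠ 0` is generated by scalars and the fractions `Xⱼ / Xᵢ`. -/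
lemma away_hom_ext {A B : Type u} [CommRing A] [CommRing B] (i : Fin (n + 1))
    (g₁ g₂ : Away (homog n A) (X i) →+* B) (hC : g₁.comp (awayC (X i)) = g₂.comp (awayC (X i)))
    (hX : ∀ j, g₁ (Away.mk (homog n A) (X_mem_homog A i) 1 (X j) (X_mem_homog A j)) =
      g₂ (Away.mk (homog n A) (X_mem_homog A i) 1 (X j) (X_mem_homog A j))) : g₁ = g₂ := by
  ext x
  obtain ⟨N, p, hp, rfl⟩ := Away.mk_surjective _ (X_mem_homog A i) x
  rw [away_mk_eq_eval₂, eval₂_comp_left, eval₂_comp_left, hC]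
  congr 1
  ext j
  exact hX j

/-- A homomorphism out of the ring of the standard chart `Xᵢ ≠ 0` may be prescribed freely on the
scalars and on the fractions `Xⱼ / Xᵢ` with `j ≠ i`. -/
lemma exists_away_hom {A B : Type u} [CommRing A] [CommRing B] (i : Fin (n + 1))
    (g : A →+* B) (b : Fin (n + 1) → B) (hb : b i = 1) :
    ∃ φ : Away (homog n A) (X i) →+* B, φ.comp (awayC (X i)) = g ∧
      ∀ j, φ (Away.mk (homog n A) (X_mem_homog A i) 1 (X j) (X_mem_homog A j)) = b j := by
  let e : MvPolynomial (Fin (n + 1)) A →+* B := eval₂Hom g b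
  have he : e (X i) = 1 := by simp [e, hb]
  have hu : IsUnit (e (X i)) := he ▸ isUnit_one
  let ψ : Localization.Away (X i : MvPolynomial (Fin (n + 1)) A) →+* B :=
    IsLocalization.Away.lift (X i) hu
  refine ⟨ψ.comp (algebraMap _ _), ?_, fun j ↦ ?_⟩
  · ext a
    simp only [RingHom.comp_apply, HomogeneousLocalization.algebraMap_apply, val_awayC]
    simp [ψ, e]
  · simp only [RingHom.comp_apply, HomogeneousLocalization.algebraMap_apply, Away.val_mk]
    rw [Localization.mk_eq_mk'_apply]
    have : ψ (IsLocalization.mk' _ (X j) (⟨X i ^ 1, 1, rfl⟩ :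
        Submonoid.powers (X i : MvPolynomial (Fin (n + 1)) A))) * e (X i ^ 1) = e (X j) := by
      have h := IsLocalization.mk'_spec (Localization.Away (X i : MvPolynomial (Fin (n + 1)) A))
        (X j) (⟨X i ^ 1, 1, rfl⟩ : Submonoid.powers (X i : MvPolynomial (Fin (n + 1)) A))
      have := congrArg ψ h
      rwa [map_mul, IsLocalization.Away.lift_eq, IsLocalization.Away.lift_eq] at this
    rw [map_pow, he, one_pow, mul_one] at this
    refine this.trans ?_
    simp [e]

/-- Base change for the standard chart `Xᵢ ≠ 0`. The denominator `s = Xᵢ` over `B` is a variable, so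
that the lemma applies to the image of `Xᵢ` under a map of polynomial rings without rewriting. -/
lemma isPushout_away {A B : Type u} [CommRing A] [CommRing B] (φ : A →+* B) (i : Fin (n + 1))
    (s : MvPolynomial (Fin (n + 1)) B) (hs : s = X i)
    (m : Away (homog n A) (X i) →+* Away (homog n B) s)
    (hm : m.comp (awayC (X i)) = (awayC s).comp φ)
    (hmX : ∀ j, m (Away.mk (homog n A) (X_mem_homog A i) 1 (X j) (X_mem_homog A j)) =
      Away.mk (homog n B) (hs ▸ X_mem_homog B i) 1 (X j) (X_mem_homog B j)) :
    IsPushout (CommRingCat.ofHom (awayC (X i))) (CommRingCat.ofHom φ)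
      (CommRingCat.ofHom m) (CommRingCat.ofHom (awayC s)) := by
  subst hs
  have hone : Away.mk (homog n A) (X_mem_homog A i) 1 (X i) (X_mem_homog A i) = 1 := by
    apply val_injective
    rw [Away.val_mk, val_one, ← Localization.mk_one]
    exact Localization.mk_eq_mk_iff.mpr (Localization.r_of_eq (by simp))
  have hE (t : PushoutCocone (CommRingCat.ofHom (awayC (n := n) (A := A) (X i)))
      (CommRingCat.ofHom φ)) :
      ∃ ψ : Away (homog n B) (X i) →+* t.pt, ψ.comp (awayC (X i)) = t.inr.hom ∧
        ∀ j, ψ (Away.mk (homog n B) (X_mem_homog B i) 1 (X j) (X_mem_homog B j)) =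
          t.inl.hom (Away.mk (homog n A) (X_mem_homog A i) 1 (X j) (X_mem_homog A j)) :=
    exists_away_hom i t.inr.hom
      (fun j ↦ t.inl.hom (Away.mk (homog n A) (X_mem_homog A i) 1 (X j) (X_mem_homog A j)))
      (by rw [hone, map_one])
  choose ψ h1 h2 using hE
  refine ⟨⟨by rw [← CommRingCat.ofHom_comp, hm, CommRingCat.ofHom_comp]⟩,
    ⟨PushoutCocone.IsColimit.mk _ (fun t ↦ CommRingCat.ofHom (ψ t)) ?_ ?_ ?_⟩⟩
  · intro t
    ext1
    refine away_hom_ext i _ _ ?_ fun j ↦ ?_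
    · have := congrArg CommRingCat.Hom.hom t.condition
      simp only [CommRingCat.hom_comp, CommRingCat.hom_ofHom] at this ⊢
      rw [RingHom.comp_assoc, hm, ← RingHom.comp_assoc, h1, this]
    · simp only [CommRingCat.hom_comp, CommRingCat.hom_ofHom, RingHom.comp_apply, hmX]
      exact h2 t j
  · intro t
    ext1
    exact h1 t
  · intro t g hg1 hg2
    ext1
    refine away_hom_ext i _ _ ?_ fun j ↦ ?_
    · refine Eq.trans ?_ (h1 t).symm
      exact congrArg CommRingCat.Hom.hom hg2
    · refine Eq.trans ?_ (h2 t j).symm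
      rw [← hg1]
      simp only [CommRingCat.hom_comp, CommRingCat.hom_ofHom, RingHom.comp_apply, hmX]

lemma awayMap_comp_awayC {A B : Type u} [CommRing A] [CommRing B] (φ : A →+* B)
    (f : MvPolynomial (Fin (n + 1)) A) :
    (Away.map (homogMap φ) f : Away (homog n A) f →+* Away (homog n B) (homogMap φ f)).comp
      (awayC f) = (awayC (homogMap φ f)).comp φ := by
  refine RingHom.ext fun a ↦ ?_
  change HomogeneousLocalization.map (homogMap φ)
    (Submonoid.powers_le.mpr (Submonoid.mem_powers _)) (HomogeneousLocalization.mk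
    ⟨0, algebraMap A (homog n A 0) a, 1, one_mem _⟩) = _
  rw [HomogeneousLocalization.map_mk]
  apply val_injective
  rw [RingHom.comp_apply, val_awayC, val_mk, ← Localization.mk_one_eq_algebraMap]
  congr 1
  · exact MvPolynomial.map_C _ _
  · exact Subtype.ext (map_one _)

lemma Pn.map_toSpec {A B : Type u} [CommRing A] [CommRing B] (φ : A →+* B) :
    Pn.map φ ≫ Pn.toSpec n A = Pn.toSpec n B ≫ Spec.map (CommRingCat.ofHom φ) := by
  refine (Proj.mapAffineOpenCover (homogMap φ) (irrelevant_le_map φ)).openCover.hom_ext _ _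
    fun s ↦ ?_
  change (Σ i : PNat, homog n A i) at s
  obtain ⟨⟨d, hd⟩, ⟨f, hf⟩⟩ := s
  change f ∈ homog n A d at hf
  let ι := Proj.awayι (homog n B) (homogMap φ f) ((homogMap φ).2 hf) hd
  change ι ≫ Proj.map _ _ ≫ _ = ι ≫ _
  rw [Proj.awayι_comp_map_assoc (homogMap φ) (irrelevant_le_map φ) hd _ hf, awayι_toSpec]
  have := awayι_toSpec (homogMap φ f) ((homogMap φ).2 hf) hd
  rw [← Category.assoc]
  refine Eq.trans ?_ (congrArg (· ≫ Spec.map (CommRingCat.ofHom φ)) this).symm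
  rw [← Spec.map_comp, ← Spec.map_comp, ← CommRingCat.ofHom_comp, ← CommRingCat.ofHom_comp,
    awayMap_comp_awayC]

/-- The standard affine open cover of projective space. -/
noncomputable def Pn.cover (A : Type u) [CommRing A] : (Pn n A).AffineOpenCover :=
  Proj.affineOpenCoverOfIrrelevantLESpan (homog n A) (X : Fin (n + 1) → _) (X_mem_homog A)
    (fun _ ↦ one_pos) (irrelevant_le_span_X A)

/-- Projective space over `B` is the base change of projective space over `A`, as can be checked on
the standard charts. -/
lemma Pn.isPullback {A B : Type u} [CommRing A] [CommRing B] (φ : A →+* B) :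
    IsPullback (Pn.map φ) (Pn.toSpec n B) (Pn.toSpec n A) (Spec.map (CommRingCat.ofHom φ)) := by
  refine Scheme.isPullback_of_openCover _ _ _ _ (Pn.cover A).openCover fun i ↦ ?_
  have hX : homogMap φ (X i) = (X i : MvPolynomial (Fin (n + 1)) B) := map_X _ _
  let ιB := Proj.awayι (homog n B) (homogMap φ (X i)) ((homogMap φ).2 (X_mem_homog A i)) one_pos
  change Fin (n + 1) at i
  let ιA := Proj.awayι (homog n A) (X i) (X_mem_homog A i) one_pos
  have h1 : IsPullback (Spec.map (CommRingCat.ofHom (Away.map (homogMap φ) (X i)))) ιB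
      ιA (Pn.map φ) := by
    refine IsOpenImmersion.isPullback _ _ _ _
      (Proj.awayι_comp_map (homogMap φ) (irrelevant_le_map φ) one_pos _ (X_mem_homog A i)) ?_
    refine (congrArg _ (Proj.opensRange_awayι (homog n A) (X i) (X_mem_homog A i) one_pos)).trans ?_
    exact (Proj.opensRange_awayι (homog n B) (homogMap φ (X i)) _ one_pos).symm
  have h2 := isPullback_SpecMap_of_isPushout _ _ _ _ (isPushout_away φ i (homogMap φ (X i)) hX
    (Away.map (homogMap φ) (X i)) (awayMap_comp_awayC φ (X i)) fun j ↦ by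
      rw [Away.map_mk]
      apply val_injective
      rw [Away.val_mk, Away.val_mk]
      congr 1
      exact map_X _ _)
  rw [← awayι_toSpec _ (X_mem_homog A i) one_pos,
    ← awayι_toSpec _ ((homogMap φ).2 (X_mem_homog A i)) one_pos] at h2
  let e := (IsPullback.of_hasPullback (Pn.map φ) ιA).flip.isoIsPullback _ _ h1
  change IsPullback (pullback.snd (Pn.map φ) ιA) (pullback.fst (Pn.map φ) ιA ≫ Pn.toSpec n B)
    (ιA ≫ Pn.toSpec n A) _
  refine h2.of_iso e.symm (Iso.refl _) (Iso.refl _) (Iso.refl _) ?_ ?_ ?_ ?_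
  · rw [Iso.refl_hom, Category.comp_id]
    exact (IsPullback.isoIsPullback_inv_fst _ _ _ _).symm
  · rw [Iso.refl_hom, Category.comp_id]
    exact (IsPullback.isoIsPullback_inv_snd_assoc _ _ _ _ _).symm
  · simp [ιA]
  · simp

end ProjectiveSpace

/-! ### Testing equality of morphisms on fibres -/

section JointlyInjective

/-- Two morphisms from an affine scheme `Spec A` to a separated scheme agree as soon as they agree
along a jointly injective family of ring homomorphisms out of `A`: their equalizer is cut out by
an ideal that every member of the family kills. -/
lemma eq_of_forall_Spec_map_comp_eq {A : CommRingCat.{u}} {ι : Type*} {B : ι → CommRingCat.{u}}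
    (v : ∀ t, A ⟶ B t) (hv : ∀ a : A, (∀ t, (v t).hom a = 0) → a = 0)
    {Y Z : Scheme.{u}} {q₁ q₂ : Spec A ⟶ Y} (h : Y ⟶ Z) [IsSeparated h]
    (e : q₁ ≫ h = q₂ ≫ h) (H : ∀ t, Spec.map (v t) ≫ q₁ = Spec.map (v t) ≫ q₂) : q₁ = q₂ := by
  let d := pullback.lift (f := h) (g := h) q₁ q₂ e
  have hd₁ : d ≫ pullback.fst h h = q₁ := pullback.lift_fst _ _ _
  have hd₂ : d ≫ pullback.snd h h = q₂ := pullback.lift_snd _ _ _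
  have hcl : IsClosedImmersion (pullback.fst d (pullback.diagonal h)) := inferInstance
  obtain ⟨I, e', he'⟩ := IsClosedImmersion.Spec_iff.mp hcl
  have hI : I = ⊥ := by
    refine (Submodule.eq_bot_iff _).mpr fun a ha ↦ hv a fun t ↦ ?_
    let s : Spec (B t) ⟶ pullback d (pullback.diagonal h) :=
      pullback.lift (Spec.map (v t)) (Spec.map (v t) ≫ q₁) (by
        apply pullback.hom_ext <;> simp [hd₁, hd₂, H])
    have hs : Spec.map (v t) = (s ≫ e'.hom) ≫
        Spec.map (CommRingCat.ofHom (Ideal.Quotient.mk I)) := by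
      rw [Category.assoc, ← he', pullback.lift_fst]
    obtain ⟨w, hw⟩ := Spec.map_surjective (s ≫ e'.hom)
    rw [← hw, ← Spec.map_comp] at hs
    rw [Spec.map_injective hs]
    simp [Ideal.Quotient.eq_zero_iff_mem.mpr ha]
  have : IsIso (Spec.map (CommRingCat.ofHom (Ideal.Quotient.mk I))) := by
    have : IsIso (CommRingCat.ofHom (Ideal.Quotient.mk I)) := by
      rw [ConcreteCategory.isIso_iff_bijective]
      refine ⟨?_, Ideal.Quotient.mk_surjective⟩
      refine (RingHom.injective_iff_ker_eq_bot (Ideal.Quotient.mk I)).mpr ?_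
      rw [Ideal.mk_ker, hI]
    infer_instance
  have hiso : IsIso (pullback.fst d (pullback.diagonal h)) := by rw [he']; infer_instance
  have hd : d = inv (pullback.fst d (pullback.diagonal h)) ≫
      pullback.snd d (pullback.diagonal h) ≫ pullback.diagonal h := by
    rw [IsIso.eq_inv_comp, pullback.condition]
  rw [← hd₁, ← hd₂, hd]; simp

/-- Joint injectivity of a family of `F`-points of `C` is preserved by base change. -/
lemma lTensor_jointly_injective {F : Type u} [Field F] {B C : Type u} [CommRing B] [Algebra F B]
    [CommRing C] [Algebra F C] {T : Set (C →ₐ[F] F)} (hT : ∀ c : C, (∀ t ∈ T, t c = 0) → c = 0)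
    (x : B ⊗[F] C) (hx : ∀ t ∈ T, specialize t x = 0) : x = 0 := by
  classical
  let b := Module.Basis.ofVectorSpace F B
  let e := TensorProduct.equivFinsuppOfBasisLeft (N := C) b
  suffices h : e x = 0 from e.map_eq_zero_iff.mp h
  ext i
  refine hT _ fun t ht ↦ ?_
  have key : ∀ y : B ⊗[F] C, b.repr (specialize t y) i = t (e y i) := by
    intro y
    induction y with
    | zero => simp
    | add a b ha hb => simp [ha, hb]
    | tmul m r =>
      rw [specialize_tmul, mul_comm, ← Algebra.smul_def]
      simp [e, mul_comm]
  rw [← key, hx t ht]; simp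

/-- The case of an affine chart `jX` of `X` in `eq_of_forall_section_comp_eq`. -/
lemma pullback_fst_comp_eq_of_forall_section {F C : Type u} [Field F] [CommRing C] [Algebra F C]
    {T : Set (C →ₐ[F] F)} (hT : ∀ c : C, (∀ t ∈ T, t c = 0) → c = 0)
    {X Q Y Z : Scheme.{u}} {f : X ⟶ Spec (.of F)} {p : Q ⟶ X} {c : Q ⟶ Spec (.of C)}
    (hQ : IsPullback p c f (Spec.map (CommRingCat.ofHom (algebraMap F C))))
    {q₁ q₂ : Q ⟶ Y} (h : Y ⟶ Z) [IsSeparated h] (e : q₁ ≫ h = q₂ ≫ h)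
    (H : ∀ t ∈ T, ∀ s : X ⟶ Q, s ≫ p = 𝟙 X →
      s ≫ c = f ≫ Spec.map (CommRingCat.ofHom (t : C →+* F)) → s ≫ q₁ = s ≫ q₂)
    {B : CommRingCat.{u}} (jX : Spec B ⟶ X) :
    pullback.fst p jX ≫ q₁ = pullback.fst p jX ≫ q₂ := by
  obtain ⟨φ, hφ⟩ : ∃ φ : CommRingCat.of F ⟶ B, Spec.map φ = jX ≫ f := Spec.map_surjective _
  let _ : Algebra F B := φ.hom.toAlgebra
  have hφ' : Spec.map (CommRingCat.ofHom (algebraMap F B)) = jX ≫ f := hφ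
  have hP := isPullback_SpecMap_of_isPushout _ _ _ _ (CommRingCat.isPushout_tensorProduct F B C)
  have hP' : IsPullback (pullback.snd p jX) (pullback.fst p jX ≫ c) (jX ≫ f)
      (Spec.map (CommRingCat.ofHom (algebraMap F C))) :=
    (IsPullback.of_hasPullback p jX).flip.paste_vert hQ
  rw [hφ'] at hP
  let E := hP.isoIsPullback _ _ hP'
  suffices hE : E.hom ≫ pullback.fst p jX ≫ q₁ = E.hom ≫ pullback.fst p jX ≫ q₂ from
    (cancel_epi E.hom).mp hE
  refine eq_of_forall_Spec_map_comp_eq (ι := T) (B := fun _ ↦ B)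
    (fun t ↦ CommRingCat.ofHom (specialize (B := B) t.1).toRingHom)
    (fun a ha ↦ lTensor_jointly_injective hT a fun t ht ↦ ha ⟨t, ht⟩) h (by simp [e]) ?_
  rintro ⟨t, ht⟩
  have w : 𝟙 X ≫ f = (f ≫ Spec.map (CommRingCat.ofHom (t : C →+* F))) ≫
      Spec.map (CommRingCat.ofHom (algebraMap F C)) := by
    rw [Category.assoc, ← Spec.map_comp, ← CommRingCat.ofHom_comp]
    simp
  have key := H t ht (hQ.lift (𝟙 X) _ w) (hQ.lift_fst _ _ _) (hQ.lift_snd _ _ _)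
  have hfac : Spec.map (CommRingCat.ofHom (specialize (B := B) t).toRingHom) ≫ E.hom ≫
      pullback.fst p jX = jX ≫ hQ.lift (𝟙 X) _ w := by
    apply hQ.hom_ext
    · simp only [Category.assoc, pullback.condition]
      rw [IsPullback.isoIsPullback_hom_fst_assoc,
        ← Spec.map_comp_assoc, ← CommRingCat.ofHom_comp, hQ.lift_fst]
      have : (specialize (B := B) t).toRingHom.comp
          (Algebra.TensorProduct.includeLeftRingHom : B →+* B ⊗[F] C) = RingHom.id B := by
        ext x; simp
      rw [Category.comp_id, this]
      simp
    · simp only [Category.assoc]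
      rw [IsPullback.isoIsPullback_hom_snd,
        ← Spec.map_comp, ← CommRingCat.ofHom_comp, hQ.lift_snd, ← Category.assoc, ← hφ',
        ← Spec.map_comp, ← CommRingCat.ofHom_comp]
      congr 2
      ext x
      simp [specialize_tmul]
  simp only [← Category.assoc] at hfac ⊢
  rw [hfac, Category.assoc, Category.assoc, key]

/-- Let `Q` be the base change to a ring `C` of a scheme `X` over a field `F`. Two morphisms from
`Q` to a separated scheme agree if they agree on the fibres over a jointly injective family of
`F`-points of `C`. -/
lemma eq_of_forall_section_comp_eq {F C : Type u} [Field F] [CommRing C] [Algebra F C]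
    {T : Set (C →ₐ[F] F)} (hT : ∀ c : C, (∀ t ∈ T, t c = 0) → c = 0)
    {X Q Y Z : Scheme.{u}} {f : X ⟶ Spec (.of F)} {p : Q ⟶ X} {c : Q ⟶ Spec (.of C)}
    (hQ : IsPullback p c f (Spec.map (CommRingCat.ofHom (algebraMap F C))))
    {q₁ q₂ : Q ⟶ Y} (h : Y ⟶ Z) [IsSeparated h] (e : q₁ ≫ h = q₂ ≫ h)
    (H : ∀ t ∈ T, ∀ s : X ⟶ Q, s ≫ p = 𝟙 X →
      s ≫ c = f ≫ Spec.map (CommRingCat.ofHom (t : C →+* F)) → s ≫ q₁ = s ≫ q₂) : q₁ = q₂ :=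
  Scheme.Cover.hom_ext (X.affineCover.pullback₁ p) _ _ fun i ↦
    pullback_fst_comp_eq_of_forall_section hT hQ h e H (X.affineCover.f i)

end JointlyInjective

/-! ### Galois descent of morphisms -/

section FieldDescent

variable {E Ω : Type u} [Field E] [Field Ω] [Algebra E Ω]

/-- Independence of automorphisms: an element of `Ω ⊗_E Ω` is zero if `a ⊗ b ↦ a * ρ b` kills it for
every automorphism `ρ`. Geometrically, the graphs of the automorphisms are dense. -/
lemma tensor_jointly_injective [Algebra.IsInvariant E Ω (Ω ≃ₐ[E] Ω)] (x : Ω ⊗[E] Ω)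
    (hx : ∀ ρ : Ω ≃ₐ[E] Ω, Algebra.TensorProduct.lift (AlgHom.id Ω Ω) (ρ : Ω →ₐ[E] Ω)
      (fun _ _ ↦ .all _ _) x = 0) : x = 0 := by
  classical
  let b := Module.Basis.ofVectorSpace E Ω
  let e := TensorProduct.equivFinsuppOfBasisRight (M := Ω) b
  suffices h : e x = 0 from e.map_eq_zero_iff.mp h
  set s := (e x).support with hs
  have hb : LinearIndepOn (FixedPoints.subfield (Ω ≃ₐ[E] Ω) Ω) id
      ((s.map ⟨b, b.injective⟩ : Finset Ω) : Set Ω) := by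
    rw [Finset.coe_map, Function.Embedding.coeFn_mk]
    refine LinearIndepOn.id_image (linearIndepOn_finset_iff.mpr fun l hl i hi ↦ ?_)
    have hE : ∀ i, ∃ y, algebraMap E Ω y = l i := fun i ↦
      Algebra.IsInvariant.isInvariant (G := Ω ≃ₐ[E] Ω) _ (l i).2
    choose y hy using hE
    have h0 : ∑ i ∈ s, y i • b i = 0 := by
      rw [← hl]
      exact Finset.sum_congr rfl fun i _ ↦ by rw [Algebra.smul_def, hy]; rfl
    have := linearIndependent_iff'.mp b.linearIndependent s y h0 i hi
    rw [Subtype.ext_iff, ← hy, this]; simp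
  have hli := FixedPoints.linearIndependent_smul_of_linearIndependent (Ω ≃ₐ[E] Ω) Ω hb
  rw [Finset.coe_map, Function.Embedding.coeFn_mk] at hli
  have hli' : LinearIndepOn Ω (fun i ↦ MulAction.toFun (Ω ≃ₐ[E] Ω) Ω (b i)) (s : Set _) :=
    hli.comp_of_image b.injective.injOn
  rw [linearIndepOn_finset_iff] at hli'
  have key : ∀ (ρ : Ω ≃ₐ[E] Ω) (y : Ω ⊗[E] Ω),
      Algebra.TensorProduct.lift (AlgHom.id Ω Ω) (ρ : Ω →ₐ[E] Ω) (fun _ _ ↦ .all _ _) y =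
        (e y).sum fun i a ↦ a * ρ (b i) := by
    intro ρ y
    conv_lhs => rw [← e.symm_apply_apply y]
    simp only [e, TensorProduct.equivFinsuppOfBasisRight_symm_apply, Finsupp.sum, map_sum]
    simp
  ext i
  by_cases hi : i ∈ s
  · refine hli' (e x) ?_ i hi
    ext ρ
    have := hx ρ
    rw [key, Finsupp.sum] at this
    simpa using this
  · simpa [hs] using hi

/-- The projection from a base change along a field extension is an fpqc covering, hence an
effective epimorphism. -/
lemma effectiveEpi_of_isPullback {X Y : Scheme.{u}} {f : X ⟶ Spec (.of Ω)} {p : X ⟶ Y}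
    {g : Y ⟶ Spec (.of E)}
    (hp : IsPullback p f g (Spec.map (CommRingCat.ofHom (algebraMap E Ω)))) : EffectiveEpi p := by
  have hS : Surjective p := MorphismProperty.of_isPullback hp.flip inferInstance
  have hF : Flat p := MorphismProperty.of_isPullback hp.flip (by
    rw [Flat.SpecMap_iff]
    exact RingHom.flat_algebraMap_iff.mpr inferInstance)
  have hQC : QuasiCompact p := MorphismProperty.of_isPullback hp.flip inferInstance
  infer_instance

/-- Galois descent of morphisms for the (infinite) extension `Ω / E`: a morphism from the base
change of `Y` to `Ω` which is invariant under the automorphisms of `Ω` over `E` comes from `Y`.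
The map `p` is an effective epimorphism for the fpqc topology, and a morphism out of
`X ×_Y X = X ×_Ω Spec (Ω ⊗ Ω)` is determined by its restrictions to the graphs of the
automorphisms. -/
lemma exists_comp_eq_of_invariant [Algebra.IsInvariant E Ω (Ω ≃ₐ[E] Ω)]
    {X Y W Z : Scheme.{u}} {f : X ⟶ Spec (.of Ω)} {p : X ⟶ Y} {g : Y ⟶ Spec (.of E)}
    (hp : IsPullback p f g (Spec.map (CommRingCat.ofHom (algebraMap E Ω))))
    (act : (Ω ≃ₐ[E] Ω) → (X ⟶ X)) (hact : ∀ ρ, act ρ ≫ p = p)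
    (hact' : ∀ ρ : Ω ≃ₐ[E] Ω, act ρ ≫ f = f ≫ Spec.map (CommRingCat.ofHom (ρ : Ω →+* Ω)))
    (q : X ⟶ W) (h : W ⟶ Z) [IsSeparated h] (r : Y ⟶ Z) (hr : q ≫ h = p ≫ r)
    (hq : ∀ ρ, act ρ ≫ q = q) : ∃ q' : Y ⟶ W, p ≫ q' = q := by
  have := effectiveEpi_of_isPullback hp
  refine ⟨EffectiveEpi.desc p q fun {T} g₁ g₂ hg ↦ ?_, EffectiveEpi.fac _ _ _⟩
  -- `Q` is the product of `X` with itself over `Y`, with projections `a` and `b`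
  let inc : Ω →+* Ω ⊗[E] Ω := algebraMap Ω (Ω ⊗[E] Ω)
  let inr : Ω →+* Ω ⊗[E] Ω := (Algebra.TensorProduct.includeRight : Ω →ₐ[E] Ω ⊗[E] Ω)
  have hinc : inc.comp (algebraMap E Ω) = inr.comp (algebraMap E Ω) := by
    ext x
    simp [inc, inr, Algebra.TensorProduct.algebraMap_apply]
  have hQ := IsPullback.of_hasPullback f (Spec.map (CommRingCat.ofHom inc))
  set Q := pullback f (Spec.map (CommRingCat.ofHom inc))
  set a := pullback.fst f (Spec.map (CommRingCat.ofHom inc))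
  set c := pullback.snd f (Spec.map (CommRingCat.ofHom inc))
  let b : Q ⟶ X := hp.lift (a ≫ p) (c ≫ Spec.map (CommRingCat.ofHom inr)) (by
    rw [Category.assoc, hp.w, reassoc_of% hQ.w, Category.assoc, ← Spec.map_comp, ← Spec.map_comp,
      ← CommRingCat.ofHom_comp, ← CommRingCat.ofHom_comp, hinc])
  have hbp : b ≫ p = a ≫ p := hp.lift_fst _ _ _
  have hbf : b ≫ f = c ≫ Spec.map (CommRingCat.ofHom inr) := hp.lift_snd _ _ _
  have hab : a ≫ q = b ≫ q := by
    refine eq_of_forall_section_comp_eq (T := Set.range fun ρ : Ω ≃ₐ[E] Ω ↦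
      Algebra.TensorProduct.lift (AlgHom.id Ω Ω) (ρ : Ω →ₐ[E] Ω) (fun _ _ ↦ .all _ _))
      (fun x hx ↦ tensor_jointly_injective x fun ρ ↦ hx _ ⟨ρ, rfl⟩) hQ h
      (by rw [Category.assoc, Category.assoc, hr, reassoc_of% hbp]) ?_
    rintro _ ⟨ρ, rfl⟩ s hs₁ hs₂
    have : s ≫ b = act ρ := by
      apply hp.hom_ext
      · rw [Category.assoc, hbp, reassoc_of% hs₁, hact]
      · rw [Category.assoc, hbf, reassoc_of% hs₂, hact', ← Spec.map_comp, ← CommRingCat.ofHom_comp]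
        congr 3
        ext x
        simp [inr]
    rw [reassoc_of% hs₁, reassoc_of% this, hq]
  -- a pair of morphisms to `X` with the same composite to `Y` factors through `Q`
  have hP := isPullback_SpecMap_of_isPushout _ _ _ _ (CommRingCat.isPushout_tensorProduct E Ω Ω)
  let m₀ := hP.lift (g₁ ≫ f) (g₂ ≫ f) (by
    rw [Category.assoc, Category.assoc, ← hp.w, reassoc_of% hg])
  let m : T ⟶ Q := hQ.lift g₁ m₀ (hP.lift_fst _ _ _).symm
  have h₁ : m ≫ a = g₁ := hQ.lift_fst _ _ _
  have h₂ : m ≫ b = g₂ := by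
    apply hp.hom_ext
    · rw [Category.assoc, hbp, reassoc_of% h₁, hg]
    · rw [Category.assoc, hbf, hQ.lift_snd_assoc]
      exact hP.lift_snd _ _ _
  rw [← h₁, ← h₂, Category.assoc, Category.assoc, hab]

end FieldDescent

/-! ### Base change of cofiltered limits -/

section PullbackDiagram

universe v₁ v₂

variable {J : Type v₁} [Category.{v₂} J] {S V : Scheme.{u}}
  (g : V ⟶ S) (D : J ⥤ Scheme.{u}) (t : ∀ j, D.obj j ⟶ S)
  (ht : ∀ {i j : J} (φ : i ⟶ j), D.map φ ≫ t j = t i)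

/-- The base change of a diagram `D` over `S` along a morphism `V ⟶ S`. -/
noncomputable def pullbackDiagram : J ⥤ Scheme.{u} where
  obj j := pullback g (t j)
  map {i j} φ := pullback.lift (pullback.fst g (t i)) (pullback.snd g (t i) ≫ D.map φ) (by
    rw [Category.assoc, ht, pullback.condition])
  map_id j := by
    apply pullback.hom_ext
    · rw [pullback.lift_fst, Category.id_comp]
    · rw [pullback.lift_snd, D.map_id, Category.id_comp, Category.comp_id]
  map_comp φ ψ := by
    apply pullback.hom_ext
    · rw [pullback.lift_fst, Category.assoc, pullback.lift_fst, pullback.lift_fst]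
    · rw [pullback.lift_snd, Category.assoc, pullback.lift_snd, pullback.lift_snd_assoc, D.map_comp,
        Category.assoc]

namespace pullbackDiagram

/-- The projection of the base changed diagram to `V`. -/
noncomputable def fst (j : J) : (pullbackDiagram g D t ht).obj j ⟶ V := pullback.fst g (t j)

/-- The projection of the base changed diagram to the original one. -/
noncomputable def snd (j : J) : (pullbackDiagram g D t ht).obj j ⟶ D.obj j := pullback.snd g (t j)

lemma isPullback (j : J) : IsPullback (fst g D t ht j) (snd g D t ht j) g (t j) :=
  IsPullback.of_hasPullback g (t j)

lemma map_fst {i j : J} (φ : i ⟶ j) :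
    (pullbackDiagram g D t ht).map φ ≫ fst g D t ht j = fst g D t ht i :=
  pullback.lift_fst _ _ _

lemma map_snd {i j : J} (φ : i ⟶ j) :
    (pullbackDiagram g D t ht).map φ ≫ snd g D t ht j = snd g D t ht i ≫ D.map φ :=
  pullback.lift_snd _ _ _

lemma map_snd_assoc {i j : J} (φ : i ⟶ j) {Z : Scheme.{u}} (h : D.obj j ⟶ Z) :
    (pullbackDiagram g D t ht).map φ ≫ snd g D t ht j ≫ h =
      snd g D t ht i ≫ D.map φ ≫ h := by
  rw [← Category.assoc, map_snd, Category.assoc]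

lemma isPullback_map {i j : J} (φ : i ⟶ j) :
    IsPullback ((pullbackDiagram g D t ht).map φ) (snd g D t ht i) (snd g D t ht j)
      (D.map φ) := by
  refine IsPullback.of_right (h₁₂ := fst g D t ht j) (h₂₂ := t j) ?_
    (map_snd g D t ht φ) (isPullback g D t ht j)
  rw [map_fst, ht]
  exact isPullback g D t ht i

variable {g D t ht} {c : Cone D} {s : c.pt ⟶ S} (hs : ∀ j, c.π.app j ≫ t j = s)
  {P : Scheme.{u}} {a : P ⟶ V} {b : P ⟶ c.pt} (hP : IsPullback a b g s)

lemma cone_w (j : J) (hs : ∀ j, c.π.app j ≫ t j = s) (hP : IsPullback a b g s) :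
    a ≫ g = (b ≫ c.π.app j) ≫ t j := by
  rw [Category.assoc, hs, hP.w]

/-- The components of the cone over the base changed diagram whose point is the base change `P` of
`V` to the point of the given cone. -/
noncomputable def proj (j : J) : P ⟶ (pullbackDiagram g D t ht).obj j :=
  (isPullback g D t ht j).lift a (b ≫ c.π.app j) (cone_w j hs hP)

lemma proj_fst (j : J) : proj (ht := ht) hs hP j ≫ fst g D t ht j = a := IsPullback.lift_fst _ _ _ _

lemma proj_snd (j : J) : proj (ht := ht) hs hP j ≫ snd g D t ht j = b ≫ c.π.app j :=
  IsPullback.lift_snd _ _ _ _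

lemma proj_snd_assoc (j : J) {Z : Scheme.{u}} (h : D.obj j ⟶ Z) :
    proj (ht := ht) hs hP j ≫ snd g D t ht j ≫ h = b ≫ c.π.app j ≫ h := by
  rw [← Category.assoc, proj_snd, Category.assoc]

lemma proj_map {i j : J} (φ : i ⟶ j) :
    proj (ht := ht) hs hP i ≫ (pullbackDiagram g D t ht).map φ = proj hs hP j := by
  apply (isPullback g D t ht j).hom_ext
  · rw [Category.assoc, map_fst, proj_fst, proj_fst]
  · rw [Category.assoc, map_snd, proj_snd, proj_snd_assoc, c.w]

/-- The cone over the base changed diagram. -/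
@[simps]
noncomputable def cone : Cone (pullbackDiagram g D t ht) where
  pt := P
  π :=
    { app j := proj hs hP j
      naturality _ _ φ := (Category.id_comp _).trans (proj_map hs hP φ).symm }

/-- Base change preserves cofiltered limits. -/
noncomputable def isLimitCone [IsCofiltered J] (hc : IsLimit c) :
    IsLimit (cone (ht := ht) hs hP) :=
  let j₀ : J := IsCofiltered.nonempty.some
  have hfst (r : Cone (pullbackDiagram g D t ht)) {i j : J} (φ : i ⟶ j) :
      r.π.app i ≫ fst g D t ht i = r.π.app j ≫ fst g D t ht j := by
    rw [← r.w φ, Category.assoc, map_fst]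
  have hfst' (r : Cone (pullbackDiagram g D t ht)) (j : J) :
      r.π.app j₀ ≫ fst g D t ht j₀ = r.π.app j ≫ fst g D t ht j := by
    rw [← hfst r (IsCofiltered.minToLeft j₀ j), ← hfst r (IsCofiltered.minToRight j₀ j)]
  let pr (r : Cone (pullbackDiagram g D t ht)) : Cone D :=
    { pt := r.pt
      π :=
        { app j := r.π.app j ≫ snd g D t ht j
          naturality i j φ := by
            rw [← r.w φ, Category.assoc, Category.assoc, map_snd]
            exact Category.id_comp _ } }
  have hpr (r : Cone (pullbackDiagram g D t ht)) (j : J) :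
      hc.lift (pr r) ≫ c.π.app j = r.π.app j ≫ snd g D t ht j := hc.fac _ _
  have hw (r : Cone (pullbackDiagram g D t ht)) :
      (r.π.app j₀ ≫ fst g D t ht j₀) ≫ g = hc.lift (pr r) ≫ s := by
    rw [← hs j₀, reassoc_of% hpr r j₀, Category.assoc, (isPullback g D t ht j₀).w]
  { lift r := hP.lift (r.π.app j₀ ≫ fst g D t ht j₀) (hc.lift (pr r)) (hw r)
    fac r j := (isPullback g D t ht j).hom_ext
      (show (_ ≫ proj hs hP j) ≫ _ = _ by
        rw [Category.assoc, proj_fst, hP.lift_fst, hfst' r j])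
      (show (_ ≫ proj hs hP j) ≫ _ = _ by
        rw [Category.assoc, proj_snd, hP.lift_snd_assoc, hpr])
    uniq r (m : r.pt ⟶ P) (hm : ∀ j, m ≫ proj hs hP j = r.π.app j) := by
      apply hP.hom_ext
      · rw [hP.lift_fst, ← hm, Category.assoc, proj_fst]
      · refine hc.hom_ext fun j ↦ ?_
        rw [hP.lift_snd, hpr, ← hm, Category.assoc, Category.assoc, proj_snd] }

end pullbackDiagram

end PullbackDiagram

/-! ### Spreading out isomorphisms -/

section SpreadIso

lemma isPullback_of_isIso_comp {C : Type*} [Category* C] {P P' X Y Z : C} {a : P ⟶ X} {b : P ⟶ Y}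
    {f : X ⟶ Z} {g : Y ⟶ Z} (h : IsPullback a b f g) {a' : P' ⟶ X} {b' : P' ⟶ Y} (e : P' ⟶ P)
    [IsIso e] (h₁ : e ≫ a = a') (h₂ : e ≫ b = b') : IsPullback a' b' f g :=
  h.of_iso (asIso e).symm (Iso.refl _) (Iso.refl _) (Iso.refl _) (by simp [← h₁]) (by simp [← h₂])
    (by simp) (by simp)

variable {J : Type u} [Category.{u} J] [IsCofiltered J] {S V : Scheme.{u}} (g : V ⟶ S)
  [LocallyOfFinitePresentation g] [QuasiCompact g] (D : J ⥤ Scheme.{u}) [∀ j, IsAffine (D.obj j)]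

open pullbackDiagram

/-- A morphism to `V` from the base change of `V` to the limit is defined at a finite level. -/
lemma exists_proj_comp_eq [IsSeparated g] (t : ∀ j, D.obj j ⟶ S)
    (ht : ∀ {i j : J} (φ : i ⟶ j), D.map φ ≫ t j = t i)
    (t' : ∀ j, D.obj j ⟶ S) (ht' : ∀ {i j : J} (φ : i ⟶ j), D.map φ ≫ t' j = t' i)
    {c : Cone D} (hc : IsLimit c) {s s' : c.pt ⟶ S} (hs : ∀ j, c.π.app j ≫ t j = s)
    (hs' : ∀ j, c.π.app j ≫ t' j = s') {P : Scheme.{u}} {a a' : P ⟶ V} {b : P ⟶ c.pt}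
    (hP : IsPullback a b g s) (hP' : a' ≫ g = b ≫ s') :
    ∃ (j : J) (I : (pullbackDiagram g D t ht).obj j ⟶ V), proj hs hP j ≫ I = a' ∧
      I ≫ g = snd g D t ht j ≫ t' j := by
  have haff {i j : J} (φ : i ⟶ j) : IsAffineHom ((pullbackDiagram g D t ht).map φ) :=
    MorphismProperty.of_isPullback (isPullback_map g D t ht φ).flip inferInstance
  have hqc (j : J) : QuasiCompact (snd g D t ht j) :=
    MorphismProperty.of_isPullback (isPullback g D t ht j) ‹_›
  have hsep (j : J) : IsSeparated (snd g D t ht j) :=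
    MorphismProperty.of_isPullback (isPullback g D t ht j) ‹_›
  have hcomp (j : J) : CompactSpace ((pullbackDiagram g D t ht).obj j) :=
    QuasiCompact.compactSpace_of_compactSpace (snd g D t ht j)
  have hqs (j : J) : QuasiSeparatedSpace ((pullbackDiagram g D t ht).obj j) :=
    quasiSeparatedSpace_of_quasiSeparated (snd g D t ht j)
  let T : pullbackDiagram g D t ht ⟶ (Functor.const J).obj S :=
    { app j := snd g D t ht j ≫ t' j
      naturality i j φ := by
        rw [map_snd_assoc, ht']
        exact (Category.comp_id _).symm }
  obtain ⟨j, I, h₁, h₂⟩ := Scheme.exists_π_app_comp_eq_of_locallyOfFinitePresentation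
    (pullbackDiagram g D t ht) T g (cone hs hP) (isLimitCone hs hP hc) a' (by
      ext1; ext1 j
      change proj hs hP j ≫ snd g D t ht j ≫ t' j = a' ≫ g
      rw [proj_snd_assoc, hs', hP'])
  exact ⟨j, I, h₁, h₂⟩

/-- A morphism to `V` from a finite level that becomes the projection over the limit is the
projection at some further level. -/
lemma exists_map_comp_eq (t : ∀ j, D.obj j ⟶ S) (ht : ∀ {i j : J} (φ : i ⟶ j), D.map φ ≫ t j = t i)
    {c : Cone D} (hc : IsLimit c) {s : c.pt ⟶ S} (hs : ∀ j, c.π.app j ≫ t j = s)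
    {P : Scheme.{u}} {a : P ⟶ V} {b : P ⟶ c.pt} (hP : IsPullback a b g s) {j : J}
    (I : (pullbackDiagram g D t ht).obj j ⟶ V) (hI : I ≫ g = snd g D t ht j ≫ t j)
    (h : proj hs hP j ≫ I = a) :
    ∃ (i : J) (φ : i ⟶ j), (pullbackDiagram g D t ht).map φ ≫ I = fst g D t ht i := by
  have haff {i j : J} (φ : i ⟶ j) : IsAffineHom ((pullbackDiagram g D t ht).map φ) :=
    MorphismProperty.of_isPullback (isPullback_map g D t ht φ).flip inferInstance
  have hqc (j : J) : QuasiCompact (snd g D t ht j) :=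
    MorphismProperty.of_isPullback (isPullback g D t ht j) ‹_›
  have hcomp (j : J) : CompactSpace ((pullbackDiagram g D t ht).obj j) :=
    QuasiCompact.compactSpace_of_compactSpace (snd g D t ht j)
  let T : pullbackDiagram g D t ht ⟶ (Functor.const J).obj S :=
    { app j := snd g D t ht j ≫ t j
      naturality i j φ := by
        rw [map_snd_assoc, ht]
        exact (Category.comp_id _).symm }
  obtain ⟨k, φ, ψ, hk⟩ := Scheme.exists_hom_hom_comp_eq_comp_of_locallyOfFiniteType
    (pullbackDiagram g D t ht) T g (cone hs hP) (isLimitCone hs hP hc) I hI.symm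
    (fst g D t ht j) (isPullback g D t ht j).w.symm (by
      change proj hs hP j ≫ I = proj hs hP j ≫ _
      rw [h, proj_fst])
  exact ⟨k, φ, by rw [hk, map_fst]⟩

/-- Spreading out an isomorphism: if the base changes of `g : V ⟶ S` along two morphisms from
a cofiltered limit of affine schemes to `S` are isomorphic, then so are the base changes at some
finite level of the limit. -/
theorem exists_isPullback_of_isLimit [IsSeparated g]
    (t : ∀ j, D.obj j ⟶ S) (ht : ∀ {i j : J} (φ : i ⟶ j), D.map φ ≫ t j = t i)
    (t' : ∀ j, D.obj j ⟶ S) (ht' : ∀ {i j : J} (φ : i ⟶ j), D.map φ ≫ t' j = t' i)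
    {c : Cone D} (hc : IsLimit c) {s s' : c.pt ⟶ S} (hs : ∀ j, c.π.app j ≫ t j = s)
    (hs' : ∀ j, c.π.app j ≫ t' j = s') {P : Scheme.{u}} {a a' : P ⟶ V} {b : P ⟶ c.pt}
    (hP : IsPullback a b g s) (hP' : IsPullback a' b g s') :
    ∃ (j : J) (w : P ⟶ (pullbackDiagram g D t ht).obj j)
      (I : (pullbackDiagram g D t ht).obj j ⟶ V), w ≫ fst g D t ht j = a ∧
      w ≫ snd g D t ht j = b ≫ c.π.app j ∧ w ≫ I = a' ∧
      IsPullback I (snd g D t ht j) g (t' j) := by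
  obtain ⟨j₁, I₁, h₁, w₁⟩ := exists_proj_comp_eq g D t ht t' ht' hc hs hs' hP hP'.w
  obtain ⟨j₂, I₂, h₂, w₂⟩ := exists_proj_comp_eq g D t' ht' t ht hc hs' hs hP' hP.w
  let Y := pullbackDiagram g D t ht
  let Y' := pullbackDiagram g D t' ht'
  -- the two morphisms over a common index
  let F (j : J) (φ : j ⟶ j₁) : Y.obj j ⟶ Y'.obj j :=
    (isPullback g D t' ht' j).lift (Y.map φ ≫ I₁) (snd g D t ht j) (by
      rw [Category.assoc, w₁, map_snd_assoc, ht'])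
  let G (j : J) (φ : j ⟶ j₂) : Y'.obj j ⟶ Y.obj j :=
    (isPullback g D t ht j).lift (Y'.map φ ≫ I₂) (snd g D t' ht' j) (by
      rw [Category.assoc, w₂, map_snd_assoc, ht])
  have Ff (j φ) : F j φ ≫ fst g D t' ht' j = Y.map φ ≫ I₁ := IsPullback.lift_fst _ _ _ _
  have Fs (j φ) : F j φ ≫ snd g D t' ht' j = snd g D t ht j := IsPullback.lift_snd _ _ _ _
  have Gf (j φ) : G j φ ≫ fst g D t ht j = Y'.map φ ≫ I₂ := IsPullback.lift_fst _ _ _ _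
  have Gs (j φ) : G j φ ≫ snd g D t ht j = snd g D t' ht' j := IsPullback.lift_snd _ _ _ _
  have Fmap {i j : J} (ψ : i ⟶ j) (φ : j ⟶ j₁) : Y.map ψ ≫ F j φ = F i (ψ ≫ φ) ≫ Y'.map ψ := by
    apply (isPullback g D t' ht' j).hom_ext
    · rw [Category.assoc, Category.assoc, Ff, map_fst, Ff, Functor.map_comp, Category.assoc]
    · rw [Category.assoc, Category.assoc, Fs, map_snd, map_snd, reassoc_of% Fs]
  have Gmap {i j : J} (ψ : i ⟶ j) (φ : j ⟶ j₂) : Y'.map ψ ≫ G j φ = G i (ψ ≫ φ) ≫ Y.map ψ := by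
    apply (isPullback g D t ht j).hom_ext
    · rw [Category.assoc, Category.assoc, Gf, map_fst, Gf, Functor.map_comp, Category.assoc]
    · rw [Category.assoc, Category.assoc, Gs, map_snd, map_snd, reassoc_of% Gs]
  have Fproj (j φ) : proj hs hP j ≫ F j φ = proj hs' hP' j := by
    apply (isPullback g D t' ht' j).hom_ext
    · rw [Category.assoc, Ff, reassoc_of% (proj_map hs hP φ), h₁, proj_fst]
    · rw [Category.assoc, Fs, proj_snd, proj_snd]
  have Gproj (j φ) : proj hs' hP' j ≫ G j φ = proj hs hP j := by
    apply (isPullback g D t ht j).hom_ext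
    · rw [Category.assoc, Gf, reassoc_of% (proj_map hs' hP' φ), h₂, proj_fst]
    · rw [Category.assoc, Gs, proj_snd, proj_snd]
  let j := IsCofiltered.min j₁ j₂
  let φ₁ : j ⟶ j₁ := IsCofiltered.minToLeft _ _
  let φ₂ : j ⟶ j₂ := IsCofiltered.minToRight _ _
  obtain ⟨k₁, ψ₁, hk₁⟩ := exists_map_comp_eq g D t ht hc hs hP (F j φ₁ ≫ Y'.map φ₂ ≫ I₂)
    (by rw [Category.assoc, Category.assoc, w₂, map_snd_assoc, ht, reassoc_of% Fs])
    (by rw [reassoc_of% Fproj, reassoc_of% (proj_map hs' hP' φ₂), h₂])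
  obtain ⟨k₂, ψ₂, hk₂⟩ := exists_map_comp_eq g D t' ht' hc hs' hP' (G j φ₂ ≫ Y.map φ₁ ≫ I₁)
    (by rw [Category.assoc, Category.assoc, w₁, map_snd_assoc, ht', reassoc_of% Gs])
    (by rw [reassoc_of% Gproj, reassoc_of% (proj_map hs hP φ₁), h₁])
  obtain ⟨k, χ₁, χ₂, hχ⟩ := IsCofiltered.cospan ψ₁ ψ₂
  have auxF {i : J} (φ : i ⟶ j) : F i (φ ≫ φ₁) ≫ Y'.map (φ ≫ φ₂) ≫ I₂ =
      Y.map φ ≫ F j φ₁ ≫ Y'.map φ₂ ≫ I₂ := by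
    simp only [Functor.map_comp, Category.assoc, ← reassoc_of% Fmap]
  have auxG {i : J} (φ : i ⟶ j) : G i (φ ≫ φ₂) ≫ Y.map (φ ≫ φ₁) ≫ I₁ =
      Y'.map φ ≫ G j φ₂ ≫ Y.map φ₁ ≫ I₁ := by
    simp only [Functor.map_comp, Category.assoc, ← reassoc_of% Gmap]
  have e₁ : F k (χ₁ ≫ ψ₁ ≫ φ₁) ≫ G k (χ₁ ≫ ψ₁ ≫ φ₂) = 𝟙 _ := by
    apply (isPullback g D t ht k).hom_ext
    · rw [Category.assoc, Gf, Category.id_comp, ← Category.assoc χ₁, ← Category.assoc χ₁,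
        auxF, Functor.map_comp, Category.assoc, hk₁, map_fst]
    · rw [Category.assoc, Gs, Fs, Category.id_comp]
  have e₂ : G k (χ₁ ≫ ψ₁ ≫ φ₂) ≫ F k (χ₁ ≫ ψ₁ ≫ φ₁) = 𝟙 _ := by
    apply (isPullback g D t' ht' k).hom_ext
    · rw [Category.assoc, Ff, Category.id_comp, ← Category.assoc χ₁, ← Category.assoc χ₁, hχ,
        auxG, Functor.map_comp, Category.assoc, hk₂, map_fst]
    · rw [Category.assoc, Fs, Gs, Category.id_comp]
  have : IsIso (F k (χ₁ ≫ ψ₁ ≫ φ₁)) := ⟨_, e₁, e₂⟩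
  refine ⟨k, proj hs hP k, Y.map (χ₁ ≫ ψ₁ ≫ φ₁) ≫ I₁, proj_fst _ _ _, proj_snd _ _ _, ?_, ?_⟩
  · rw [reassoc_of% (proj_map hs hP (χ₁ ≫ ψ₁ ≫ φ₁)), h₁]
  · exact isPullback_of_isIso_comp (isPullback g D t' ht' k) _ (Ff _ _) (Fs _ _)

end SpreadIso

/-! ### Localizations of a subalgebra of a field -/

section Away

variable {K Ω : Type u} [Field K] [Field Ω] [Algebra K Ω]

/-- The nonzero elements of a subring `N` of a field, preordered by inclusion of the
localizations `N[1/c]`. -/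
structure Denom (N : Subalgebra K Ω) : Type u where
  /-- the underlying element -/
  val : Ω
  mem : val ∈ N
  ne_zero : val ≠ 0

/-- The subring `N[1/c]` of `Ω`. -/
def Denom.away {N : Subalgebra K Ω} (c : Denom N) : Subalgebra K Ω where
  carrier := {x | ∃ m : ℕ, c.val ^ m * x ∈ N}
  mul_mem' := by
    rintro x y ⟨m, hm⟩ ⟨n, hn⟩
    exact ⟨m + n, by convert mul_mem hm hn using 1; ring⟩
  add_mem' := by
    rintro x y ⟨m, hm⟩ ⟨n, hn⟩
    refine ⟨m + n, ?_⟩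
    have : c.val ^ (m + n) * (x + y) =
        c.val ^ n * (c.val ^ m * x) + c.val ^ m * (c.val ^ n * y) := by
      ring
    rw [this]
    exact add_mem (mul_mem (pow_mem c.mem _) hm) (mul_mem (pow_mem c.mem _) hn)
  algebraMap_mem' r := ⟨0, by simp [N.algebraMap_mem]⟩

namespace Denom

variable {N : Subalgebra K Ω}

instance : Preorder (Denom N) := Preorder.lift away

lemma le_away (c : Denom N) : N ≤ c.away := fun x hx ↦ ⟨0, by simpa using hx⟩

/-- The product of two denominators. -/
def mul (c d : Denom N) : Denom N :=
  ⟨c.val * d.val, mul_mem c.mem d.mem, mul_ne_zero c.ne_zero d.ne_zero⟩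

lemma le_mul_left (c d : Denom N) : c ≤ c.mul d := by
  rintro x ⟨m, hm⟩
  refine ⟨m, ?_⟩
  have : (c.val * d.val) ^ m * x = d.val ^ m * (c.val ^ m * x) := by ring
  change (c.val * d.val) ^ m * x ∈ N
  rw [this]
  exact mul_mem (pow_mem d.mem _) hm

lemma le_mul_right (c d : Denom N) : d ≤ c.mul d := by
  rintro x ⟨m, hm⟩
  refine ⟨m, ?_⟩
  have : (c.val * d.val) ^ m * x = c.val ^ m * (d.val ^ m * x) := by ring
  change (c.val * d.val) ^ m * x ∈ N
  rw [this]
  exact mul_mem (pow_mem c.mem _) hm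

instance : IsDirectedOrder (Denom N) := ⟨fun c d ↦ ⟨c.mul d, le_mul_left c d, le_mul_right c d⟩⟩

instance : Nonempty (Denom N) := ⟨⟨1, one_mem _, one_ne_zero⟩⟩

/-- The inclusion of `N` into `N[1/c]`. -/
def inc (c : Denom N) : N →+* c.away := (Subalgebra.inclusion c.le_away).toRingHom

variable (N) in
/-- The diagram of the rings `N[1/c]`. -/
@[simps]
def awayFunctor : Denom N ⥤ CommRingCat.{u} where
  obj c := .of c.away
  map {c d} h := CommRingCat.ofHom
    (Subalgebra.inclusion (show c.away ≤ d.away from leOfHom h)).toRingHom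

variable (N) in
/-- The fraction field of `N` inside `Ω`. -/
abbrev frac : IntermediateField K Ω := IntermediateField.adjoin K N

lemma away_le_frac (c : Denom N) : c.away ≤ (frac N).toSubalgebra := by
  rintro x ⟨m, hm⟩
  have h : ∀ y ∈ N, y ∈ frac N := fun y hy ↦ IntermediateField.subset_adjoin K _ hy
  have := mul_mem (inv_mem (pow_mem (h _ c.mem) m)) (h _ hm)
  rwa [inv_mul_cancel_left₀ (pow_ne_zero _ c.ne_zero)] at this

lemma exists_mem_away {x : Ω} (hx : x ∈ frac N) : ∃ c : Denom N, x ∈ c.away := by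
  obtain ⟨r, hr, s, hs, rfl⟩ := IntermediateField.mem_adjoin_iff_div.mp hx
  rw [Algebra.adjoin_eq] at hr hs
  by_cases h : s = 0
  · exact ⟨⟨1, one_mem _, one_ne_zero⟩, 0, by simp [h, N.zero_mem]⟩
  · exact ⟨⟨s, hs, h⟩, 1, by rwa [pow_one, mul_div_cancel₀ _ h]⟩

variable (N) in
/-- The fraction field of `N` as a cocone over the rings `N[1/c]`. -/
@[simps]
def awayCocone : Cocone (awayFunctor N) where
  pt := .of (frac N)
  ι := { app c := CommRingCat.ofHom (Subalgebra.inclusion (away_le_frac c)).toRingHom }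

variable (N) in
/-- The fraction field of `N` is the filtered union of the rings `N[1/c]`. -/
noncomputable def isColimitAwayCocone : IsColimit (awayCocone N) :=
  have : ReflectsColimitsOfShape (Denom N) (forget CommRingCat.{u}) :=
    reflectsColimitsOfShape_of_reflectsIsomorphisms
  isColimitOfReflects (forget CommRingCat) <| Types.FilteredColimit.isColimitOf' _ _
    (fun ⟨x, hx⟩ ↦ by
      obtain ⟨c, hc⟩ := exists_mem_away hx
      exact ⟨c, ⟨x, hc⟩, rfl⟩)
    (fun c x y h ↦ ⟨c, 𝟙 c, by
      have h' : (x : c.away) = y := Subtype.ext (congrArg (fun z : frac N ↦ (z : Ω)) h)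
      rw [h']⟩)

end Denom

end Away

/-! ### Semilinear actions -/

/-- A semilinear action of the automorphisms of `Ω` over `K` on an `Ω`-scheme `f : X ⟶ Spec Ω`: the
automorphism `σ` acts by a morphism of schemes covering `Spec σ`, contravariantly as `Spec` does. -/
structure SemilinearAction (K : Type u) {Ω : Type u} [Field K] [Field Ω] [Algebra K Ω]
    {X : Scheme.{u}} (f : X ⟶ Spec (.of Ω)) where
  /-- the action of an automorphism -/
  act : (Ω ≃ₐ[K] Ω) → (X ⟶ X)
  act_one : act 1 = 𝟙 X
  act_mul (σ τ : Ω ≃ₐ[K] Ω) : act (σ * τ) = act σ ≫ act τ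
  act_comp (σ : Ω ≃ₐ[K] Ω) :
    act σ ≫ f = f ≫ Spec.map (CommRingCat.ofHom ((σ : Ω ≃+* Ω) : Ω →+* Ω))

namespace SemilinearAction

variable {K Ω : Type u} [Field K] [Field Ω] [Algebra K Ω] {X : Scheme.{u}}
  {f : X ⟶ Spec (.of Ω)} (A : SemilinearAction K f)

lemma act_comp_assoc (σ : Ω ≃ₐ[K] Ω) {Z : Scheme.{u}} (h : Spec (.of Ω) ⟶ Z) :
    A.act σ ≫ f ≫ h = f ≫ Spec.map (CommRingCat.ofHom ((σ : Ω ≃+* Ω) : Ω →+* Ω)) ≫ h := by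
  rw [← Category.assoc, A.act_comp, Category.assoc]

lemma act_comp_inv (σ : Ω ≃ₐ[K] Ω) : A.act σ ≫ A.act σ⁻¹ = 𝟙 X := by
  rw [← A.act_mul, mul_inv_cancel, A.act_one]

lemma act_comp_inv_assoc (σ : Ω ≃ₐ[K] Ω) {Z : Scheme.{u}} (h : X ⟶ Z) :
    A.act σ ≫ A.act σ⁻¹ ≫ h = h := by
  rw [← Category.assoc, act_comp_inv, Category.id_comp]

lemma act_inv_comp (σ : Ω ≃ₐ[K] Ω) : A.act σ⁻¹ ≫ A.act σ = 𝟙 X := by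
  rw [← A.act_mul, inv_mul_cancel, A.act_one]

lemma act_inv_comp_assoc (σ : Ω ≃ₐ[K] Ω) {Z : Scheme.{u}} (h : X ⟶ Z) :
    A.act σ⁻¹ ≫ A.act σ ≫ h = h := by
  rw [← Category.assoc, act_inv_comp, Category.id_comp]

instance (σ : Ω ≃ₐ[K] Ω) : IsIso (A.act σ) := ⟨A.act σ⁻¹, A.act_comp_inv σ, A.act_inv_comp σ⟩

lemma isPullback_act (σ : Ω ≃ₐ[K] Ω) :
    IsPullback (A.act σ) f f (Spec.map (CommRingCat.ofHom ((σ : Ω ≃+* Ω) : Ω →+* Ω))) := by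
  have : IsIso (CommRingCat.ofHom ((σ : Ω ≃+* Ω) : Ω →+* Ω)) :=
    (σ : Ω ≃+* Ω).toCommRingCatIso.isIso_hom
  exact IsPullback.of_horiz_isIso ⟨A.act_comp σ⟩

/-- A morphism `π` is invariant under the automorphisms that fix the set `s` pointwise. -/
def InvariantUnder {Y : Scheme.{u}} (s : Set Ω) (π : X ⟶ Y) : Prop :=
  ∀ ρ : Ω ≃ₐ[K] Ω, (∀ x ∈ s, ρ x = x) → A.act ρ ≫ π = π

variable {A} in
lemma InvariantUnder.mono {Y : Scheme.{u}} {s t : Set Ω} (h : s ⊆ t) {π : X ⟶ Y}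
    (hπ : A.InvariantUnder s π) : A.InvariantUnder t π :=
  fun ρ hρ ↦ hπ ρ fun x hx ↦ hρ x (h hx)

end SemilinearAction

/-! ### Spreading out the comparison of two models -/

section Spread

variable {K Ω : Type u} [Field K] [Field Ω] [Algebra K Ω] [IsAlgClosed Ω] [CharZero Ω]
  {X : Scheme.{u}} {f : X ⟶ Spec (.of Ω)} (A : SemilinearAction K f)

/-- The morphism `Spec N[1/c] ⟶ Spec R` attached to a ring homomorphism `R → N`. -/
noncomputable abbrev Denom.baseMap {N : Subalgebra K Ω} {R : Type u} [CommRing R] (j : R →+* N)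
    (c : Denom N) : Spec (.of c.away) ⟶ Spec (.of R) :=
  Spec.map (CommRingCat.ofHom (c.inc.comp j))

/-- The fraction field of a finitely generated subalgebra of `Ω` is the fixed field of its
automorphism group, as `Ω` still has infinite transcendence degree over it. -/
lemma isInvariant_frac (htr : Cardinal.aleph0 ≤ Algebra.trdeg K Ω)
    {N : Subalgebra K Ω} (hN : N.FG) :
    Algebra.IsInvariant (Denom.frac N) Ω (Ω ≃ₐ[Denom.frac N] Ω) := by
  have hE : (Denom.frac N).FG := by
    obtain ⟨s, rfl⟩ := hN
    refine ⟨s, le_antisymm (IntermediateField.adjoin.mono _ _ _ Algebra.subset_adjoin) ?_⟩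
    rw [IntermediateField.adjoin_le_iff]
    exact IntermediateField.algebra_adjoin_le_adjoin _ _
  have : Algebra.EssFiniteType K (Denom.frac N) := (IntermediateField.essFiniteType_iff).mpr hE
  apply isInvariant_of_trdeg
  rwa [trdeg_eq_of_trdeg_lt htr (trdeg_lt_aleph0 K _)]

/-- Let `X` be the base change of `V` along two homomorphisms `R → N ⊂ Ω`, both projections to `V`
being invariant under the automorphisms that fix `N`. Then the two base changes of `V` to
a localization `N[1/c]` are already isomorphic, compatibly with `X`. -/
theorem exists_spread (htr : Cardinal.aleph0 ≤ Algebra.trdeg K Ω) {N : Subalgebra K Ω} (hN : N.FG)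
    {R : Type u} [CommRing R] {V : Scheme.{u}} (g : V ⟶ Spec (.of R))
    [IsSeparated g] [LocallyOfFinitePresentation g] [QuasiCompact g] (j₁ j₂ : R →+* N)
    {π₁ π₂ : X ⟶ V}
    (h₁ : IsPullback π₁ f g (Spec.map (CommRingCat.ofHom (N.subtype.comp j₁))))
    (h₂ : IsPullback π₂ f g (Spec.map (CommRingCat.ofHom (N.subtype.comp j₂))))
    (hi₁ : A.InvariantUnder N π₁) (hi₂ : A.InvariantUnder N π₂) :
    ∃ (c : Denom N) (P : Scheme.{u}) (a : P ⟶ V) (b : P ⟶ Spec (.of c.away)) (I : P ⟶ V),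
      IsPullback a b g (c.baseMap j₁) ∧ IsPullback I b g (c.baseMap j₂) ∧
      ∀ s : X ⟶ P, s ≫ a = π₁ → s ≫ b = f ≫ Spec.map (CommRingCat.ofHom c.away.subtype) →
        s ≫ I = π₂ := by
  let F := Denom.frac N
  have := isInvariant_frac htr hN
  let incF : N →+* F := (Subalgebra.inclusion
    (show N ≤ F.toSubalgebra from IntermediateField.subset_adjoin K (N : Set Ω))).toRingHom
  have hincF : (algebraMap F Ω).comp incF = N.subtype := rfl
  let s (j : R →+* N) : Spec (.of F) ⟶ Spec (.of R) := Spec.map (CommRingCat.ofHom (incF.comp j))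
  have hs (j : R →+* N) : Spec.map (CommRingCat.ofHom (algebraMap F Ω)) ≫ s j =
      Spec.map (CommRingCat.ofHom (N.subtype.comp j)) := by
    rw [← Spec.map_comp, ← CommRingCat.ofHom_comp, ← RingHom.comp_assoc, hincF]
  -- descent to the fraction field, for either of the two maps
  have main (j j' : R →+* N) {π π' : X ⟶ V}
      (h : IsPullback π f g (Spec.map (CommRingCat.ofHom (N.subtype.comp j))))
      (h' : IsPullback π' f g (Spec.map (CommRingCat.ofHom (N.subtype.comp j'))))
      (hi : A.InvariantUnder N π) (hi' : A.InvariantUnder N π') :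
      ∃ (p : X ⟶ pullback g (s j)) (q : pullback g (s j) ⟶ V), Epi p ∧ p ≫ pullback.fst _ _ = π ∧
        p ≫ pullback.snd _ _ = f ≫ Spec.map (CommRingCat.ofHom (algebraMap F Ω)) ∧
        p ≫ q = π' ∧ q ≫ g = pullback.snd g (s j) ≫ s j' := by
    let p : X ⟶ pullback g (s j) := pullback.lift π
      (f ≫ Spec.map (CommRingCat.ofHom (algebraMap F Ω))) (by rw [Category.assoc, hs, h.w])
    have hpf : p ≫ pullback.fst _ _ = π := pullback.lift_fst _ _ _
    have hps : p ≫ pullback.snd _ _ = f ≫ Spec.map (CommRingCat.ofHom (algebraMap F Ω)) :=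
      pullback.lift_snd _ _ _
    have hp : IsPullback p f (pullback.snd g (s j))
        (Spec.map (CommRingCat.ofHom (algebraMap F Ω))) := by
      refine IsPullback.of_right (h₁₂ := pullback.fst g (s j)) (h₂₂ := s j) ?_ hps
        (IsPullback.of_hasPullback g (s j))
      rw [hpf, hs]
      exact h
    have hfix (ρ : Ω ≃ₐ[F] Ω) : ∀ x ∈ (N : Set Ω), ρ.restrictScalars K x = x := fun x hx ↦
      ρ.commutes (⟨x, IntermediateField.subset_adjoin K (N : Set Ω) hx⟩ : F)
    have := effectiveEpi_of_isPullback hp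
    obtain ⟨q, hq⟩ := exists_comp_eq_of_invariant hp (fun ρ ↦ A.act (ρ.restrictScalars K))
      (fun ρ ↦ by
        apply pullback.hom_ext
        · rw [Category.assoc, hpf, hi _ (hfix ρ)]
        · rw [Category.assoc, hps, A.act_comp_assoc, ← Spec.map_comp, ← CommRingCat.ofHom_comp]
          congr 3
          ext x
          exact ρ.commutes x)
      (fun ρ ↦ A.act_comp _) π' g (pullback.snd g (s j) ≫ s j')
      (by rw [reassoc_of% hps, hs, h'.w]) (fun ρ ↦ hi' _ (hfix ρ))
    refine ⟨p, q, inferInstance, hpf, hps, hq, ?_⟩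
    rw [← cancel_epi p, reassoc_of% hq, reassoc_of% hps, hs, h'.w]
  obtain ⟨p₁, q₁, hep₁, hf₁, hs₁, hq₁, hg₁⟩ := main j₁ j₂ h₁ h₂ hi₁ hi₂
  obtain ⟨p₂, q₂, hep₂, hf₂, hs₂, hq₂, hg₂⟩ := main j₂ j₁ h₂ h₁ hi₂ hi₁
  -- the two descended morphisms are inverse to each other, so both base changes of `V` to the
  -- fraction field are isomorphic
  have hP' : IsPullback q₁ (pullback.snd g (s j₁)) g (s j₂) := by
    let e : pullback g (s j₁) ⟶ pullback g (s j₂) := pullback.lift q₁ (pullback.snd _ _) hg₁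
    let e' : pullback g (s j₂) ⟶ pullback g (s j₁) := pullback.lift q₂ (pullback.snd _ _) hg₂
    have ef : e ≫ pullback.fst _ _ = q₁ := pullback.lift_fst _ _ _
    have es : e ≫ pullback.snd _ _ = pullback.snd _ _ := pullback.lift_snd _ _ _
    have ef' : e' ≫ pullback.fst _ _ = q₂ := pullback.lift_fst _ _ _
    have es' : e' ≫ pullback.snd _ _ = pullback.snd _ _ := pullback.lift_snd _ _ _
    have pe : p₁ ≫ e = p₂ := by
      apply pullback.hom_ext
      · rw [Category.assoc, ef, hq₁, hf₂]
      · rw [Category.assoc, es, hs₁, hs₂]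
    have pe' : p₂ ≫ e' = p₁ := by
      apply pullback.hom_ext
      · rw [Category.assoc, ef', hq₂, hf₁]
      · rw [Category.assoc, es', hs₁, hs₂]
    have : IsIso e := ⟨e', by rw [← cancel_epi p₁, reassoc_of% pe, pe', Category.comp_id],
      by rw [← cancel_epi p₂, reassoc_of% pe', pe, Category.comp_id]⟩
    exact isPullback_of_isIso_comp (IsPullback.of_hasPullback g (s j₂)) e ef es
  -- the spectrum of the fraction field is the limit of the spectra of the localizations
  let D : (Denom N)ᵒᵖ ⥤ Scheme.{u} := (Denom.awayFunctor N).op ⋙ Scheme.Spec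
  let t (j : R →+* N) (c : (Denom N)ᵒᵖ) : D.obj c ⟶ Spec (.of R) := c.unop.baseMap j
  have ht (j : R →+* N) {c d : (Denom N)ᵒᵖ} (φ : c ⟶ d) : D.map φ ≫ t j d = t j c :=
    (Spec.map_comp _ _).symm
  have : ∀ c, IsAffine (D.obj c) := fun c ↦ inferInstanceAs (IsAffine (Spec _))
  have hlim : IsLimit (Scheme.Spec.mapCone (Denom.awayCocone N).op) :=
    isLimitOfPreserves Scheme.Spec (Denom.isColimitAwayCocone N).op
  obtain ⟨c, w, I, hwf, hws, hI, hpb⟩ := exists_isPullback_of_isLimit g D (t j₁) (ht j₁) (t j₂)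
    (ht j₂) hlim (s := s j₁) (s' := s j₂) (fun c ↦ (Spec.map_comp _ _).symm)
    (fun c ↦ (Spec.map_comp _ _).symm) (IsPullback.of_hasPullback g (s j₁)) hP'
  refine ⟨c.unop, _, pullbackDiagram.fst g D (t j₁) (ht j₁) c,
    pullbackDiagram.snd g D (t j₁) (ht j₁) c, I,
    pullbackDiagram.isPullback g D (t j₁) (ht j₁) c, hpb,
    fun r hr₁ hr₂ ↦ ?_⟩
  rw [← hq₁, ← hI, ← Category.assoc]
  congr 1
  apply (pullbackDiagram.isPullback g D (t j₁) (ht j₁) c).hom_ext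
  · rw [Category.assoc, hwf, hr₁, hf₁]
  · let ψ : c.unop.away →+* F := (Subalgebra.inclusion (Denom.away_le_frac c.unop)).toRingHom
    have hws' : w ≫ pullbackDiagram.snd g D (t j₁) (ht j₁) c =
        pullback.snd g (s j₁) ≫ Spec.map (CommRingCat.ofHom ψ) := hws
    have h₃ : f ≫ Spec.map (CommRingCat.ofHom c.unop.away.subtype) =
        (p₁ ≫ pullback.snd g (s j₁)) ≫ Spec.map (CommRingCat.ofHom ψ) := by
      rw [hs₁, Category.assoc]
      rw [← Spec.map_comp]
      rfl
    exact (hr₂.trans h₃).trans ((Category.assoc _ _ _).trans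
      ((congrArg (p₁ ≫ ·) hws'.symm).trans (Category.assoc _ _ _).symm))

end Spread

/-! ### Generic automorphisms -/

section GenericPoints

variable {K Ω : Type u} [Field K] [Field Ω] [Algebra K Ω]

/-- An element of `Ω ⊗ R` involves only finitely many elements of `Ω`. -/
lemma exists_fg_subalgebra_tensor {R : Type u} [CommRing R] [Algebra K R] (A₀ : Subalgebra K Ω)
    (hA₀ : A₀.FG) (x : Ω ⊗[K] R) :
    ∃ A : Subalgebra K Ω, A.FG ∧ A₀ ≤ A ∧ ∃ y : A ⊗[K] R,
      Algebra.TensorProduct.map A.val (AlgHom.id K R) y = x := by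
  induction x with
  | zero => exact ⟨A₀, hA₀, le_rfl, 0, by simp⟩
  | tmul a r =>
    refine ⟨A₀ ⊔ Algebra.adjoin K {a}, hA₀.sup ⟨{a}, by simp⟩, le_sup_left,
      ⟨a, (le_sup_right : _ ≤ A₀ ⊔ Algebra.adjoin K {a})
        (Algebra.self_mem_adjoin_singleton K a)⟩ ⊗ₜ r,
      by simp⟩
  | add x y hx hy =>
    obtain ⟨A, hA, h, x', rfl⟩ := hx
    obtain ⟨B, hB, -, y', rfl⟩ := hy
    refine ⟨A ⊔ B, hA.sup hB, h.trans le_sup_left,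
      Algebra.TensorProduct.map (Subalgebra.inclusion (le_sup_left : A ≤ A ⊔ B))
        (AlgHom.id K R) x' +
      Algebra.TensorProduct.map (Subalgebra.inclusion (le_sup_right : B ≤ A ⊔ B))
        (AlgHom.id K R) y',
      ?_⟩
    have h1 : (A ⊔ B).val.comp (Subalgebra.inclusion (le_sup_left : A ≤ A ⊔ B)) = A.val := rfl
    have h2 : (A ⊔ B).val.comp (Subalgebra.inclusion (le_sup_right : B ≤ A ⊔ B)) = B.val := rfl
    rw [map_add, ← AlgHom.comp_apply, ← AlgHom.comp_apply, ← Algebra.TensorProduct.map_comp,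
      ← Algebra.TensorProduct.map_comp, h1, h2]
    rfl

lemma productMap_injective_of_le {R P : Type u} [CommRing R] [Algebra K R] [CommRing P]
    [Algebra K P]
    {A : Subalgebra K Ω} {h : R →ₐ[K] Ω}
    (H : Function.Injective (Algebra.TensorProduct.productMap A.val h)) (i : P →ₐ[K] Ω)
    (hi : Function.Injective i) (hA : ∀ p, i p ∈ A) :
    Function.Injective (Algebra.TensorProduct.productMap i h) := by
  let i' : P →ₐ[K] A := i.codRestrict A hA
  have hi' : Function.Injective (Algebra.TensorProduct.map i' (AlgHom.id K R)) :=
    Module.Flat.rTensor_preserves_injective_linearMap i'.toLinearMap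
      fun x y hxy ↦ hi (congrArg Subtype.val hxy)
  convert H.comp hi' using 1
  ext x
  induction x with
  | zero => simp
  | add a b ha hb => simp_all
  | tmul a r => simp [i']

/-- Evaluation of `Ω ⊗ R` at an automorphism, seen as an `Ω`-point of `R ⊂ Ω`. -/
noncomputable def evalAut (R : Subalgebra K Ω) (σ : Ω ≃ₐ[K] Ω) : Ω ⊗[K] R →ₐ[Ω] Ω :=
  Algebra.TensorProduct.lift (AlgHom.id Ω Ω) ((σ : Ω →ₐ[K] Ω).comp R.val) fun _ _ ↦ .all _ _

@[simp]
lemma evalAut_tmul {R : Subalgebra K Ω} (σ : Ω ≃ₐ[K] Ω) (a : Ω) (r : R) :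
    evalAut R σ (a ⊗ₜ[K] r) = a * σ r := by
  simp [evalAut]

lemma evalAut_map {P : Type u} [CommRing P] [Algebra K P] {R : Subalgebra K Ω} (σ : Ω ≃ₐ[K] Ω)
    (i : P →ₐ[K] Ω) (y : P ⊗[K] R) :
    evalAut R σ (Algebra.TensorProduct.map i (AlgHom.id K R) y) =
      Algebra.TensorProduct.productMap i ((σ : Ω →ₐ[K] Ω).comp R.val) y := by
  induction y with
  | zero => simp
  | add a b ha hb => simp only [map_add, ha, hb]
  | tmul a r => simp

lemma specialize_map {P R : Type u} [CommRing P] [Algebra K P] [CommRing R] [Algebra K R]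
    (φ : R →ₐ[K] K) (i : P →ₐ[K] Ω) (y : P ⊗[K] R) :
    specialize φ (Algebra.TensorProduct.map i (AlgHom.id K R) y) = i (specialize φ y) := by
  induction y with
  | zero => simp
  | add a b ha hb => simp only [map_add, ha, hb]
  | tmul a r => simp

/-- `σ` is generic with respect to `A` and `R`: the algebras `A` and `σ R` are linearly disjoint. -/
def IsGenericAut (A R : Subalgebra K Ω) (σ : Ω ≃ₐ[K] Ω) : Prop :=
  Function.Injective (Algebra.TensorProduct.productMap A.val ((σ : Ω →ₐ[K] Ω).comp R.val))

/-- The generic automorphisms are jointly injective on localizations of `Ω ⊗ R`. -/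
lemma exists_isGenericAut_apply_ne_zero [IsAlgClosed K] [IsAlgClosed Ω]
    (htr : Cardinal.aleph0 ≤ Algebra.trdeg K Ω) {A R : Subalgebra K Ω} (hA : A.FG) (hR : R.FG)
    (d : Ω ⊗[K] R) (hd : ∀ σ, IsGenericAut A R σ → evalAut R σ d ≠ 0)
    (c : Localization.Away d) (hc : c ≠ 0) :
    ∃ (σ : Ω ≃ₐ[K] Ω) (t : Localization.Away d →ₐ[Ω] Ω), IsGenericAut A R σ ∧
      (∀ x, t (algebraMap _ _ x) = evalAut R σ x) ∧ t c ≠ 0 := by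
  obtain ⟨n, x, hx⟩ := IsLocalization.Away.surj d c
  obtain ⟨A', hA', hAA', y, hy⟩ := exists_fg_subalgebra_tensor A hA x
  obtain ⟨σ, hσ⟩ := exists_algEquiv_productMap_injective htr A' R hA' hR
  have hσA : IsGenericAut A R σ :=
    productMap_injective_of_le hσ A.val Subtype.val_injective fun a ↦ hAA' a.2
  have hunit : IsUnit (evalAut R σ d) := (hd σ hσA).isUnit
  have hM : ∀ m : Submonoid.powers d, IsUnit (evalAut R σ (m : Ω ⊗[K] R)) := by
    rintro ⟨_, n, rfl⟩
    simpa using hunit.pow n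
  let t : Localization.Away d →ₐ[Ω] Ω := IsLocalization.liftAlgHom (M := Submonoid.powers d) hM
  have ht : ∀ x, t (algebraMap _ _ x) = evalAut R σ x := fun x ↦ IsLocalization.lift_eq _ x
  refine ⟨σ, t, hσA, ht, fun h0 ↦ hc ?_⟩
  have hx0 : evalAut R σ x = 0 := by rw [← ht, ← hx, map_mul, h0, zero_mul]
  have hy0 : y = 0 := hσ (by rw [map_zero, ← hx0, ← hy, evalAut_map])
  rw [← hy, hy0, map_zero, map_zero] at hx
  exact ((IsLocalization.Away.algebraMap_isUnit d).pow n).mul_left_eq_zero.mp hx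

end GenericPoints

/-! ### Homomorphisms out of a localization -/

namespace Denom

variable {K Ω : Type u} [Field K] [Field Ω] [Algebra K Ω] {N : Subalgebra K Ω} (c : Denom N)

/-- The denominator as an element of `N`. -/
def elt : N := ⟨c.val, c.mem⟩

lemma isLocalization : letI := c.inc.toAlgebra; IsLocalization.Away c.elt c.away := by
  let _ : Algebra N c.away := c.inc.toAlgebra
  have hu : IsUnit (c.inc c.elt) := by
    refine IsUnit.of_mul_eq_one ⟨c.val⁻¹, 1, ?_⟩ (Subtype.ext (mul_inv_cancel₀ c.ne_zero))
    rw [pow_one, mul_inv_cancel₀ c.ne_zero]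
    exact one_mem N
  refine ⟨?_, ?_, ?_⟩
  · rintro ⟨_, n, rfl⟩
    exact (map_pow c.inc c.elt n).symm ▸ hu.pow n
  · rintro ⟨x, m, hm⟩
    exact ⟨⟨⟨_, hm⟩, ⟨_, m, rfl⟩⟩, Subtype.ext (mul_comm _ _)⟩
  · intro x y h
    have : (x : N) = y := Subtype.ext (congrArg (fun z : c.away ↦ (z : Ω)) h)
    exact ⟨1, by rw [this]⟩

lemma exists_lift {L : Type u} [CommRing L] (ν : N →+* L) (h : IsUnit (ν c.elt)) :
    ∃ ν' : c.away →+* L, ν'.comp c.inc = ν := by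
  let _ : Algebra N c.away := c.inc.toAlgebra
  have := c.isLocalization
  exact ⟨IsLocalization.Away.lift c.elt h, IsLocalization.Away.lift_comp c.elt h⟩

lemma hom_ext {L : Type u} [CommRing L] {ν ν' : c.away →+* L} (h : ν.comp c.inc = ν'.comp c.inc) :
    ν = ν' := by
  let _ : Algebra N c.away := c.inc.toAlgebra
  have := c.isLocalization
  exact IsLocalization.ringHom_ext (Submonoid.powers c.elt) h

end Denom

/-! ### Specialization of a model with semilinear action -/

section Specialization

variable {K Ω : Type u} [Field K] [Field Ω] [Algebra K Ω]
  {X V : Scheme.{u}} {f : X ⟶ Spec (.of Ω)} (A : SemilinearAction K f)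

/-- The conjugate of an invariant morphism `π` under `σ` depends only on the values of `σ` on
`s`. -/
lemma SemilinearAction.InvariantUnder.act_comp_eq {A : SemilinearAction K f} {s : Set Ω}
    {π : X ⟶ V} (h : A.InvariantUnder s π) {σ τ : Ω ≃ₐ[K] Ω} (hστ : ∀ x ∈ s, σ x = τ x) :
    A.act σ ≫ π = A.act τ ≫ π := by
  have h' := h (τ⁻¹ * σ) fun x hx ↦ by
    rw [AlgEquiv.mul_apply, hστ x hx]
    exact τ.symm_apply_apply x
  rw [A.act_mul] at h'
  conv_rhs => rw [← h', Category.assoc, A.act_comp_inv_assoc]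

/-- If `I` realizes the comparison of `π` with its `σ`-conjugate over `N`, then it also realizes
the comparison with the `σ'`-conjugate along any other embedding of `N` into `Ω` that is compatible
with `σ'`, because this embedding extends to an automorphism of `Ω`. -/
lemma lift_comp_eq_act_comp [IsAlgClosed Ω] (htr : Cardinal.aleph0 ≤ Algebra.trdeg K Ω)
    {N R : Subalgebra K Ω} (hN : N.FG) {g : V ⟶ Spec (.of R)} {π : X ⟶ V}
    (hi : A.InvariantUnder R π) {j₁ j₂ : R →ₐ[K] N} {σ σ' : Ω ≃ₐ[K] Ω}
    (hj₁ : ∀ r, (j₁ r : Ω) = r) (hj₂ : ∀ r, (j₂ r : Ω) = σ r) {c : Denom N}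
    {P : Scheme.{u}} {a I : P ⟶ V} {b : P ⟶ Spec (.of c.away)}
    (hP : IsPullback a b g (c.baseMap (j₁ : R →+* N)))
    (hI : ∀ s : X ⟶ P, s ≫ a = π → s ≫ b = f ≫ Spec.map (CommRingCat.ofHom c.away.subtype) →
        s ≫ I = A.act σ ≫ π)
    (hπ : π ≫ g = f ≫ Spec.map (CommRingCat.ofHom R.subtype))
    (ν : c.away →+* Ω) (hν₁ : ∀ r : R, ν (c.inc (j₁ r)) = r)
    (hν₂ : ∀ r : R, ν (c.inc (j₂ r)) = σ' r)
    (hν : Function.Injective (ν.comp c.inc)) (s : X ⟶ P) (hsa : s ≫ a = π)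
    (hsb : s ≫ b = f ≫ Spec.map (CommRingCat.ofHom ν)) : s ≫ I = A.act σ' ≫ π := by
  let u : N →ₐ[K] Ω := { ν.comp c.inc with
    commutes' := fun x ↦ by
      have h := hν₁ (algebraMap K R x)
      rw [j₁.commutes] at h
      exact h }
  have : Algebra.FiniteType K N := N.fg_iff_finiteType.mp hN
  obtain ⟨ρ, hρ⟩ := exists_algEquiv_comp_eq htr (P := N) trdeg_lt_aleph0_of_finiteType N.val u
    Subtype.val_injective hν
  have hρR : A.act ρ ≫ π = π := hi ρ fun r hr ↦ by
    have h := hρ (j₁ ⟨r, hr⟩)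
    rw [N.val_apply, hj₁] at h
    exact h.trans (hν₁ ⟨r, hr⟩)
  have hw : π ≫ g = (f ≫ Spec.map (CommRingCat.ofHom c.away.subtype)) ≫
      c.baseMap (j₁ : R →+* N) := by
    rw [hπ, Category.assoc, ← Spec.map_comp, ← CommRingCat.ofHom_comp]
    congr 3
    ext r
    exact (hj₁ r).symm
  let s₀ : X ⟶ P := hP.lift π (f ≫ Spec.map (CommRingCat.ofHom c.away.subtype)) hw
  have h₀a : s₀ ≫ a = π := hP.lift_fst _ _ _
  have h₀b : s₀ ≫ b = f ≫ Spec.map (CommRingCat.ofHom c.away.subtype) := hP.lift_snd _ _ _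
  have hs : s = A.act ρ ≫ s₀ := by
    apply hP.hom_ext
    · rw [Category.assoc, h₀a, hρR, hsa]
    · rw [Category.assoc, h₀b, hsb, A.act_comp_assoc, ← Spec.map_comp, ← CommRingCat.ofHom_comp]
      congr 3
      refine c.hom_ext (RingHom.ext fun x ↦ ?_)
      exact (hρ x).symm
  rw [hs, Category.assoc, hI s₀ h₀a h₀b, ← Category.assoc, ← A.act_mul]
  refine hi.act_comp_eq fun r hr ↦ ?_
  have h := hρ (j₂ ⟨r, hr⟩)
  rw [N.val_apply, hj₂] at h
  exact h.trans (hν₂ ⟨r, hr⟩)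

set_option maxHeartbeats 1000000 in
/-- A model over a finitely generated algebra `R` of a scheme with semilinear action specializes,
at a general point of `R`, to a model over the algebraically closed ground field `K` whose
projection is invariant under the whole action. -/
theorem exists_invariant_specialization [IsAlgClosed K] [IsAlgClosed Ω] [CharZero Ω]
    (htr : Cardinal.aleph0 ≤ Algebra.trdeg K Ω) {R : Subalgebra K Ω} (hR : R.FG)
    (g : V ⟶ Spec (.of R)) [IsSeparated g] [LocallyOfFinitePresentation g] [QuasiCompact g]
    {π : X ⟶ V} (hπ : IsPullback π f g (Spec.map (CommRingCat.ofHom R.subtype)))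
    (hi : A.InvariantUnder R π) :
    ∃ (φ : R →ₐ[K] K) (π' : X ⟶ V),
      IsPullback π' f g (Spec.map (CommRingCat.ofHom ((algebraMap K Ω).comp (φ : R →+* K)))) ∧
      ∀ τ, A.act τ ≫ π' = π' := by
  obtain ⟨σ, hσ⟩ := exists_algEquiv_productMap_injective htr R R hR hR
  have hRft : Algebra.FiniteType K R := R.fg_iff_finiteType.mp hR
  -- the ring `N = R · σR`, isomorphic to `R ⊗ R`
  let μ : R ⊗[K] R →ₐ[K] Ω := Algebra.TensorProduct.productMap R.val ((σ : Ω →ₐ[K] Ω).comp R.val)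
  let N : Subalgebra K Ω := μ.range
  have hN : N.FG := by
    rw [show N = R.val.range ⊔ ((σ : Ω →ₐ[K] Ω).comp R.val).range from
      Algebra.TensorProduct.productMap_range _ _, AlgHom.range_comp, Subalgebra.range_val]
    exact hR.sup (hR.map _)
  let e : R ⊗[K] R ≃ₐ[K] N := AlgEquiv.ofInjective μ hσ
  have he : ∀ x, (e x : Ω) = μ x := fun x ↦ rfl
  let j₁ : R →ₐ[K] N := (e : R ⊗[K] R →ₐ[K] N).comp Algebra.TensorProduct.includeLeft
  let j₂ : R →ₐ[K] N := (e : R ⊗[K] R →ₐ[K] N).comp Algebra.TensorProduct.includeRight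
  have hj₁ : ∀ r, (j₁ r : Ω) = r := fun r ↦ by simp [j₁, he, μ]
  have hj₂ : ∀ r, (j₂ r : Ω) = σ r := fun r ↦ by simp [j₂, he, μ]
  have hes₁ : ∀ r, e.symm (j₁ r) = r ⊗ₜ 1 := fun r ↦ e.symm_apply_apply _
  have hes₂ : ∀ r, e.symm (j₂ r) = 1 ⊗ₜ r := fun r ↦ e.symm_apply_apply _
  -- the comparison of `π` with its conjugate
  have hπ₁ : IsPullback π f g (Spec.map (CommRingCat.ofHom (N.subtype.comp (j₁ : R →+* N)))) := by
    convert hπ using 4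
    ext r
    exact hj₁ r
  have hπ₂ : IsPullback (A.act σ ≫ π) f g
      (Spec.map (CommRingCat.ofHom (N.subtype.comp (j₂ : R →+* N)))) := by
    convert (A.isPullback_act σ).paste_horiz hπ using 1
    rw [← Spec.map_comp, ← CommRingCat.ofHom_comp]
    congr 2
    ext r
    exact hj₂ r
  have hRN : (R : Set Ω) ⊆ N := fun r hr ↦ by
    have := (j₁ ⟨r, hr⟩).2
    rwa [hj₁] at this
  have hi₂ : A.InvariantUnder N (A.act σ ≫ π) := fun ρ hρ ↦ by
    rw [← Category.assoc, ← A.act_mul]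
    refine hi.act_comp_eq fun r hr ↦ hρ _ ?_
    have := (j₂ ⟨r, hr⟩).2
    rwa [hj₂] at this
  obtain ⟨c, P, a, b, I, hPa, hPI, hI⟩ := exists_spread A htr hN g (j₁ : R →+* N) (j₂ : R →+* N)
    hπ₁ hπ₂ (hi.mono hRN) hi₂
  -- a general point of `R`
  have hc0 : e.symm c.elt ≠ 0 := fun h ↦ c.ne_zero
    (congrArg Subtype.val ((map_eq_zero_iff _ e.symm.injective).mp h))
  obtain ⟨r, hr0, hr⟩ := exists_forall_specialize_ne_zero hc0
  obtain ⟨φ, hφ⟩ := exists_algHom_apply_ne_zero (κ := K) hr0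
  have hφc := hr φ hφ
  obtain ⟨ν, hν⟩ := c.exists_lift
    ((R.subtype).comp ((specialize φ : R ⊗[K] R →ₐ[R] R) : R ⊗[K] R →+* R) |>.comp
      (e.symm : N →+* R ⊗[K] R))
    (isUnit_iff_ne_zero.mpr fun h ↦ hφc (Subtype.ext h))
  have hνN (x : N) : ν (c.inc x) = (specialize φ (e.symm x) : R) := congr($hν x)
  have hνj₁ : ν.comp (c.inc.comp (j₁ : R →+* N)) = R.subtype := by
    ext r
    change ν (c.inc (j₁ r)) = r
    rw [hνN, hes₁]; simp
  have hνj₂ : ν.comp (c.inc.comp (j₂ : R →+* N)) = (algebraMap K Ω).comp (φ : R →+* K) := by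
    ext r
    change ν (c.inc (j₂ r)) = _
    rw [hνN, hes₂]; simp
  have hw : π ≫ g = (f ≫ Spec.map (CommRingCat.ofHom ν)) ≫ c.baseMap (j₁ : R →+* N) := by
    rw [hπ.w, Category.assoc, ← Spec.map_comp, ← CommRingCat.ofHom_comp, hνj₁]
  let s : X ⟶ P := hPa.lift π (f ≫ Spec.map (CommRingCat.ofHom ν)) hw
  have hsa : s ≫ a = π := hPa.lift_fst _ _ _
  have hsb : s ≫ b = f ≫ Spec.map (CommRingCat.ofHom ν) := hPa.lift_snd _ _ _
  refine ⟨φ, s ≫ I, ?_, fun τ ↦ ?_⟩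
  · have hs : IsPullback s f b (Spec.map (CommRingCat.ofHom ν)) := by
      refine IsPullback.of_right ?_ hsb hPa
      rw [hsa, ← Spec.map_comp, ← CommRingCat.ofHom_comp, hνj₁]
      exact hπ
    have := hs.paste_horiz hPI
    rwa [← Spec.map_comp, ← CommRingCat.ofHom_comp, hνj₂] at this
  -- equivariance: the comparison with `τ` on the universal family over `Ω ⊗ R`
  let u₁ : N →ₐ[K] Ω ⊗[K] R := (Algebra.TensorProduct.map R.val (AlgHom.id K R)).comp
    (e.symm : N →ₐ[K] R ⊗[K] R)
  let u₂ : N →ₐ[K] Ω ⊗[K] R := (Algebra.TensorProduct.map ((τ : Ω →ₐ[K] Ω).comp R.val)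
    (AlgHom.id K R)).comp (e.symm : N →ₐ[K] R ⊗[K] R)
  let d := u₁ c.elt * u₂ c.elt
  let C := Localization.Away d
  have hd : IsUnit (algebraMap (Ω ⊗[K] R) C d) := IsLocalization.Away.algebraMap_isUnit d
  obtain ⟨v₁, hv₁⟩ := c.exists_lift ((algebraMap (Ω ⊗[K] R) C).comp (u₁ : N →+* Ω ⊗[K] R))
    (isUnit_of_mul_isUnit_left (y := algebraMap (Ω ⊗[K] R) C (u₂ c.elt))
      (by rw [map_mul] at hd; exact hd))
  obtain ⟨v₂, hv₂⟩ := c.exists_lift ((algebraMap (Ω ⊗[K] R) C).comp (u₂ : N →+* Ω ⊗[K] R))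
    (isUnit_of_mul_isUnit_right (x := algebraMap (Ω ⊗[K] R) C (u₁ c.elt))
      (by rw [map_mul] at hd; exact hd))
  have hv₁' (x : N) : v₁ (c.inc x) = algebraMap _ C (u₁ x) := congr($hv₁ x)
  have hv₂' (x : N) : v₂ (c.inc x) = algebraMap _ C (u₂ x) := congr($hv₂ x)
  have hu₁j₁ (r : R) : u₁ (j₁ r) = (r : Ω) ⊗ₜ 1 := by simp [u₁, hes₁]
  have hu₁j₂ (r : R) : u₁ (j₂ r) = 1 ⊗ₜ r := by simp [u₁, hes₂]
  have hu₂j₁ (r : R) : u₂ (j₁ r) = (τ r : Ω) ⊗ₜ 1 := by simp [u₂, hes₁]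
  have hu₂j₂ (r : R) : u₂ (j₂ r) = 1 ⊗ₜ r := by simp [u₂, hes₂]
  have htmul (t : C →ₐ[Ω] Ω) (x : Ω) : t (algebraMap (Ω ⊗[K] R) C (x ⊗ₜ 1)) = x :=
    t.commutes x
  have hQ := IsPullback.of_hasPullback f (Spec.map (CommRingCat.ofHom (algebraMap Ω C)))
  set p := pullback.fst f (Spec.map (CommRingCat.ofHom (algebraMap Ω C)))
  set q := pullback.snd f (Spec.map (CommRingCat.ofHom (algebraMap Ω C)))
  have w₁ : (p ≫ π) ≫ g = (q ≫ Spec.map (CommRingCat.ofHom v₁)) ≫ c.baseMap (j₁ : R →+* N) := by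
    rw [Category.assoc, hπ.w, reassoc_of% hQ.w, Category.assoc, ← Spec.map_comp, ← Spec.map_comp,
      ← CommRingCat.ofHom_comp, ← CommRingCat.ofHom_comp]
    congr 3
    ext r
    change _ = v₁ (c.inc (j₁ r))
    rw [hv₁', hu₁j₁]
    rfl
  have w₂ : (p ≫ A.act τ ≫ π) ≫ g =
      (q ≫ Spec.map (CommRingCat.ofHom v₂)) ≫ c.baseMap (j₁ : R →+* N) := by
    rw [Category.assoc, Category.assoc, hπ.w, A.act_comp_assoc, reassoc_of% hQ.w, Category.assoc,
      ← Spec.map_comp, ← Spec.map_comp, ← Spec.map_comp, ← CommRingCat.ofHom_comp,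
      ← CommRingCat.ofHom_comp, ← CommRingCat.ofHom_comp]
    congr 3
    ext r
    change _ = v₂ (c.inc (j₁ r))
    rw [hv₂', hu₂j₁]
    rfl
  let s₁ := hPa.lift (p ≫ π) (q ≫ Spec.map (CommRingCat.ofHom v₁)) w₁
  let s₂ := hPa.lift (p ≫ A.act τ ≫ π) (q ≫ Spec.map (CommRingCat.ofHom v₂)) w₂
  have s₁a : s₁ ≫ a = p ≫ π := hPa.lift_fst _ _ _
  have s₁b : s₁ ≫ b = q ≫ Spec.map (CommRingCat.ofHom v₁) := hPa.lift_snd _ _ _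
  have s₂a : s₂ ≫ a = p ≫ A.act τ ≫ π := hPa.lift_fst _ _ _
  have s₂b : s₂ ≫ b = q ≫ Spec.map (CommRingCat.ofHom v₂) := hPa.lift_snd _ _ _
  -- pulling back along sections
  have sec₁ (t : C →ₐ[Ω] Ω) (r : X ⟶ _) (hr₁ : r ≫ p = 𝟙 X)
      (hr₂ : r ≫ q = f ≫ Spec.map (CommRingCat.ofHom (t : C →+* Ω))) :
      (r ≫ s₁) ≫ a = π ∧
        (r ≫ s₁) ≫ b = f ≫ Spec.map (CommRingCat.ofHom ((t : C →+* Ω).comp v₁)) := by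
    constructor
    · rw [Category.assoc, s₁a, reassoc_of% hr₁]
    · rw [Category.assoc, s₁b, reassoc_of% hr₂, ← Spec.map_comp, ← CommRingCat.ofHom_comp]
  have sec₂ (t : C →ₐ[Ω] Ω) (r : X ⟶ _) (hr₁ : r ≫ p = 𝟙 X)
      (hr₂ : r ≫ q = f ≫ Spec.map (CommRingCat.ofHom (t : C →+* Ω))) :
      (A.act τ⁻¹ ≫ r ≫ s₂) ≫ a = π ∧ (A.act τ⁻¹ ≫ r ≫ s₂) ≫ b = f ≫ Spec.map (CommRingCat.ofHom
        (((τ⁻¹ : Ω ≃ₐ[K] Ω) : Ω →+* Ω).comp ((t : C →+* Ω).comp v₂))) := by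
    constructor
    · rw [Category.assoc, Category.assoc, s₂a, reassoc_of% hr₁, A.act_inv_comp_assoc]
    · rw [Category.assoc, Category.assoc, s₂b, reassoc_of% hr₂, A.act_comp_assoc, ← Spec.map_comp,
        ← Spec.map_comp, ← CommRingCat.ofHom_comp, ← CommRingCat.ofHom_comp]
      rfl
  let A₀ : Subalgebra K Ω := R ⊔ R.map (τ : Ω →ₐ[K] Ω)
  have hA₀ : A₀.FG := hR.sup (hR.map _)
  have ev₁ (σ' : Ω ≃ₐ[K] Ω) (hσ' : IsGenericAut A₀ R σ') :
      Function.Injective fun x : N ↦ evalAut R σ' (u₁ x) := by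
    have h := productMap_injective_of_le hσ' R.val Subtype.val_injective
      fun r ↦ (le_sup_left : R ≤ A₀) r.2
    convert h.comp e.symm.injective using 1
    exact funext fun x ↦ evalAut_map σ' _ _
  have ev₂ (σ' : Ω ≃ₐ[K] Ω) (hσ' : IsGenericAut A₀ R σ') :
      Function.Injective fun x : N ↦ evalAut R σ' (u₂ x) := by
    have h := productMap_injective_of_le hσ' ((τ : Ω →ₐ[K] Ω).comp R.val)
      (τ.injective.comp Subtype.val_injective)
      fun r ↦ (le_sup_right : _ ≤ A₀) (Subalgebra.mem_map.mpr ⟨r, r.2, rfl⟩)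
    convert h.comp e.symm.injective using 1
    exact funext fun x ↦ evalAut_map σ' _ _
  have helt : c.elt ≠ 0 := fun h ↦ c.ne_zero (congrArg Subtype.val h)
  have hq : s₁ ≫ I = s₂ ≫ I := by
    refine eq_of_forall_section_comp_eq (T := {t : C →ₐ[Ω] Ω | ∃ σ', IsGenericAut A₀ R σ' ∧
      ∀ x, t (algebraMap _ _ x) = evalAut R σ' x}) (fun x hx ↦ ?_) hQ g ?_ ?_
    · by_contra hx0
      obtain ⟨σ', t, h₁, h₂, h₃⟩ := exists_isGenericAut_apply_ne_zero htr hA₀ hR d (fun σ' hσ' ↦ by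
        rw [map_mul]
        refine mul_ne_zero (fun h ↦ helt ?_) (fun h ↦ helt ?_)
        · exact ev₁ σ' hσ' (h.trans (by simp only [map_zero]))
        · exact ev₂ σ' hσ' (h.trans (by simp only [map_zero]))) x hx0
      exact h₃ (hx t ⟨σ', h₁, h₂⟩)
    · rw [Category.assoc, Category.assoc, hPI.w, reassoc_of% s₁b, reassoc_of% s₂b, ← Spec.map_comp,
        ← Spec.map_comp, ← CommRingCat.ofHom_comp, ← CommRingCat.ofHom_comp]
      congr 3
      ext r
      change v₁ (c.inc (j₂ r)) = v₂ (c.inc (j₂ r))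
      rw [hv₁', hv₂', hu₁j₂, hu₂j₂]
    · rintro t ⟨σ', hσ', ht⟩ r hr₁ hr₂
      obtain ⟨k₁, k₂⟩ := sec₁ t r hr₁ hr₂
      obtain ⟨k₃, k₄⟩ := sec₂ t r hr₁ hr₂
      have e₁ := lift_comp_eq_act_comp A htr hN hi hj₁ hj₂ hPa hI hπ.w ((t : C →+* Ω).comp v₁)
        (σ' := σ') (fun r ↦ by
          change t (v₁ _) = _
          rw [hv₁', hu₁j₁, htmul]) (fun r ↦ by
          change t (v₁ _) = _
          rw [hv₁', hu₁j₂, ht]; simp) (by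
          convert ev₁ σ' hσ' using 1
          ext x
          change t (v₁ _) = _
          rw [hv₁', ht]) _ k₁ k₂
      have e₂ := lift_comp_eq_act_comp A htr hN hi hj₁ hj₂ hPa hI hπ.w
        (((τ⁻¹ : Ω ≃ₐ[K] Ω) : Ω →+* Ω).comp ((t : C →+* Ω).comp v₂))
        (σ' := τ⁻¹ * σ') (fun r ↦ by
          change τ⁻¹ (t (v₂ _)) = _
          rw [hv₂', hu₂j₁, htmul]
          exact τ.symm_apply_apply _) (fun r ↦ by
          change τ⁻¹ (t (v₂ _)) = _
          rw [hv₂', hu₂j₂, ht]; simp) (by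
          convert (τ⁻¹ : Ω ≃ₐ[K] Ω).injective.comp (ev₂ σ' hσ') using 1
          ext x
          change τ⁻¹ (t (v₂ _)) = _
          rw [hv₂', ht]
          rfl) _ k₃ k₄
      rw [← Category.assoc, ← Category.assoc, e₁]
      rw [Category.assoc, Category.assoc, A.act_mul, Category.assoc, cancel_epi] at e₂
      rw [← e₂, Category.assoc]
  -- specialization of the universal comparison at `φ`
  have hev₁ (x : N) : specialize φ (u₁ x) = ν (c.inc x) :=
    (specialize_map φ R.val (e.symm x)).trans (hνN x).symm
  have hev₂ (x : N) : specialize φ (u₂ x) = τ (ν (c.inc x)) :=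
    (specialize_map φ ((τ : Ω →ₐ[K] Ω).comp R.val) (e.symm x)).trans (congrArg τ (hνN x).symm)
  have hνc : ν (c.inc c.elt) ≠ 0 := by
    rw [hνN]
    exact fun h ↦ hφc (Subtype.ext h)
  have hdφ : IsUnit (specialize (B := Ω) φ d) := by
    rw [isUnit_iff_ne_zero, map_mul, hev₁, hev₂]
    exact mul_ne_zero hνc ((map_ne_zero_iff τ τ.injective).mpr hνc)
  let t : C →ₐ[Ω] Ω := IsLocalization.liftAlgHom (M := Submonoid.powers d)
    (f := specialize (B := Ω) φ) (by
      rintro ⟨_, n, rfl⟩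
      simpa using hdφ.pow n)
  have ht (x) : t (algebraMap _ _ x) = specialize φ x := IsLocalization.lift_eq _ x
  let r : X ⟶ _ := hQ.lift (𝟙 X) (f ≫ Spec.map (CommRingCat.ofHom (t : C →+* Ω))) (by
    rw [Category.assoc, ← Spec.map_comp, ← CommRingCat.ofHom_comp]
    simp)
  obtain ⟨k₁, k₂⟩ := sec₁ t r (hQ.lift_fst _ _ _) (hQ.lift_snd _ _ _)
  obtain ⟨k₃, k₄⟩ := sec₂ t r (hQ.lift_fst _ _ _) (hQ.lift_snd _ _ _)
  have e₁ : r ≫ s₁ = s := hPa.hom_ext (k₁.trans hsa.symm) (by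
    rw [k₂, hsb]
    congr 3
    refine c.hom_ext (RingHom.ext fun x ↦ ?_)
    change t (v₁ _) = ν _
    rw [hv₁', ht, hev₁])
  have e₂ : A.act τ⁻¹ ≫ r ≫ s₂ = s := hPa.hom_ext (k₃.trans hsa.symm) (by
    rw [k₄, hsb]
    congr 3
    refine c.hom_ext (RingHom.ext fun x ↦ ?_)
    change τ⁻¹ (t (v₂ _)) = ν _
    rw [hv₂', ht, hev₂]
    exact τ.symm_apply_apply _)
  calc A.act τ ≫ s ≫ I = A.act τ ≫ A.act τ⁻¹ ≫ r ≫ s₂ ≫ I := by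
        conv_lhs => rw [← e₂]
        simp only [Category.assoc]
    _ = r ≫ s₁ ≫ I := by rw [A.act_comp_inv_assoc, hq]
    _ = s ≫ I := by rw [← Category.assoc, e₁]

end Specialization

/-! ### Stability of subschemes of projective space -/

section Stable

attribute [local instance] MvPolynomial.gradedAlgebra

/-- A morphism from a reduced scheme factors through an immersion as soon as it does so on the
underlying sets. -/
lemma exists_comp_eq_of_range_subset {T X Y : Scheme.{u}} [IsReduced T] (h : T ⟶ Y) (j : X ⟶ Y)
    [IsImmersion j] (H : Set.range h ⊆ Set.range j) : ∃ u : T ⟶ X, u ≫ j = h := by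
  let h' : T ⟶ j.coborderRange := IsOpenImmersion.lift j.coborderRange.ι h (by
    refine H.trans ?_
    simpa using! subset_coborder)
  have hh' : h' ≫ j.coborderRange.ι = h := IsOpenImmersion.lift_fac _ _ _
  have : Surjective (pullback.fst h' j.liftCoborder) := by
    refine ⟨fun t ↦ ?_⟩
    obtain ⟨x, hx⟩ := H ⟨t, rfl⟩
    have : h' t = j.liftCoborder x := by
      apply j.coborderRange.ι.injective
      rw [← Scheme.Hom.comp_apply, ← Scheme.Hom.comp_apply, hh', j.liftCoborder_ι, hx]
    obtain ⟨z, hz, -⟩ := Scheme.Pullback.exists_preimage_pullback t x this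
    exact ⟨z, hz⟩
  have : IsIso (pullback.fst h' j.liftCoborder) := isIso_of_isClosedImmersion_of_surjective _
  refine ⟨inv (pullback.fst h' j.liftCoborder) ≫ pullback.snd h' j.liftCoborder, ?_⟩
  rw [Category.assoc, IsIso.inv_comp_eq]
  calc pullback.snd h' j.liftCoborder ≫ j
      = pullback.snd h' j.liftCoborder ≫ j.liftCoborder ≫ j.coborderRange.ι := by
        rw [j.liftCoborder_ι]
    _ = pullback.fst h' j.liftCoborder ≫ h := by
        rw [← Category.assoc, ← pullback.condition, Category.assoc, hh']

variable {n : ℕ} {Ω : Type u} [Field Ω]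

/-- An automorphism that fixes the coefficients of finitely many polynomials fixes the
polynomials. -/
lemma exists_finset_coeff (t : Finset (MvPolynomial (Fin (n + 1)) Ω)) :
    ∃ s : Finset Ω, ∀ (σ : Ω →+* Ω), (∀ x ∈ s, σ x = x) → ∀ p ∈ t, MvPolynomial.map σ p = p := by
  classical
  refine ⟨t.biUnion fun p ↦ p.support.image fun m ↦ p.coeff m, fun σ hσ p hp ↦ ?_⟩
  ext m
  rw [MvPolynomial.coeff_map]
  by_cases hm : m ∈ p.support
  · exact hσ _ (Finset.mem_biUnion.mpr ⟨p, hp, Finset.mem_image_of_mem _ hm⟩)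
  · rw [MvPolynomial.notMem_support_iff.mp hm, map_zero]

lemma exists_finset_zeroLocus {Z : Set (Pn n Ω)} (hZ : IsClosed Z) :
    ∃ t : Finset (MvPolynomial (Fin (n + 1)) Ω),
      Z = ProjectiveSpectrum.zeroLocus (homog n Ω) t := by
  obtain ⟨s, rfl⟩ := (ProjectiveSpectrum.isClosed_iff_zeroLocus (homog n Ω) Z).mp hZ
  obtain ⟨t, ht⟩ : (Ideal.span s).FG := IsNoetherian.noetherian _
  exact ⟨t, by rw [← ProjectiveSpectrum.zeroLocus_span, ← ht, ProjectiveSpectrum.zeroLocus_span]⟩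

lemma preimage_map_zeroLocus (σ : Ω →+* Ω) (t : Set (MvPolynomial (Fin (n + 1)) Ω))
    (ht : ∀ p ∈ t, MvPolynomial.map σ p = p) :
    Pn.map σ ⁻¹' (ProjectiveSpectrum.zeroLocus (homog n Ω) t) =
      ProjectiveSpectrum.zeroLocus (homog n Ω) t := by
  ext x
  have key : ∀ p ∈ t,
      (p ∈ ((Pn.map (n := n) σ x : ProjectiveSpectrum (homog n Ω))).asHomogeneousIdeal ↔
      p ∈ (x : ProjectiveSpectrum (homog n Ω)).asHomogeneousIdeal) := by
    intro p hp
    conv_rhs => rw [← ht p hp]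
    rfl
  exact forall₂_congr key

/-- A closed subset of projective space is stable under the automorphisms fixing the coefficients
of its equations. -/
lemma exists_finset_preimage_eq {Z : Set (Pn n Ω)} (hZ : IsClosed Z) :
    ∃ s : Finset Ω, ∀ σ : Ω →+* Ω, (∀ x ∈ s, σ x = x) → Pn.map σ ⁻¹' Z = Z := by
  obtain ⟨t, rfl⟩ := exists_finset_zeroLocus hZ
  obtain ⟨s, hs⟩ := exists_finset_coeff t
  exact ⟨s, fun σ hσ ↦ preimage_map_zeroLocus (n := n) σ (t : Set _)
    fun p hp ↦ hs σ hσ p (Finset.mem_coe.mp hp)⟩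

/-- The transport of a reduced subscheme of projective space through the coordinates: an
automorphism that fixes the coefficients of the equations of the closure and of the boundary of `X`
maps `X` to itself. -/
lemma exists_finset_forall_exists_comp_eq {X : Scheme.{u}} [IsReduced X] (i : X ⟶ Pn n Ω)
    [IsImmersion i] :
    ∃ s : Finset Ω, ∀ σ : Ω ≃+* Ω, (∀ x ∈ s, σ x = x) →
      ∃ u : X ⟶ X, u ≫ i = i ≫ Pn.map (σ : Ω →+* Ω) := by
  classical
  obtain ⟨s₁, h₁⟩ := exists_finset_preimage_eq (isClosed_closure (s := Set.range i))
  obtain ⟨s₂, h₂⟩ := exists_finset_preimage_eq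
    (i.isLocallyClosed_range.isOpen_coborder.isClosed_compl)
  refine ⟨s₁ ∪ s₂, fun σ hσ ↦ exists_comp_eq_of_range_subset _ i ?_⟩
  rintro _ ⟨x, rfl⟩
  have hx : i x ∈ closure (Set.range i) ∩ coborder (Set.range i) := by
    rw [closure_inter_coborder]
    exact ⟨x, rfl⟩
  rw [← closure_inter_coborder (s := Set.range i), Scheme.Hom.comp_apply]
  refine ⟨?_, ?_⟩
  · rw [← h₁ (σ : Ω →+* Ω) fun x hx ↦ hσ x (Finset.mem_union_left _ hx)] at hx
    exact hx.1
  · by_contra h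
    have h' : i x ∈ Pn.map (σ : Ω →+* Ω) ⁻¹' (coborder (Set.range i))ᶜ := h
    rw [h₂ (σ : Ω →+* Ω) fun x hx ↦ hσ x (Finset.mem_union_right _ hx)] at h'
    exact h' hx.2

end Stable

/-! ### Equivariance from rigidity -/

section Equivariance

variable {n : ℕ} {K Ω : Type u} [Field K] [Field Ω] [Algebra K Ω]
  {X : Scheme.{u}} {f : X ⟶ Spec (.of Ω)} (A : SemilinearAction K f)

/-- `i` is equivariant for the automorphisms fixing the set `s` pointwise, which act on projective
space through the coefficients. -/
def SemilinearAction.EquivariantUnder (s : Set Ω) (i : X ⟶ Pn n Ω) : Prop :=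
  ∀ σ : Ω ≃ₐ[K] Ω, (∀ x ∈ s, σ x = x) →
    A.act σ ≫ i = i ≫ Pn.map ((σ : Ω ≃+* Ω) : Ω →+* Ω)

/-- The points of `X` fixed by an action rigidify projective embeddings: an embedding `i` is
automatically equivariant for all automorphisms that fix its coefficients and those of the points,
since the action and the transport along `i` differ by an automorphism of `X` that fixes the given
points. -/
theorem exists_equivariantUnder [IsReduced X] (i : X ⟶ Pn n Ω) [IsImmersion i]
    (hi : i ≫ Pn.toSpec n Ω = f) {S : Set (Spec (.of Ω) ⟶ X)} (hS : S.Finite)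
    (hSf : ∀ P ∈ S, P ≫ f = 𝟙 _)
    (hrigid : ∀ α : X ≅ X, α.hom ≫ f = f → (∀ P ∈ S, P ≫ α.hom = P) → α.hom = 𝟙 X)
    (s₀ : Finset Ω) (hfix : ∀ σ : Ω ≃ₐ[K] Ω, (∀ x ∈ s₀, σ x = x) → ∀ P ∈ S,
      P ≫ A.act σ = Spec.map (CommRingCat.ofHom ((σ : Ω ≃+* Ω) : Ω →+* Ω)) ≫ P) :
    ∃ s : Finset Ω, A.EquivariantUnder s i := by
  classical
  obtain ⟨s₁, h₁⟩ := exists_finset_forall_exists_comp_eq i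
  -- the points have coordinates in a finitely generated field: they are themselves subschemes
  -- of projective space
  have hP (P : Spec (.of Ω) ⟶ X) (hPS : P ∈ S) : ∃ t : Finset Ω, ∀ σ : Ω ≃+* Ω,
      (∀ x ∈ t, σ x = x) → P ≫ i ≫ Pn.map (σ : Ω →+* Ω) =
        Spec.map (CommRingCat.ofHom (σ : Ω →+* Ω)) ≫ P ≫ i := by
    have hs : (P ≫ i) ≫ Pn.toSpec n Ω = 𝟙 _ := by rw [Category.assoc, hi, hSf P hPS]
    have : IsImmersion ((P ≫ i) ≫ Pn.toSpec n Ω) := by rw [hs]; infer_instance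
    have : IsImmersion (P ≫ i) := IsImmersion.of_comp _ (Pn.toSpec n Ω)
    obtain ⟨t, ht⟩ := exists_finset_forall_exists_comp_eq (P ≫ i)
    refine ⟨t, fun σ hσ ↦ ?_⟩
    obtain ⟨u, hu⟩ := ht σ hσ
    have h2 := hu =≫ Pn.toSpec n Ω
    rw [Category.assoc, hs, Category.comp_id, Category.assoc, Pn.map_toSpec, ← Category.assoc, hs,
      Category.id_comp] at h2
    rw [← Category.assoc, ← hu, h2]
  choose! t ht using hP
  let s : Finset Ω := s₀ ∪ s₁ ∪ hS.toFinset.biUnion t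
  have key (σ : Ω ≃ₐ[K] Ω) (hσ : ∀ x ∈ s, σ x = x) : ∃ u : X ⟶ X,
      u ≫ i = i ≫ Pn.map ((σ : Ω ≃+* Ω) : Ω →+* Ω) :=
    h₁ (σ : Ω ≃+* Ω) fun x hx ↦ hσ x (by simp [s, hx])
  refine ⟨s, fun σ hσ ↦ ?_⟩
  have hσ' : ∀ x ∈ s, σ⁻¹ x = x := fun x hx ↦ by
    conv_lhs => rw [← hσ x (Finset.mem_coe.mpr hx)]
    exact σ.symm_apply_apply x
  obtain ⟨u, hu⟩ := key σ hσ
  obtain ⟨v, hv⟩ := key σ⁻¹ hσ'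
  have hmap : Pn.map (n := n) ((σ : Ω ≃+* Ω) : Ω →+* Ω) ≫ Pn.map ((σ⁻¹ : Ω ≃ₐ[K] Ω) : Ω →+* Ω) =
      𝟙 _ := by
    rw [← Pn.map_comp, ← Pn.map_id]
    congr 1
    ext x
    exact σ.apply_symm_apply x
  have hmap' : Pn.map (n := n) ((σ⁻¹ : Ω ≃ₐ[K] Ω) : Ω →+* Ω) ≫ Pn.map ((σ : Ω ≃+* Ω) : Ω →+* Ω) =
      𝟙 _ := by
    rw [← Pn.map_comp, ← Pn.map_id]
    congr 1
    ext x
    exact σ.symm_apply_apply x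
  have huv : u ≫ v = 𝟙 X := by
    rw [← cancel_mono i, Category.assoc, hv, reassoc_of% hu]
    exact (congrArg (i ≫ ·) hmap).trans (by simp)
  have hvu : v ≫ u = 𝟙 X := by
    rw [← cancel_mono i, Category.assoc, hu, reassoc_of% hv]
    exact (congrArg (i ≫ ·) hmap').trans (by simp)
  have huf : u ≫ f = f ≫ Spec.map (CommRingCat.ofHom ((σ : Ω ≃+* Ω) : Ω →+* Ω)) := by
    rw [← hi, reassoc_of% hu, Pn.map_toSpec, Category.assoc]
  have hSpec : Spec.map (CommRingCat.ofHom (((σ⁻¹ : Ω ≃ₐ[K] Ω) : Ω ≃+* Ω) : Ω →+* Ω)) ≫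
      Spec.map (CommRingCat.ofHom ((σ : Ω ≃+* Ω) : Ω →+* Ω)) = 𝟙 _ := by
    rw [← Spec.map_comp, ← CommRingCat.ofHom_comp, ← Spec.map_id]
    congr 2
    ext x
    exact σ.symm_apply_apply x
  have hPu (P) (hPS : P ∈ S) :
      P ≫ u = Spec.map (CommRingCat.ofHom ((σ : Ω ≃+* Ω) : Ω →+* Ω)) ≫ P := by
    rw [← cancel_mono i, Category.assoc, Category.assoc, hu]
    exact ht P hPS σ fun x hx ↦ hσ x
      (Finset.mem_union_right _ (Finset.mem_biUnion.mpr ⟨P, hS.mem_toFinset.mpr hPS, hx⟩))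
  -- the automorphism by which the action and the transport `u` along `i` differ
  let α : X ≅ X := ⟨A.act σ⁻¹ ≫ u, v ≫ A.act σ,
    by rw [Category.assoc, reassoc_of% huv, A.act_inv_comp],
    by rw [Category.assoc, A.act_comp_inv_assoc, hvu]⟩
  have hα : α.hom = 𝟙 X := by
    refine hrigid α ?_ fun P hPS ↦ ?_
    · change (A.act σ⁻¹ ≫ u) ≫ f = f
      rw [Category.assoc, huf, ← Category.assoc, A.act_comp, Category.assoc, hSpec,
        Category.comp_id]
    · change P ≫ A.act σ⁻¹ ≫ u = P
      rw [← Category.assoc, hfix σ⁻¹ (fun x hx ↦ hσ' x (by simp [s, hx])) P hPS, Category.assoc,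
        hPu P hPS, reassoc_of% hSpec]
  have : u = A.act σ := by
    have h2 : A.act σ ≫ α.hom = u := A.act_comp_inv_assoc σ u
    rw [← h2, hα, Category.comp_id]
  rw [← this, hu]

end Equivariance

/-! ### Models of closed subschemes -/

section ClosedModel

open Scheme

/-- An element of a pushout of rings involves only finitely many elements of the second ring. -/
lemma exists_finset_mem_of_isPushout {A B C D : CommRingCat.{u}} {a : A ⟶ B} {b : A ⟶ C}
    {inl : B ⟶ D} {inr : C ⟶ D} (h : IsPushout a b inl inr) (x : D) :
    ∃ e : Finset C, ∀ T : Subring D, (∀ y, inl y ∈ T) → (∀ c ∈ e, inr c ∈ T) → x ∈ T := by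
  classical
  let U : Subring D := Subring.closure (Set.range inl ∪ Set.range inr)
  have hx : x ∈ U := by
    let l : B ⟶ CommRingCat.of U := CommRingCat.ofHom
      (inl.hom.codRestrict U fun y ↦ Subring.subset_closure (Or.inl ⟨y, rfl⟩))
    let r : C ⟶ CommRingCat.of U := CommRingCat.ofHom
      (inr.hom.codRestrict U fun y ↦ Subring.subset_closure (Or.inr ⟨y, rfl⟩))
    let incl : CommRingCat.of U ⟶ D := CommRingCat.ofHom U.subtype
    have hlr : a ≫ l = b ≫ r := by
      ext y
      exact congrArg (fun φ ↦ φ.hom y) h.w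
    have : h.desc l r hlr ≫ incl = 𝟙 D := by
      apply h.hom_ext
      · rw [h.inl_desc_assoc, Category.comp_id]; rfl
      · rw [h.inr_desc_assoc, Category.comp_id]; rfl
    have h2 : ((h.desc l r hlr x : U) : D) = x := congrArg (fun φ ↦ φ.hom x) this
    exact h2 ▸ (h.desc l r hlr x : U).2
  induction hx using Subring.closure_induction with
  | mem x hx =>
    obtain ⟨y, rfl⟩ | ⟨c, rfl⟩ := hx
    · exact ⟨∅, fun T h _ ↦ h y⟩
    · exact ⟨{c}, fun T _ h ↦ h c (Finset.mem_singleton_self c)⟩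
  | zero => exact ⟨∅, fun T _ _ ↦ T.zero_mem⟩
  | one => exact ⟨∅, fun T _ _ ↦ T.one_mem⟩
  | add x y _ _ hx hy =>
    obtain ⟨e₁, h₁⟩ := hx
    obtain ⟨e₂, h₂⟩ := hy
    exact ⟨e₁ ∪ e₂, fun T h h' ↦ T.add_mem
      (h₁ T h fun c hc ↦ h' c (Finset.mem_union_left _ hc))
      (h₂ T h fun c hc ↦ h' c (Finset.mem_union_right _ hc))⟩
  | neg x _ hx =>
    obtain ⟨e₁, h₁⟩ := hx
    exact ⟨e₁, fun T h h' ↦ T.neg_mem (h₁ T h h')⟩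
  | mul x y _ _ hx hy =>
    obtain ⟨e₁, h₁⟩ := hx
    obtain ⟨e₂, h₂⟩ := hy
    exact ⟨e₁ ∪ e₂, fun T h h' ↦ T.mul_mem
      (h₁ T h fun c hc ↦ h' c (Finset.mem_union_left _ hc))
      (h₂ T h fun c hc ↦ h' c (Finset.mem_union_right _ hc))⟩

variable {K Ω : Type u} [Field K] [Field Ω] [Algebra K Ω]

/-- A section over the preimage of an affine open involves only finitely many scalars. -/
lemma exists_finset_mem_range_app {Y₁ Y' : Scheme.{u}} {q₁ : Y' ⟶ Y₁}
    {g' : Y' ⟶ Spec (.of Ω)} {g₁ : Y₁ ⟶ Spec (.of K)}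
    (h : IsPullback q₁ g' g₁ (Spec.map (CommRingCat.ofHom (algebraMap K Ω))))
    {W : Y₁.Opens} (hW : IsAffineOpen W) (x : Γ(Y', q₁ ⁻¹ᵁ W)) :
    ∃ e : Finset Ω, ∀ (R : Subalgebra K Ω), (e : Set Ω) ⊆ R →
      ∀ {Y : Scheme.{u}} (q' : Y' ⟶ Y) (q : Y ⟶ Y₁) (g : Y ⟶ Spec (.of R)) (hq : q' ≫ q = q₁),
        q' ≫ g = g' ≫ Spec.map (CommRingCat.ofHom R.subtype) →
        ∃ y, (q'.appLE (q ⁻¹ᵁ W) (q₁ ⁻¹ᵁ W) (by rw [← hq]; exact le_rfl)).hom y = x := by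
  classical
  have hp := (isIso_pushoutSection_iff h (US := ⊤) (UT := ⊤) (UX := W) (UY := q₁ ⁻¹ᵁ W)
    le_top le_top (by simp)).mp
    (isIso_pushoutSection_of_isAffineOpen h (by exact le_top) (by exact le_top) (by simp)
      (isAffineOpen_top _) (isAffineOpen_top _) hW)
  obtain ⟨e, he⟩ := exists_finset_mem_of_isPushout hp x
  refine ⟨e.image (ΓSpecIso (.of Ω)).hom, fun R hR Y q' q g hq hg ↦ ?_⟩
  subst hq
  refine he (q'.appLE (q ⁻¹ᵁ W) ((q' ≫ q) ⁻¹ᵁ W) le_rfl).hom.range (fun y ↦ ?_) fun c hc ↦ ?_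
  · refine ⟨q.appLE W (q ⁻¹ᵁ W) le_rfl y, ?_⟩
    exact congrArg (fun φ ↦ φ.hom y) (Scheme.Hom.appLE_comp_appLE q' q W (q ⁻¹ᵁ W) ((q' ≫ q) ⁻¹ᵁ W)
      le_rfl le_rfl)
  · have hc' : (ΓSpecIso (.of Ω)).hom c ∈ R := hR (Finset.mem_image_of_mem _ hc)
    let r : R := ⟨_, hc'⟩
    refine ⟨g.appLE ⊤ (q ⁻¹ᵁ W) le_top ((ΓSpecIso (.of R)).inv r), ?_⟩
    have h1 := Scheme.Hom.appLE_comp_appLE q' g ⊤ (q ⁻¹ᵁ W) ((q' ≫ q) ⁻¹ᵁ W) le_top le_rfl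
    let w : Spec (.of Ω) ⟶ Spec (.of R) := Spec.map (CommRingCat.ofHom R.subtype)
    have h2 : w.appTop
        ((ΓSpecIso (.of R)).inv r) = c := by
      have := congrArg (fun φ ↦ φ.hom r) (Scheme.ΓSpecIso_inv_naturality
        (CommRingCat.ofHom R.subtype : CommRingCat.of R ⟶ .of Ω))
      refine this.symm.trans ?_
      change (ΓSpecIso (.of Ω)).inv.hom ((ΓSpecIso (.of Ω)).hom.hom c) = c
      rw [← CommRingCat.comp_apply, Iso.hom_inv_id]
      rfl
    have h3 : (q' ≫ g).appLE ⊤ ((q' ≫ q) ⁻¹ᵁ W) le_top =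
        w.appTop ≫ g'.appLE ⊤ ((q' ≫ q) ⁻¹ᵁ W) le_top := by
      have h4 := Scheme.Hom.appLE_comp_appLE g' w ⊤ ⊤
        ((q' ≫ q) ⁻¹ᵁ W) le_top le_top
      have h5 : w.appLE ⊤ ⊤ le_top =
          w.appTop := Scheme.Hom.appLE_eq_app _
      rw [← h5, h4]
      congr 1
    refine (congrArg (fun φ ↦ φ.hom ((ΓSpecIso (.of R)).inv r)) (h1.trans h3)).trans ?_
    exact congrArg (g'.appLE ⊤ ((q' ≫ q) ⁻¹ᵁ W) le_top).hom h2

/-- A closed subscheme of the base change `Y'` of `Y₁` to `Ω` is defined over a finitely generated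
algebra `R`: once `R` contains the coefficients of the local equations, the subscheme is the
base change of its scheme theoretic image in the base change of `Y₁` to `R`. -/
lemma exists_finset_isPullback_toImage {X Y₁ Y' : Scheme.{u}} [CompactSpace Y₁]
    [IsLocallyNoetherian Y'] {q₁ : Y' ⟶ Y₁}
    {g' : Y' ⟶ Spec (.of Ω)} {g₁ : Y₁ ⟶ Spec (.of K)}
    (h : IsPullback q₁ g' g₁ (Spec.map (CommRingCat.ofHom (algebraMap K Ω))))
    [IsAffineHom q₁] (j : X ⟶ Y') [IsClosedImmersion j] :
    ∃ e : Finset Ω, ∀ (R : Subalgebra K Ω), (e : Set Ω) ⊆ R →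
      ∀ {Y : Scheme.{u}} (q' : Y' ⟶ Y) (q : Y ⟶ Y₁) (g : Y ⟶ Spec (.of R)) [IsAffineHom q']
        [IsAffineHom q], q' ≫ q = q₁ → q' ≫ g = g' ≫ Spec.map (CommRingCat.ofHom R.subtype) →
        IsPullback j (j ≫ q').toImage q' (j ≫ q').imageι := by
  classical
  have hgen (W : Y₁.affineOpens) : ∃ t : Finset Γ(Y', q₁ ⁻¹ᵁ W.1),
      Ideal.span (t : Set _) = j.ker.ideal ⟨_, W.2.preimage q₁⟩ := by
    have : IsNoetherianRing Γ(Y', q₁ ⁻¹ᵁ W.1) :=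
      IsLocallyNoetherian.component_noetherian ⟨_, W.2.preimage q₁⟩
    exact IsNoetherian.noetherian (j.ker.ideal ⟨_, W.2.preimage q₁⟩)
  choose t ht using hgen
  choose e he using fun (W : Y₁.affineOpens) (x : Γ(Y', q₁ ⁻¹ᵁ W.1)) ↦
    exists_finset_mem_range_app h W.2 x
  obtain ⟨F, hF⟩ := isCompact_univ.elim_finite_subcover
    (fun W : Y₁.affineOpens ↦ (W.1 : Set Y₁)) (fun W ↦ W.1.isOpen) (by
      rw [← TopologicalSpace.Opens.coe_iSup, iSup_affineOpens_eq_top]; exact subset_rfl)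
  refine ⟨F.biUnion fun W ↦ (t W).biUnion (e W), fun R hR Y q' q g _ _ hq hg ↦ ?_⟩
  refine isPullback_of_isClosedImmersion _ _ _ _ (Scheme.Hom.toImage_imageι _).symm ?_
  rw [Scheme.Hom.imageι, IdealSheafData.ker_subschemeι, ← IdealSheafData.map_ker]
  refine le_antisymm (IdealSheafData.comap_map_le _ _) ?_
  refine IdealSheafData.le_of_iSup_eq_top
    (fun W : F ↦ ⟨q₁ ⁻¹ᵁ W.1.1, W.1.2.preimage q₁⟩) ?_ fun W ↦ ?_
  · refine top_le_iff.mp fun x _ ↦ ?_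
    obtain ⟨W, hW, hx⟩ := Set.mem_iUnion₂.mp (hF (Set.mem_univ (q₁ x)))
    exact TopologicalSpace.Opens.mem_iSup.mpr ⟨⟨W, hW⟩, hx⟩
  rw [← ht W.1, Ideal.span_le]
  intro x hx
  obtain ⟨y, hy⟩ := he W.1 x R (fun c hc ↦ hR (Finset.mem_biUnion.mpr
    ⟨W.1, W.2, Finset.mem_biUnion.mpr ⟨x, hx, hc⟩⟩)) q' q g hq hg
  have hxk : x ∈ j.ker.ideal ⟨_, W.1.2.preimage q₁⟩ := ht W.1 ▸ Ideal.subset_span hx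
  subst hq
  let V : Y.affineOpens := ⟨_, W.1.2.preimage q⟩
  have hy' : (q'.app V).hom y = x := by
    rw [← hy]
    exact congrArg (fun φ ↦ φ.hom y) (Scheme.Hom.appLE_eq_app q').symm
  have h1 : y ∈ (j.ker.map q').ideal V := by
    rw [IdealSheafData.ideal_map_of_isAffineHom, Ideal.mem_comap, hy']
    exact hxk
  have h2 := IdealSheafData.le_map_comap (J := j.ker.map q') (f := q') V h1
  rw [IdealSheafData.ideal_map_of_isAffineHom, Ideal.mem_comap, hy'] at h2
  exact h2

end ClosedModel

/-! ### Finiteness properties of projective space -/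

section ProjectiveSpaceProper

attribute [local instance] MvPolynomial.gradedAlgebra

variable {n : ℕ}

lemma surjective_algebraMap_homog_zero (A : Type u) [CommRing A] :
    Function.Surjective (algebraMap A (homog n A 0)) := by
  rintro ⟨p, hp⟩
  refine ⟨p.coeff 0, Subtype.ext ?_⟩
  have h : p.totalDegree = 0 := (MvPolynomial.totalDegree_zero_iff_isHomogeneous _).mpr
    ((MvPolynomial.mem_homogeneousSubmodule _ _).mp hp)
  exact (MvPolynomial.totalDegree_eq_zero_iff_eq_C.mp h).symm

instance (A : Type u) [CommRing A] :
    Algebra.FiniteType (homog n A 0) (MvPolynomial (Fin (n + 1)) A) := by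
  have : IsScalarTower A (homog n A 0) (MvPolynomial (Fin (n + 1)) A) :=
    ⟨fun a b c ↦ smul_mul_assoc a (b : MvPolynomial (Fin (n + 1)) A) c⟩
  exact .of_restrictScalars_finiteType A _ _

instance (A : Type u) [CommRing A] : IsSeparated (Pn.toSpec n A) := by
  unfold Pn.toSpec; infer_instance

instance (A : Type u) [CommRing A] : QuasiCompact (Pn.toSpec n A) := by
  unfold Pn.toSpec; infer_instance

instance (A : Type u) [CommRing A] : LocallyOfFiniteType (Pn.toSpec n A) := by
  have : LocallyOfFiniteType (Spec.map (CommRingCat.ofHom (algebraMap A (homog n A 0)))) :=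
    (HasRingHomProperty.Spec_iff (P := @LocallyOfFiniteType)).mpr
      (RingHom.FiniteType.of_surjective _ (surjective_algebraMap_homog_zero A))
  unfold Pn.toSpec; infer_instance

instance (A : Type u) [CommRing A] [IsNoetherianRing A] : IsLocallyNoetherian (Pn n A) :=
  LocallyOfFiniteType.isLocallyNoetherian (Pn.toSpec n A)

instance (A : Type u) [CommRing A] : CompactSpace (Pn n A) :=
  QuasiCompact.compactSpace_of_compactSpace (Pn.toSpec n A)

instance {A B : Type u} [CommRing A] [CommRing B] (φ : A →+* B) : IsAffineHom (Pn.map (n := n) φ) :=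
  MorphismProperty.of_isPullback (Pn.isPullback φ).flip inferInstance

end ProjectiveSpaceProper

/-! ### Models of immersions into projective space -/

section ImmersionModel

attribute [local instance] MvPolynomial.gradedAlgebra

variable {n : ℕ} {K Ω : Type u} [Field K] [Field Ω] [Algebra K Ω]

/-- An open subset of projective space over `Ω` is defined over any ring containing the
coefficients of the equations of its complement. -/
lemma exists_finset_preimage_opens_eq (O : (Pn n Ω).Opens) :
    ∃ e : Finset Ω, ∀ R : Subalgebra K Ω, (e : Set Ω) ⊆ R →
      ∃ O' : (Pn n R).Opens, Pn.map R.subtype ⁻¹ᵁ O' = O := by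
  classical
  obtain ⟨t, ht⟩ := exists_finset_zeroLocus O.isOpen.isClosed_compl
  refine ⟨t.biUnion fun p ↦ p.support.image fun m ↦ p.coeff m, fun R hR ↦ ?_⟩
  let T : Set (MvPolynomial (Fin (n + 1)) R) := MvPolynomial.map R.subtype ⁻¹' t
  refine ⟨⟨(ProjectiveSpectrum.zeroLocus (homog n R) T)ᶜ,
    (ProjectiveSpectrum.isClosed_zeroLocus (homog n R) T).isOpen_compl⟩, ?_⟩
  have hsurj : ∀ p ∈ t, ∃ p' : MvPolynomial (Fin (n + 1)) R, MvPolynomial.map R.subtype p' = p := by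
    intro p hp
    change p ∈ Set.range _
    rw [MvPolynomial.mem_range_map_iff_coeffs_subset]
    intro c hc
    obtain ⟨m, hm, rfl⟩ := MvPolynomial.mem_coeffs_iff.mp hc
    exact ⟨⟨_, hR (Finset.mem_biUnion.mpr ⟨p, hp, Finset.mem_image_of_mem _ hm⟩)⟩, rfl⟩
  refine TopologicalSpace.Opens.ext (compl_injective (ht ▸ ?_))
  ext x
  let w : R →+* Ω := R.subtype
  have key : (∀ q ∈ T,
      q ∈ ((Pn.map (n := n) w x : ProjectiveSpectrum (homog n R))).asHomogeneousIdeal) ↔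
      ∀ p ∈ t, p ∈ (x : ProjectiveSpectrum (homog n Ω)).asHomogeneousIdeal := by
    refine ⟨fun h p hp ↦ ?_, fun h q hq ↦ h _ hq⟩
    obtain ⟨p', rfl⟩ := hsurj p hp
    exact h p' hp
  refine Iff.trans ?_ key
  exact not_not

/-- A quasi-projective scheme over `Ω`, together with its embedding, is defined over every
finitely generated algebra that contains a suitable finite set of coefficients. -/
theorem exists_finset_immersion_model {X : Scheme.{u}} (i : X ⟶ Pn n Ω) [IsImmersion i]
    [QuasiCompact i] :
    ∃ e : Finset Ω, ∀ R : Subalgebra K Ω, R.FG → (e : Set Ω) ⊆ R →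
      ∃ (V : Scheme.{u}) (ι : V ⟶ Pn n R) (π : X ⟶ V), IsImmersion ι ∧ QuasiCompact ι ∧
        IsPullback π i ι (Pn.map R.subtype) := by
  classical
  obtain ⟨e₁, h₁⟩ := exists_finset_isPullback_toImage (Pn.isPullback (n := n) (algebraMap K Ω))
    i.imageι
  obtain ⟨e₂, h₂⟩ := exists_finset_preimage_opens_eq (K := K) i.coborderRange
  refine ⟨e₁ ∪ e₂, fun R hRfg hR ↦ ?_⟩
  have : Algebra.FiniteType K R := R.fg_iff_finiteType.mp hRfg
  have : IsNoetherianRing R := Algebra.FiniteType.isNoetherianRing K R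
  let q' : Pn n Ω ⟶ Pn n R := Pn.map R.subtype
  have sq := h₁ R (fun x hx ↦ hR (Finset.mem_union_left _ hx)) q'
    (Pn.map (algebraMap K R)) (Pn.toSpec n R) (by rw [← Pn.map_comp]; rfl) (Pn.map_toSpec _)
  obtain ⟨O, hO⟩ := h₂ R fun x hx ↦ hR (Finset.mem_union_right _ hx)
  obtain ⟨m, hm⟩ : ∃ m : (i.coborderRange : Scheme.{u}) ⟶ O,
      IsPullback m i.coborderRange.ι O.ι q' := hO ▸ ⟨_, isPullback_morphismRestrict q' O⟩
  have big := (IsImmersion.isPullback_toImage_liftCoborder i).flip.paste_horiz hm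
  set J := (i.imageι ≫ q').imageι
  set p := (i.imageι ≫ q').toImage
  have hpJ : i.imageι ≫ q' = p ≫ J := (Scheme.Hom.toImage_imageι _).symm
  rw [hpJ] at big
  have hVP := IsPullback.of_hasPullback J O.ι
  let π : X ⟶ pullback J O.ι := hVP.lift (i.toImage ≫ p) (i.liftCoborder ≫ m)
    (by rw [Category.assoc]; exact big.w.symm)
  have hπ : IsPullback π i.toImage (pullback.fst J O.ι) p := by
    refine IsPullback.of_right ?_ (hVP.lift_fst _ _ _) hVP.flip
    rw [show π ≫ pullback.snd J O.ι = _ from hVP.lift_snd _ _ _]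
    exact big
  have hfin := hπ.paste_vert sq.flip
  rw [Scheme.Hom.toImage_imageι] at hfin
  exact ⟨pullback J O.ι, pullback.fst J O.ι ≫ J, π, inferInstance, inferInstance, hfin⟩

end ImmersionModel

/-! ### Equivariant embeddings over an algebraically closed field -/

section ConstantEmbedding

variable {n : ℕ} {K Ω : Type u} [Field K] [Field Ω] [Algebra K Ω] [IsAlgClosed Ω] [CharZero Ω]
  {X : Scheme.{u}} {f : X ⟶ Spec (.of Ω)}

/-- If an embedding is equivariant for the automorphisms that fix a finite set, then some embedding
is equivariant for all automorphisms over `K`, provided that `K` is algebraically closed: it is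
obtained by specializing the coefficients of the given one to `K`. -/
theorem exists_equivariant_immersion [IsAlgClosed K] (htr : Cardinal.aleph0 ≤ Algebra.trdeg K Ω)
    (A : SemilinearAction K f) (i : X ⟶ Pn n Ω) [IsImmersion i] [QuasiCompact i]
    (hi : i ≫ Pn.toSpec n Ω = f) (s : Finset Ω) (hs : A.EquivariantUnder s i) :
    ∃ i' : X ⟶ Pn n Ω, IsImmersion i' ∧ i' ≫ Pn.toSpec n Ω = f ∧ ∀ τ : Ω ≃ₐ[K] Ω,
      A.act τ ≫ i' = i' ≫ Pn.map ((τ : Ω ≃+* Ω) : Ω →+* Ω) := by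
  classical
  obtain ⟨e, he⟩ := exists_finset_immersion_model (K := K) i
  let R : Subalgebra K Ω := Algebra.adjoin K (e ∪ s : Finset Ω)
  have hR : R.FG := ⟨_, rfl⟩
  have hsub : ((e ∪ s : Finset Ω) : Set Ω) ⊆ R := Algebra.subset_adjoin
  obtain ⟨V, ι, π, hι, hιqc, hπ⟩ := he R hR fun x hx ↦ hsub (Finset.mem_union_left _ hx)
  have : Algebra.FiniteType K R := R.fg_iff_finiteType.mp hR
  have : IsNoetherianRing R := Algebra.FiniteType.isNoetherianRing K R
  let g : V ⟶ Spec (.of R) := ι ≫ Pn.toSpec n R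
  have hg : IsPullback π f g (Spec.map (CommRingCat.ofHom R.subtype)) :=
    hi ▸ hπ.paste_vert (Pn.isPullback _)
  have : LocallyOfFiniteType g := inferInstance
  have : LocallyOfFinitePresentation g :=
    LocallyOfFinitePresentation.iff_locallyOfFiniteType.mpr this
  have hinv : A.InvariantUnder R π := by
    intro ρ hρ
    rw [← cancel_mono ι, Category.assoc, hπ.w, ← Category.assoc,
      hs ρ fun x hx ↦ hρ x (hsub (Finset.mem_union_right _ hx)), Category.assoc, ← Pn.map_comp]
    congr 2
    ext r
    exact hρ r r.2
  obtain ⟨φ, π', hπ', hact⟩ := exists_invariant_specialization A htr hR g hg hinv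
  let ψ : R →+* Ω := (algebraMap K Ω).comp (φ : R →+* K)
  have hP := Pn.isPullback (n := n) ψ
  let i' : X ⟶ Pn n Ω := hP.lift (π' ≫ ι) f (by rw [Category.assoc]; exact hπ'.w)
  have h1 : i' ≫ Pn.map ψ = π' ≫ ι := hP.lift_fst _ _ _
  have h2 : i' ≫ Pn.toSpec n Ω = f := hP.lift_snd _ _ _
  have hi' : IsPullback π' i' ι (Pn.map ψ) :=
    IsPullback.of_bot (by rw [h2]; exact hπ') h1.symm hP
  refine ⟨i', MorphismProperty.of_isPullback hi' hι, h2, fun τ ↦ ?_⟩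
  refine hP.hom_ext ?_ ?_
  · rw [Category.assoc, h1, ← Category.assoc, hact, Category.assoc, ← Pn.map_comp]
    refine h1.symm.trans ?_
    congr 2
    ext r
    exact (τ.commutes _).symm
  · rw [Category.assoc, h2, A.act_comp, Category.assoc, Pn.map_toSpec, ← Category.assoc, h2]

end ConstantEmbedding

/-! ### Equivariant embeddings over a finite extension -/

section Restrict

variable {k Ω : Type u} [Field k] [Field Ω] [Algebra k Ω]
  {X : Scheme.{u}} {f : X ⟶ Spec (.of Ω)}

/-- Restriction of a semilinear action to the automorphisms over an intermediate field. -/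
def SemilinearAction.restrict (A : SemilinearAction k f) (E : IntermediateField k Ω) :
    SemilinearAction E f where
  act σ := A.act (σ.restrictScalars k)
  act_one := A.act_one
  act_mul σ τ := A.act_mul (σ.restrictScalars k) (τ.restrictScalars k)
  act_comp _ := A.act_comp _

variable {n : ℕ}

/-- The automorphisms for which a morphism to projective space is equivariant. -/
def SemilinearAction.equivariantSubgroup (A : SemilinearAction k f) (i : X ⟶ Pn n Ω) :
    Subgroup (Ω ≃ₐ[k] Ω) where
  carrier := {σ | A.act σ ≫ i = i ≫ Pn.map ((σ : Ω ≃+* Ω) : Ω →+* Ω)}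
  one_mem' := by
    change A.act 1 ≫ i = i ≫ Pn.map (RingHom.id Ω)
    rw [A.act_one, Pn.map_id, Category.id_comp, Category.comp_id]
  mul_mem' {σ τ} hσ hτ := by
    change A.act (σ * τ) ≫ i = i ≫ Pn.map (((σ : Ω ≃+* Ω) : Ω →+* Ω).comp ((τ : Ω ≃+* Ω) : Ω →+* Ω))
    rw [A.act_mul, Category.assoc, hτ, ← Category.assoc, hσ, Category.assoc, Pn.map_comp]
  inv_mem' {σ} hσ := by
    change A.act σ⁻¹ ≫ i = i ≫ Pn.map (((σ⁻¹ : Ω ≃ₐ[k] Ω) : Ω ≃+* Ω) : Ω →+* Ω)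
    have h : Pn.map (n := n) ((σ : Ω ≃+* Ω) : Ω →+* Ω) ≫
        Pn.map (((σ⁻¹ : Ω ≃ₐ[k] Ω) : Ω ≃+* Ω) : Ω →+* Ω) = 𝟙 _ := by
      rw [← Pn.map_comp, ← Pn.map_id]
      congr 1
      ext x
      exact σ.apply_symm_apply x
    rw [← cancel_epi (A.act σ), A.act_comp_inv_assoc, reassoc_of% (show _ = _ from hσ), h,
      Category.comp_id]

/-- A rigidified quasi-projective scheme with semilinear action has an embedding that is
equivariant for the automorphisms over some finite normal extension of `k`. -/
theorem exists_immersion_equivariant_finite [IsAlgClosed Ω] [CharZero Ω]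
    (htr : Cardinal.aleph0 ≤ Algebra.trdeg k Ω) (A : SemilinearAction k f)
    [IsReduced X] [CompactSpace X] (i : X ⟶ Pn n Ω) [IsImmersion i]
    (hi : i ≫ Pn.toSpec n Ω = f) {S : Set (Spec (.of Ω) ⟶ X)} (hS : S.Finite)
    (hSf : ∀ P ∈ S, P ≫ f = 𝟙 _)
    (hrigid : ∀ α : X ≅ X, α.hom ≫ f = f → (∀ P ∈ S, P ≫ α.hom = P) → α.hom = 𝟙 X)
    (s₀ : Finset Ω) (hfix : ∀ σ : Ω ≃ₐ[k] Ω, (∀ x ∈ s₀, σ x = x) → ∀ P ∈ S,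
      P ≫ A.act σ = Spec.map (CommRingCat.ofHom ((σ : Ω ≃+* Ω) : Ω →+* Ω)) ≫ P) :
    ∃ (k₁ : IntermediateField k Ω) (i' : X ⟶ Pn n Ω), FiniteDimensional k k₁ ∧ Normal k k₁ ∧
      IsImmersion i' ∧ i' ≫ Pn.toSpec n Ω = f ∧ A.EquivariantUnder k₁ i' := by
  classical
  obtain ⟨s, hs⟩ := exists_equivariantUnder A i hi hS hSf hrigid s₀ hfix
  let κ := algebraicClosure k Ω
  have : IsAlgClosed κ := IsAlgClosure.isAlgClosed k
  have hκ : Cardinal.aleph0 ≤ Algebra.trdeg κ Ω := by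
    have h := trdeg_add_eq k κ (A := Ω)
    rw [trdeg_eq_zero, zero_add] at h
    rwa [h]
  have hqc : QuasiCompact i := inferInstance
  obtain ⟨i', hi', hi'f, heq⟩ := exists_equivariant_immersion hκ (A.restrict κ) i hi s
    fun σ hσ ↦ by
      have := hs (σ.restrictScalars k) hσ
      exact this
  obtain ⟨s', hs'⟩ := exists_equivariantUnder A i' hi'f hS hSf hrigid s₀ hfix
  obtain ⟨k₁, h1, h2, h3⟩ := exists_finite_normal_fixingSubgroup_le htr (A.equivariantSubgroup i')
    (fun σ hσ ↦ by
      have := heq (IntermediateField.fixingSubgroupEquiv κ ⟨σ, hσ⟩)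
      change A.act σ ≫ i' = i' ≫ Pn.map ((σ : Ω ≃+* Ω) : Ω →+* Ω)
      exact this)
    (IntermediateField.adjoin k s') ⟨s', rfl⟩
    (fun σ hσ ↦ hs' σ fun x hx ↦ (IntermediateField.mem_fixingSubgroup_iff _ _).mp hσ x
      (IntermediateField.subset_adjoin k _ hx))
  exact ⟨k₁, i', h1, h2, hi', hi'f,
    fun σ hσ ↦ h3 ((IntermediateField.mem_fixingSubgroup_iff _ _).mpr hσ)⟩

end Restrict

/-! ### Affine neighbourhoods in stable open subsets of projective space -/

section StableAffine

attribute [local instance] MvPolynomial.gradedAlgebra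

open MvPolynomial

variable {n : ℕ} {F Ω : Type u} [Field F] [Field Ω] [Algebra F Ω]

/-- Galois descent for ideals of polynomials: an ideal that is stable under the automorphisms of
`Ω` over `F` is generated by polynomials with coefficients in `F`. An element of minimal support
in the ideal is, up to a scalar, invariant. -/
lemma le_of_stable_ideal [Algebra.IsInvariant F Ω (Ω ≃ₐ[F] Ω)] {τ : Type*}
    (I J : Ideal (MvPolynomial τ Ω))
    (hI : ∀ σ : Ω ≃ₐ[F] Ω, ∀ p ∈ I, map ((σ : Ω ≃+* Ω) : Ω →+* Ω) p ∈ I)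
    (hJ : ∀ q : MvPolynomial τ F, map (algebraMap F Ω) q ∈ I → map (algebraMap F Ω) q ∈ J) :
    I ≤ J := by
  classical
  intro p hp
  induction hN : p.support.card using Nat.strong_induction_on generalizing p with
  | _ N ih =>
  by_cases hp0 : p = 0
  · exact hp0 ▸ J.zero_mem
  obtain ⟨q, ⟨hqI, hq0, hqp⟩, hmin⟩ := exists_minimalFor_of_wellFoundedLT
    (fun q : MvPolynomial τ Ω ↦ q ∈ I ∧ q ≠ 0 ∧ q.support ⊆ p.support)
    (fun q ↦ q.support.card) ⟨p, hp, hp0, subset_rfl⟩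
  obtain ⟨m, hm⟩ := (support_nonempty (p := q)).mpr hq0
  have hqm : q.coeff m ≠ 0 := mem_support_iff.mp hm
  let r : MvPolynomial τ Ω := C (q.coeff m)⁻¹ * q
  have hrI : r ∈ I := I.mul_mem_left _ hqI
  have hrs : r.support ⊆ q.support := fun l hl ↦ by
    rw [mem_support_iff, coeff_C_mul] at hl
    exact mem_support_iff.mpr (right_ne_zero_of_mul hl)
  have hrm : r.coeff m = 1 := by rw [coeff_C_mul, inv_mul_cancel₀ hqm]
  have hinv : ∀ σ : Ω ≃ₐ[F] Ω, map ((σ : Ω ≃+* Ω) : Ω →+* Ω) r = r := by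
    intro σ
    by_contra hne
    let s := map ((σ : Ω ≃+* Ω) : Ω →+* Ω) r - r
    have hs : s.support ⊂ q.support := by
      refine (Finset.ssubset_iff_of_subset fun l hl ↦ ?_).mpr ⟨m, hm, ?_⟩
      · by_contra hlq
        have h0 : r.coeff l = 0 := notMem_support_iff.mp fun h ↦ hlq (hrs h)
        refine mem_support_iff.mp hl ?_
        rw [coeff_sub, coeff_map, h0, map_zero, sub_zero]
      · rw [notMem_support_iff, coeff_sub, coeff_map, hrm, map_one, sub_self]
    have := hmin (j := s) ⟨I.sub_mem (hI σ _ hrI) hrI, sub_ne_zero.mpr hne,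
      hs.subset.trans hqp⟩ (Finset.card_le_card hs.subset)
    exact absurd (Finset.card_lt_card hs) (not_lt.mpr this)
  have hr : r ∈ J := by
    have hmem : r ∈ Set.range (map (algebraMap F Ω)) := by
      rw [mem_range_map_iff_coeffs_subset]
      intro c hc
      obtain ⟨l, -, rfl⟩ := mem_coeffs_iff.mp hc
      refine Algebra.IsInvariant.isInvariant (G := Ω ≃ₐ[F] Ω) _ fun σ ↦ ?_
      conv_rhs => rw [← hinv σ, coeff_map]
      rfl
    obtain ⟨r₀, hr₀⟩ := hmem
    exact hr₀ ▸ hJ r₀ (hr₀ ▸ hrI)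
  have hlt : (p - C (p.coeff m) * r).support ⊂ p.support := by
    refine (Finset.ssubset_iff_of_subset fun l hl ↦ ?_).mpr ⟨m, hqp hm, ?_⟩
    · by_contra hlp
      have h0 : r.coeff l = 0 := notMem_support_iff.mp fun h ↦ hlp (hqp (hrs h))
      refine mem_support_iff.mp hl ?_
      rw [coeff_sub, coeff_C_mul, h0, mul_zero, sub_zero, notMem_support_iff.mp hlp]
    · rw [notMem_support_iff, coeff_sub, coeff_C_mul, hrm, mul_one, sub_self]
  have := ih _ (hN ▸ Finset.card_lt_card hlt) (p := p - C (p.coeff m) * r)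
    (I.sub_mem hp (I.mul_mem_left _ hrI)) rfl
  have h2 := J.add_mem this (J.mul_mem_left (C (p.coeff m)) hr)
  rwa [sub_add_cancel] at h2

/-- Homogeneous prime avoidance over an infinite field. -/
lemma exists_homog_mem_forall_notMem [Infinite F] (I : Ideal (MvPolynomial (Fin (n + 1)) F))
    {T : Set (Pn n F)} (hT : T.Finite)
    (h : ∀ y ∈ T, ∃ d > 0, ∃ p ∈ I, p ∈ homog n F d ∧
      p ∉ (y : ProjectiveSpectrum (homog n F)).asHomogeneousIdeal) :
    ∃ d > 0, ∃ p ∈ I, p ∈ homog n F d ∧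
      ∀ y ∈ T, p ∉ (y : ProjectiveSpectrum (homog n F)).asHomogeneousIdeal := by
  classical
  choose! d hd p hpI hpd hpy using h
  let N := ∏ y ∈ hT.toFinset, d y
  have hN : 0 < N := Finset.prod_pos fun y hy ↦ hd y (hT.mem_toFinset.mp hy)
  let W : Submodule F (MvPolynomial (Fin (n + 1)) F) := homog n F N ⊓ I.restrictScalars F
  let f : Pn n F → Submodule F W := fun y ↦
    ((y : ProjectiveSpectrum (homog n F)).asHomogeneousIdeal.toIdeal.restrictScalars F).comap
      W.subtype
  have htop : (⊤ : Submodule F W) ∉ hT.toFinset.image f := by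
    intro hmem
    obtain ⟨y, hy, hyt⟩ := Finset.mem_image.mp hmem
    have hyT := hT.mem_toFinset.mp hy
    obtain ⟨e, he⟩ : d y ∣ N := Finset.dvd_prod_of_mem d hy
    have he0 : e ≠ 0 := by rintro rfl; omega
    have hw : p y ^ e ∈ W := by
      refine ⟨?_, I.pow_mem_of_mem (hpI y hyT) e (Nat.pos_of_ne_zero he0)⟩
      have := SetLike.pow_mem_graded e (hpd y hyT)
      rwa [smul_eq_mul, mul_comm, ← he] at this
    have h2 : (⟨_, hw⟩ : W) ∈ f y := hyt ▸ Submodule.mem_top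
    exact hpy y hyT ((y : ProjectiveSpectrum (homog n F)).isPrime.mem_of_pow_mem e h2)
  have hne := Subspace.biUnion_ne_univ_of_top_notMem htop
  obtain ⟨⟨h, hhW⟩, hh⟩ := (Set.ne_univ_iff_exists_notMem _).mp hne
  refine ⟨N, hN, h, hhW.2, hhW.1, fun y hy hmem ↦ hh ?_⟩
  exact Set.mem_biUnion (Finset.mem_image_of_mem f (hT.mem_toFinset.mpr hy)) hmem

/-- Finitely many points of projective space over `F` that lift to a Galois stable open subset of
projective space over `Ω` lie in a basic open subset whose preimage is contained in the given
one. -/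
lemma exists_isAffineOpen_preimage_le [Infinite F] [Algebra.IsInvariant F Ω (Ω ≃ₐ[F] Ω)]
    (O : (Pn n Ω).Opens) (hO : ∀ σ : Ω ≃ₐ[F] Ω, ∀ z, Pn.map ((σ : Ω ≃+* Ω) : Ω →+* Ω) z ∈ O → z ∈ O)
    {T : Set (Pn n F)} (hT : T.Finite) (hTO : ∀ y ∈ T, ∃ z ∈ O, Pn.map (algebraMap F Ω) z = y) :
    ∃ W : (Pn n F).Opens, IsAffineOpen W ∧ T ⊆ W ∧ Pn.map (algebraMap F Ω) ⁻¹ᵁ W ≤ O := by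
  classical
  let Z : Set (ProjectiveSpectrum (homog n Ω)) := (O : Set (Pn n Ω))ᶜ
  let I : Ideal (MvPolynomial (Fin (n + 1)) Ω) := (ProjectiveSpectrum.vanishingIdeal Z).toIdeal
  have hIstab : ∀ σ : Ω ≃ₐ[F] Ω, ∀ p ∈ I, map ((σ : Ω ≃+* Ω) : Ω →+* Ω) p ∈ I := by
    intro σ p hp
    refine (ProjectiveSpectrum.mem_vanishingIdeal _ _).mpr fun z hz ↦ ?_
    exact (ProjectiveSpectrum.mem_vanishingIdeal _ _).mp hp
      (Pn.map (n := n) ((σ : Ω ≃+* Ω) : Ω →+* Ω) z) fun h ↦ hz (hO σ z h)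
  let I₀ : Ideal (MvPolynomial (Fin (n + 1)) F) := I.comap (map (algebraMap F Ω))
  obtain ⟨d, hd, h, hhI, hhd, hhT⟩ := exists_homog_mem_forall_notMem I₀ hT (by
    intro y hy
    obtain ⟨z, hzO, rfl⟩ := hTO y hy
    let z' : ProjectiveSpectrum (homog n Ω) := z
    have hIz : ¬ I ≤ z'.asHomogeneousIdeal.toIdeal := by
      intro hle
      have : z' ∈ closure Z := by
        rw [← ProjectiveSpectrum.zeroLocus_vanishingIdeal_eq_closure]
        exact hle
      have hZ : IsClosed Z := O.isOpen.isClosed_compl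
      rw [hZ.closure_eq] at this
      exact this hzO
    obtain ⟨q, hqI, hqz⟩ : ∃ q : MvPolynomial (Fin (n + 1)) F, map (algebraMap F Ω) q ∈ I ∧
        map (algebraMap F Ω) q ∉ z'.asHomogeneousIdeal.toIdeal := by
      by_contra! hcon
      exact hIz (le_of_stable_ideal I _ hIstab hcon)
    -- some homogeneous component of `q` does not vanish at the point
    obtain ⟨e, he⟩ : ∃ e, homogeneousComponent e (map (algebraMap F Ω) q) ∉
        z'.asHomogeneousIdeal.toIdeal := by
      by_contra! hcon
      refine hqz ?_
      rw [← sum_homogeneousComponent (map (algebraMap F Ω) q)]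
      exact Ideal.sum_mem _ fun e _ ↦ hcon e
    have hmapc : map (algebraMap F Ω) (homogeneousComponent e q) =
        homogeneousComponent e (map (algebraMap F Ω) q) := by
      ext m
      simp only [coeff_map, coeff_homogeneousComponent]
      split_ifs <;> simp
    have heI : homogeneousComponent e (map (algebraMap F Ω) q) ∈ I := by
      have := (ProjectiveSpectrum.vanishingIdeal Z).isHomogeneous e hqI
      have h2 : (DirectSum.decompose (homog n Ω) (map (algebraMap F Ω) q) e : MvPolynomial _ Ω) =
        homogeneousComponent e (map (algebraMap F Ω) q) := decomposition.decompose'_apply _ _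
      rwa [h2] at this
    obtain ⟨i, hi⟩ : ∃ i : Fin (n + 1), (X i : MvPolynomial (Fin (n + 1)) Ω) ∉
        z'.asHomogeneousIdeal.toIdeal := by
      by_contra! hcon
      refine z'.not_irrelevant_le ?_
      refine (irrelevant_le_span_X Ω).trans (Ideal.span_le.mpr ?_)
      rintro _ ⟨i, rfl⟩
      exact hcon i
    refine ⟨e + 1, Nat.succ_pos e, homogeneousComponent e q * X i, ?_, ?_, ?_⟩
    · change map (algebraMap F Ω) _ ∈ I
      rw [map_mul, hmapc]
      exact I.mul_mem_right _ heI
    · exact SetLike.mul_mem_graded (homogeneousComponent_mem e q) (X_mem_homog F i)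
    · intro hmem
      have hmem' : map (algebraMap F Ω) (homogeneousComponent e q * X i) ∈
          z'.asHomogeneousIdeal.toIdeal := hmem
      rw [map_mul, hmapc, map_X] at hmem'
      exact (z'.isPrime.mem_or_mem hmem').elim he hi)
  refine ⟨Proj.basicOpen (homog n F) h, Proj.isAffineOpen_basicOpen _ h hhd hd, hhT, ?_⟩
  intro z hz
  by_contra hzO
  exact hz ((ProjectiveSpectrum.mem_vanishingIdeal _ _).mp hhI z hzO)

/-- The largest open subset in which an equivariant immersion is closed is stable. -/
lemma mem_coborderRange_of_equivariant {X : Scheme.{u}} (i : X ⟶ Pn n Ω) [IsImmersion i]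
    (σ : Ω ≃+* Ω) (a : X ⟶ X) [IsIso a] (h : a ≫ i = i ≫ Pn.map (σ : Ω →+* Ω)) (z : Pn n Ω)
    (hz : Pn.map (σ : Ω →+* Ω) z ∈ i.coborderRange) : z ∈ i.coborderRange := by
  have : IsIso (Pn.map (n := n) (σ : Ω →+* Ω)) := by
    refine ⟨Pn.map (σ.symm : Ω →+* Ω), ?_, ?_⟩ <;>
    · rw [← Pn.map_comp, ← Pn.map_id]
      congr 1
      ext x
      simp
  have hrange : Pn.map (n := n) (σ : Ω →+* Ω) ⁻¹' Set.range i = Set.range i := by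
    ext w
    constructor
    · rintro ⟨x, hx⟩
      obtain ⟨x', rfl⟩ := a.surjective x
      refine ⟨x', (Pn.map (n := n) (σ : Ω →+* Ω)).homeomorph.injective ?_⟩
      change Pn.map (n := n) (σ : Ω →+* Ω) (i x') = Pn.map (n := n) (σ : Ω →+* Ω) w
      rw [← hx, ← Scheme.Hom.comp_apply, ← Scheme.Hom.comp_apply, h]
    · rintro ⟨x, rfl⟩
      refine ⟨a x, ?_⟩
      rw [← Scheme.Hom.comp_apply, ← Scheme.Hom.comp_apply, h]
  have h2 : Pn.map (n := n) (σ : Ω →+* Ω) ⁻¹' coborder (Set.range i) = coborder (Set.range i) := by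
    conv_rhs => rw [← hrange]
    refine Set.Subset.antisymm ?_ ?_
    · exact (Pn.map (n := n) (σ : Ω →+* Ω)).continuous.preimage_coborder_subset _
    · exact (Pn.map (n := n) (σ : Ω →+* Ω)).homeomorph.isOpenMap.coborder_preimage_subset _
  exact h2.subset hz

end StableAffine

/-! ### Galois descent along a finite extension -/

section FiniteIndex

variable {k Ω : Type u} [Field k] [Field Ω] [Algebra k Ω]

lemma normal_fixingSubgroup (k₁ : IntermediateField k Ω) [Normal k k₁] :
    k₁.fixingSubgroup.Normal := by
  refine ⟨fun σ hσ ρ ↦ (IntermediateField.mem_fixingSubgroup_iff _ _).mpr fun x hx ↦ ?_⟩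
  have h : ρ⁻¹ x ∈ k₁ := by
    have := AlgHom.fieldRange_of_normal (E := k₁) (((ρ⁻¹ : Ω ≃ₐ[k] Ω) : Ω →ₐ[k] Ω).comp k₁.val)
    exact this.le ⟨⟨x, hx⟩, rfl⟩
  change ρ (σ (ρ⁻¹ x)) = x
  rw [(IntermediateField.mem_fixingSubgroup_iff _ _).mp hσ _ h]
  exact ρ.apply_symm_apply x

lemma finite_quotient_fixingSubgroup (k₁ : IntermediateField k Ω) [FiniteDimensional k k₁] :
    Finite ((Ω ≃ₐ[k] Ω) ⧸ k₁.fixingSubgroup) := by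
  refine Finite.of_injective (β := k₁ →ₐ[k] Ω)
    (fun g ↦ ((g.out : Ω ≃ₐ[k] Ω) : Ω →ₐ[k] Ω).comp k₁.val) fun g g' h ↦ ?_
  rw [← g.out_eq', ← g'.out_eq']
  refine QuotientGroup.eq.mpr ((IntermediateField.mem_fixingSubgroup_iff _ _).mpr fun x hx ↦ ?_)
  have : g.out x = g'.out x := DFunLike.congr_fun h ⟨x, hx⟩
  change g.out.symm (g'.out x) = x
  rw [← this, AlgEquiv.symm_apply_apply]

/-- Galois descent for the finite extension `k₁` of `k`: in a ring with semilinear action, an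
element that is invariant over `k₁` is a linear combination of invariants over `k`. By the
independence of the embeddings of `k₁`, it is a combination of traces of its multiples by
elements of `k₁`. -/
lemma mem_range_sup_of_invariant (k₁ : IntermediateField k Ω) [FiniteDimensional k k₁]
    {B : Type u} [CommRing B] (s : Ω →+* B) (α : (Ω ≃ₐ[k] Ω) → (B →+* B))
    (hαmul : ∀ σ τ b, α (σ * τ) b = α σ (α τ b)) (hαone : ∀ b, α 1 b = b)
    (hαs : ∀ σ c, α σ (s c) = s (σ c)) (I : Subring B) (hI : ∀ b, (∀ σ, α σ b = b) → b ∈ I)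
    (b : B) (hb : ∀ σ ∈ k₁.fixingSubgroup, α σ b = b) : b ∈ s.range ⊔ I := by
  classical
  let H := k₁.fixingSubgroup
  let Q := (Ω ≃ₐ[k] Ω) ⧸ H
  have : Finite Q := finite_quotient_fixingSubgroup k₁
  let _ : Fintype Q := Fintype.ofFinite Q
  have hout (σ : Ω ≃ₐ[k] Ω) : ∃ τ ∈ H, σ = (QuotientGroup.mk σ : Q).out * τ :=
    ⟨(QuotientGroup.mk σ : Q).out⁻¹ * σ, QuotientGroup.eq.mp (QuotientGroup.out_eq' _), by simp⟩
  have hαout (σ : Ω ≃ₐ[k] Ω) : α (QuotientGroup.mk σ : Q).out b = α σ b := by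
    obtain ⟨τ, hτ, h⟩ := hout σ
    conv_rhs => rw [h, hαmul, hb τ hτ]
  have hcout (σ : Ω ≃ₐ[k] Ω) (c : k₁) : (QuotientGroup.mk σ : Q).out (c : Ω) = σ c := by
    obtain ⟨τ, hτ, h⟩ := hout σ
    conv_rhs => rw [h]
    change _ = (QuotientGroup.mk σ : Q).out (τ c)
    rw [(IntermediateField.mem_fixingSubgroup_iff _ _).mp hτ _ c.2]
  let χ : Q → (k₁ →* Ω) := fun g ↦ (((g.out : Ω ≃ₐ[k] Ω) : Ω →ₐ[k] Ω).comp k₁.val : k₁ →* Ω)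
  have hχ : Function.Injective χ := fun g g' h ↦ by
    rw [← g.out_eq', ← g'.out_eq']
    refine QuotientGroup.eq.mpr ((IntermediateField.mem_fixingSubgroup_iff _ _).mpr fun x hx ↦ ?_)
    have : g.out x = g'.out x := DFunLike.congr_fun h ⟨x, hx⟩
    change g.out.symm (g'.out x) = x
    rw [← this, AlgEquiv.symm_apply_apply]
  have hli : LinearIndependent Ω fun g : Q ↦ (χ g : k₁ → Ω) :=
    (linearIndependent_monoidHom k₁ Ω).comp χ hχ
  let v : k₁ → (Q → Ω) := fun c g ↦ χ g c
  have hspan : Submodule.span Ω (Set.range v) = ⊤ := by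
    by_contra hne
    obtain ⟨a, ha0, ha⟩ := Submodule.exists_le_ker_of_lt_top _ (lt_top_iff_ne_top.mpr hne)
    refine ha0 (LinearMap.pi_ext' fun g ↦ LinearMap.ext_ring ?_)
    have hsum : ∑ g, a (Pi.single g 1) • (χ g : k₁ → Ω) = 0 := by
      funext c
      have h1 : a (v c) = 0 := ha (Submodule.subset_span ⟨c, rfl⟩)
      rw [← Finset.univ_sum_single (v c), map_sum] at h1
      rw [Finset.sum_apply, Pi.zero_apply, ← h1]
      refine Finset.sum_congr rfl fun g _ ↦ ?_
      have : (Pi.single g (v c g) : Q → Ω) = v c g • Pi.single g 1 := by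
        rw [← Pi.single_smul, smul_eq_mul, mul_one]
      rw [this, map_smul, smul_eq_mul, Pi.smul_apply, smul_eq_mul, mul_comm]
    exact Fintype.linearIndependent_iff.mp hli _ hsum g
  have key : ∀ w ∈ Submodule.span Ω (Set.range v), ∑ g, s (w g) * α g.out b ∈ s.range ⊔ I := by
    intro w hw
    induction hw using Submodule.span_induction with
    | mem w hw =>
      obtain ⟨c, rfl⟩ := hw
      refine (le_sup_right : I ≤ _) (hI _ fun σ ↦ ?_)
      rw [map_sum]
      refine Fintype.sum_equiv (MulAction.toPerm σ) _ _ fun g ↦ ?_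
      have hg : MulAction.toPerm σ g = (QuotientGroup.mk (σ * g.out) : Q) := by
        conv_lhs => rw [← g.out_eq']
        rfl
      rw [map_mul, hαs, hg, hαout, ← hαmul]
      congr 2
      exact (hcout (σ * g.out) c).symm
    | zero => simp
    | add w w' _ _ h h' =>
      simp only [Pi.add_apply, map_add, add_mul, Finset.sum_add_distrib]
      exact Subring.add_mem _ h h'
    | smul c w _ h =>
      have : ∑ g, s ((c • w) g) * α g.out b = s c * ∑ g, s (w g) * α g.out b := by
        rw [Finset.mul_sum]
        exact Finset.sum_congr rfl fun g _ ↦ by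
          rw [Pi.smul_apply, smul_eq_mul, map_mul, mul_assoc]
      rw [this]
      exact Subring.mul_mem _ ((le_sup_left : s.range ≤ _) ⟨c, rfl⟩) h
  -- the coordinate vector at the trivial coset gives `b`, which is `α 1 b`
  have h1 := key (Pi.single (QuotientGroup.mk 1) 1) (hspan ▸ Submodule.mem_top)
  rw [Finset.sum_eq_single (QuotientGroup.mk 1 : Q) (fun g _ hg ↦ by
    rw [Pi.single_eq_of_ne hg, map_zero, zero_mul]) (fun h ↦ absurd (Finset.mem_univ _) h),
    Pi.single_eq_same, map_one, one_mul, hαout, hαone] at h1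
  exact h1

end FiniteIndex

/-! ### Good open subsets -/

section Good

open Scheme

variable {k Ω : Type u} [Field k] [Field Ω] [Algebra k Ω]
  {X : Scheme.{u}} {f : X ⟶ Spec (.of Ω)}

/-- The scalars in the ring of sections over an open subset of an `Ω`-scheme. -/
noncomputable def scalar (f : X ⟶ Spec (.of Ω)) (U : X.Opens) : Ω →+* Γ(X, U) :=
  (f.appLE ⊤ U le_top).hom.comp (ΓSpecIso (.of Ω)).inv.hom

/-- A morphism covering an endomorphism `τ` of the scalars acts on them by `τ`. -/
lemma appLE_scalar {a : X ⟶ X} {U V : X.Opens} (h : V ≤ a ⁻¹ᵁ U) (τ : Ω →+* Ω)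
    (haf : a ≫ f = f ≫ Spec.map (CommRingCat.ofHom τ)) (c : Ω) :
    (a.appLE U V h).hom (scalar f U c) = scalar f V (τ c) := by
  symm
  have h1 := Scheme.Hom.appLE_comp_appLE a f ⊤ U V le_top h
  have h2 := Scheme.Hom.appLE_comp_appLE f (Spec.map (CommRingCat.ofHom τ)) ⊤ ⊤ V le_top le_top
  have h3 : (a ≫ f).appLE ⊤ V le_top = (f ≫ Spec.map (CommRingCat.ofHom τ)).appLE ⊤ V le_top := by
    congr 1
  have h4 := congrArg (fun φ ↦ φ.hom c) (Scheme.ΓSpecIso_inv_naturality (CommRingCat.ofHom τ))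
  have h5 : (Spec.map (CommRingCat.ofHom τ)).appLE ⊤ ⊤ le_top =
    (Spec.map (CommRingCat.ofHom τ)).appTop := Scheme.Hom.appLE_eq_app _
  rw [h5] at h2
  refine Eq.trans (congrArg (f.appLE ⊤ V le_top).hom h4) ?_
  exact congrArg (fun φ ↦ φ.hom ((ΓSpecIso (.of Ω)).inv.hom c)) (h2.trans (h3.symm.trans h1.symm))

variable (A : SemilinearAction k f) (H : Subgroup (Ω ≃ₐ[k] Ω))

/-- The sections over `U` that are invariant under the automorphisms in `H`. -/
def SemilinearAction.invariants (U : X.Opens) : Subring Γ(X, U) where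
  carrier := {y | ∀ σ ∈ H, ∀ h : U ≤ A.act σ ⁻¹ᵁ U, ((A.act σ).appLE U U h).hom y = y}
  mul_mem' ha hb σ hσ h := by rw [map_mul, ha σ hσ h, hb σ hσ h]
  one_mem' σ hσ h := map_one _
  add_mem' ha hb σ hσ h := by rw [map_add, ha σ hσ h, hb σ hσ h]
  zero_mem' σ hσ h := map_zero _
  neg_mem' ha σ hσ h := by rw [map_neg, ha σ hσ h]

/-- An open subset to which descent applies: it is affine and stable under `H`, and its
sections are generated by scalars and invariants. -/
structure SemilinearAction.IsGood (U : X.Opens) : Prop where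
  isAffineOpen : IsAffineOpen U
  preimage_act : ∀ σ ∈ H, A.act σ ⁻¹ᵁ U = U
  range_sup : (scalar f U).range ⊔ A.invariants H U = ⊤

lemma appLE_surjective {X Y : Scheme.{u}} (j : X ⟶ Y) [IsClosedImmersion j] {V : Y.Opens}
    (hV : IsAffineOpen V) {U : X.Opens} (h : j ⁻¹ᵁ V = U) :
    Function.Surjective (j.appLE V U h.ge).hom := by
  subst h
  rw [Scheme.Hom.appLE_eq_app]
  exact j.app_surjective V hV

variable {A H}

/-- A morphism that covers an automorphism of the scalars and normalizes the action of `H` maps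
combinations of scalars and invariants to such combinations. -/
lemma range_sup_le_comap {a : X ⟶ X} {U V : X.Opens} (h : V ≤ a ⁻¹ᵁ U) (τ : Ω →+* Ω)
    (haf : a ≫ f = f ≫ Spec.map (CommRingCat.ofHom τ))
    (ha : ∀ σ ∈ H, ∃ σ' ∈ H, A.act σ ≫ a = a ≫ A.act σ')
    (hU : ∀ σ ∈ H, A.act σ ⁻¹ᵁ U = U) :
    (scalar f U).range ⊔ A.invariants H U ≤
      ((scalar f V).range ⊔ A.invariants H V).comap (a.appLE U V h).hom := by
  refine sup_le ?_ ?_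
  · rintro _ ⟨c, rfl⟩
    exact (le_sup_left : (scalar f V).range ≤ _) ⟨τ c, (appLE_scalar h τ haf c).symm⟩
  · intro y hy
    refine (le_sup_right : A.invariants H V ≤ _) fun σ hσ hV ↦ ?_
    obtain ⟨σ', hσ', heq⟩ := ha σ hσ
    have h1 := Scheme.Hom.appLE_comp_appLE (A.act σ) a U V V h hV
    have h2 := Scheme.Hom.appLE_comp_appLE a (A.act σ') U U V (hU σ' hσ').ge h
    have h3 : (A.act σ ≫ a).appLE U V
        (hV.trans ((TopologicalSpace.Opens.map (A.act σ).base).map (homOfLE h)).le) =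
        (a ≫ A.act σ').appLE U V (h.trans ((TopologicalSpace.Opens.map a.base).map
          (homOfLE (hU σ' hσ').ge)).le) := by
      congr 1
    refine (congrArg (fun φ ↦ φ.hom y) (h1.trans (h3.trans h2.symm))).trans ?_
    exact congrArg (a.appLE U V h).hom (hy σ' hσ' (hU σ' hσ').ge)

namespace SemilinearAction.IsGood

/-- Translates of good open subsets are good. -/
lemma preimage [H.Normal] {U : X.Opens} (hU : A.IsGood H U) (ρ : Ω ≃ₐ[k] Ω) :
    A.IsGood H (A.act ρ ⁻¹ᵁ U) := by
  have hcomm : ∀ σ ∈ H, ∃ σ' ∈ H, A.act σ ≫ A.act ρ = A.act ρ ≫ A.act σ' := fun σ hσ ↦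
    ⟨ρ⁻¹ * σ * ρ, by simpa using ‹H.Normal›.conj_mem σ hσ ρ⁻¹, by
      rw [← A.act_mul, ← A.act_mul, mul_assoc, mul_inv_cancel_left]⟩
  refine ⟨hU.isAffineOpen.preimage _, fun σ hσ ↦ ?_, top_le_iff.mp fun x _ ↦ ?_⟩
  · obtain ⟨σ', hσ', h⟩ := hcomm σ hσ
    rw [← Scheme.Hom.comp_preimage, h, Scheme.Hom.comp_preimage, hU.preimage_act σ' hσ']
  · obtain ⟨y, rfl⟩ := (ConcreteCategory.bijective_of_isIso ((A.act ρ).app U)).surjective x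
    have h := range_sup_le_comap (A := A) (H := H) (a := A.act ρ) (U := U) le_rfl _ (A.act_comp ρ)
      hcomm hU.preimage_act (hU.range_sup ▸ Subring.mem_top y)
    rwa [Subring.mem_comap, Scheme.Hom.appLE_eq_app] at h

/-- The product of two affine open subsets is affine in the fibre product. -/
lemma isAffineOpen_inf_aux [IsSeparated f] {U V : X.Opens} (hU : IsAffineOpen U)
    (hV : IsAffineOpen V) :
    IsAffineOpen (pullback.fst f f ⁻¹ᵁ U ⊓ pullback.snd f f ⁻¹ᵁ V) := by
  have h := Scheme.Hom.isPullback_resLE (IsPullback.of_hasPullback f f).flip (US := ⊤) (UT := U)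
    (UX := V) (UY := pullback.fst f f ⁻¹ᵁ U ⊓ pullback.snd f f ⁻¹ᵁ V) (by exact le_top)
    (by exact le_top) (by rw [inf_comm])
  have : IsAffine _ := hU
  have : IsAffine _ := hV
  have : IsAffine _ := isAffineOpen_top (Spec (.of Ω))
  exact .of_isPullback h

/-- Intersections of good open subsets of a separated scheme are good. -/
lemma inf [IsSeparated f] {U V : X.Opens} (hU : A.IsGood H U) (hV : A.IsGood H V) :
    A.IsGood H (U ⊓ V) := by
  -- sections over `U ⊓ V` are restrictions of sections over the product of `U` and `V` along the
  -- closed diagonal, hence are generated by sections over `U` and over `V`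
  let Y := pullback.fst f f ⁻¹ᵁ U ⊓ pullback.snd f f ⁻¹ᵁ V
  have hY : IsAffineOpen Y := isAffineOpen_inf_aux hU.isAffineOpen hV.isAffineOpen
  let d := pullback.diagonal f
  have hd₁ : d ≫ pullback.fst f f = 𝟙 X := pullback.diagonal_fst f
  have hd₂ : d ≫ pullback.snd f f = 𝟙 X := pullback.diagonal_snd f
  have hdY : d ⁻¹ᵁ Y = U ⊓ V := by
    change d ⁻¹ᵁ pullback.fst f f ⁻¹ᵁ U ⊓ d ⁻¹ᵁ pullback.snd f f ⁻¹ᵁ V = _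
    rw [← Scheme.Hom.comp_preimage, ← Scheme.Hom.comp_preimage, hd₁, hd₂]
    rfl
  have hcomm : ∀ σ ∈ H, ∃ σ' ∈ H, A.act σ ≫ 𝟙 X = 𝟙 X ≫ A.act σ' := fun σ hσ ↦
    ⟨σ, hσ, by rw [Category.comp_id, Category.id_comp]⟩
  have hf : 𝟙 X ≫ f = f ≫ Spec.map (CommRingCat.ofHom (RingHom.id Ω)) := by
    rw [CommRingCat.ofHom_id, Spec.map_id, Category.id_comp, Category.comp_id]
  refine ⟨hdY ▸ hY.preimage d, fun σ hσ ↦ ?_, top_le_iff.mp fun x _ ↦ ?_⟩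
  · change A.act σ ⁻¹ᵁ U ⊓ A.act σ ⁻¹ᵁ V = _
    rw [hU.preimage_act σ hσ, hV.preimage_act σ hσ]
  · have hp := (isIso_pushoutSection_iff (IsPullback.of_hasPullback f f) (US := ⊤) (UT := V)
      (UX := U) (UY := Y) le_top le_top rfl).mp
      (isIso_pushoutSection_of_isAffineOpen _ (by exact le_top) (by exact le_top) rfl
        (isAffineOpen_top _) hV.isAffineOpen hU.isAffineOpen)
    obtain ⟨z, rfl⟩ : ∃ z, (d.appLE Y (U ⊓ V) hdY.ge).hom z = x :=
      appLE_surjective d hY hdY x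
    obtain ⟨e, he⟩ := exists_finset_mem_of_isPushout hp z
    refine he (((scalar f (U ⊓ V)).range ⊔ A.invariants H (U ⊓ V)).comap
      (d.appLE Y (U ⊓ V) hdY.ge).hom) (fun y ↦ ?_) fun y _ ↦ ?_
    · have h := range_sup_le_comap (A := A) (H := H) (a := 𝟙 X) (U := U) (V := U ⊓ V) inf_le_left _
        hf hcomm hU.preimage_act (hU.range_sup ▸ Subring.mem_top y)
      have h1 := Scheme.Hom.appLE_comp_appLE d (pullback.fst f f) U Y (U ⊓ V) inf_le_left hdY.ge
      have h2 : (d ≫ pullback.fst f f).appLE U (U ⊓ V) (by rw [hd₁]; exact inf_le_left) =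
          (𝟙 X : X ⟶ X).appLE U (U ⊓ V) inf_le_left := by congr 1
      rw [Subring.mem_comap] at h ⊢
      have h3 := congrArg (fun φ ↦ φ.hom y) (h1.trans h2)
      exact (show _ = _ from h3) ▸ h
    · have h := range_sup_le_comap (A := A) (H := H) (a := 𝟙 X) (U := V) (V := U ⊓ V) inf_le_right _
        hf hcomm hV.preimage_act (hV.range_sup ▸ Subring.mem_top y)
      have h1 := Scheme.Hom.appLE_comp_appLE d (pullback.snd f f) V Y (U ⊓ V) inf_le_right hdY.ge
      have h2 : (d ≫ pullback.snd f f).appLE V (U ⊓ V) (by rw [hd₂]; exact inf_le_right) =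
          (𝟙 X : X ⟶ X).appLE V (U ⊓ V) inf_le_right := by congr 1
      rw [Subring.mem_comap] at h ⊢
      have h3 := congrArg (fun φ ↦ φ.hom y) (h1.trans h2)
      exact (show _ = _ from h3) ▸ h

/-- Descent along a finite extension: a good open subset for the automorphisms over `k₁` that is
stable under all automorphisms is good for all automorphisms. -/
lemma top_of_fixingSubgroup {k₁ : IntermediateField k Ω} [FiniteDimensional k k₁] {U : X.Opens}
    (hU : A.IsGood k₁.fixingSubgroup U) (hs : ∀ σ, A.act σ ⁻¹ᵁ U = U) : A.IsGood ⊤ U := by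
  refine ⟨hU.isAffineOpen, fun σ _ ↦ hs σ, ?_⟩
  let α : (Ω ≃ₐ[k] Ω) → (Γ(X, U) →+* Γ(X, U)) := fun σ ↦ ((A.act σ).appLE U U (hs σ).ge).hom
  have hα : ∀ b ∈ A.invariants k₁.fixingSubgroup U,
      b ∈ (scalar f U).range ⊔ A.invariants ⊤ U := by
    intro b hb
    refine mem_range_sup_of_invariant k₁ (scalar f U) α (fun σ τ b ↦ ?_) (fun b ↦ ?_)
      (fun σ c ↦ ?_) (A.invariants ⊤ U) (fun b hb σ _ _ ↦ hb σ) b fun σ hσ ↦ hb σ hσ _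
    · have h1 := Scheme.Hom.appLE_comp_appLE (A.act σ) (A.act τ) U U U (hs τ).ge (hs σ).ge
      have h2 : (A.act (σ * τ)).appLE U U (hs _).ge = (A.act σ ≫ A.act τ).appLE U U
          (by rw [← A.act_mul]; exact (hs _).ge) := by
        congr 1
        exact A.act_mul σ τ
      exact congrArg (fun φ ↦ φ.hom b) (h2.trans h1.symm)
    · have h2 : (A.act 1).appLE U U (hs _).ge = (𝟙 X : X ⟶ X).appLE U U le_rfl := by
        congr 1
        exact A.act_one
      refine (congrArg (fun φ ↦ φ.hom b) h2).trans ?_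
      rw [show (𝟙 X : X ⟶ X).appLE U U le_rfl = (𝟙 X : X ⟶ X).app U from Scheme.Hom.appLE_eq_app _,
        Scheme.Hom.id_app]
      rfl
    · exact appLE_scalar _ _ (A.act_comp σ) c
  refine top_le_iff.mp (hU.range_sup.ge.trans (sup_le le_sup_left hα))

end SemilinearAction.IsGood

section Existence

variable {n : ℕ}

/-- An embedding that is equivariant over `k₁` becomes invariant after projection to projective
space over `k₁`. -/
lemma SemilinearAction.EquivariantUnder.act_comp_map_eq {k₁ : IntermediateField k Ω}
    {i : X ⟶ Pn n Ω} (heq : A.EquivariantUnder k₁ i) {σ : Ω ≃ₐ[k] Ω}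
    (hσ : σ ∈ k₁.fixingSubgroup) :
    A.act σ ≫ i ≫ Pn.map (algebraMap k₁ Ω) = i ≫ Pn.map (algebraMap k₁ Ω) := by
  have hσ' := (IntermediateField.mem_fixingSubgroup_iff _ _).mp hσ
  rw [← Category.assoc, heq σ hσ', Category.assoc, ← Pn.map_comp]
  congr 2
  ext x
  exact hσ' x x.2

/-- Preimages of affine open subsets of projective space over `k₁` under an equivariant immersion
are good, provided that the immersion is closed over them. -/
lemma isGood_preimage (k₁ : IntermediateField k Ω) (i : X ⟶ Pn n Ω) [IsImmersion i]
    (hi : i ≫ Pn.toSpec n Ω = f) (heq : A.EquivariantUnder k₁ i) {W : (Pn n k₁).Opens}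
    (hW : IsAffineOpen W)
    (hWi : Pn.map (n := n) (algebraMap k₁ Ω) ⁻¹ᵁ W ≤ i.coborderRange) :
    A.IsGood k₁.fixingSubgroup ((i ≫ Pn.map (algebraMap k₁ Ω)) ⁻¹ᵁ W) := by
  let q : Pn n Ω ⟶ Pn n k₁ := Pn.map (algebraMap k₁ Ω)
  let W' := q ⁻¹ᵁ W
  let U := (i ≫ q) ⁻¹ᵁ W
  have hW' : IsAffineOpen W' := hW.preimage q
  let V := i.coborderRange.ι ⁻¹ᵁ W'
  have hV : IsAffineOpen V := hW'.preimage_of_isOpenImmersion _ (by simpa using hWi)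
  have hVU : i.liftCoborder ⁻¹ᵁ V = U := by
    change i.liftCoborder ⁻¹ᵁ i.coborderRange.ι ⁻¹ᵁ q ⁻¹ᵁ W = (i ≫ q) ⁻¹ᵁ W
    rw [← Scheme.Hom.comp_preimage, ← Scheme.Hom.comp_preimage, i.liftCoborder_ι]
  have hinv : ∀ σ ∈ k₁.fixingSubgroup, A.act σ ≫ i ≫ q = i ≫ q :=
    fun σ hσ ↦ heq.act_comp_map_eq hσ
  have hU : IsAffineOpen U := hVU ▸ hV.preimage _
  refine ⟨hU, fun σ hσ ↦ ?_, top_le_iff.mp fun x _ ↦ ?_⟩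
  · rw [← Scheme.Hom.comp_preimage, hinv σ hσ]
  · have hp := (isIso_pushoutSection_iff (Pn.isPullback (n := n) (algebraMap k₁ Ω)) (US := ⊤)
      (UT := ⊤) (UX := W) (UY := W') le_top le_top (by simp [W', q])).mp
      (isIso_pushoutSection_of_isAffineOpen _ (by exact le_top) (by exact le_top) (by simp [W', q])
        (isAffineOpen_top _) (isAffineOpen_top _) hW)
    obtain ⟨z, rfl⟩ : ∃ z, (i.appLE W' U le_rfl).hom z = x := by
      obtain ⟨y, rfl⟩ := appLE_surjective i.liftCoborder hV hVU x
      have : IsIso (i.coborderRange.ι.app W') := Scheme.Hom.isIso_app _ _ (by simpa using hWi)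
      obtain ⟨z, rfl⟩ :=
        (ConcreteCategory.bijective_of_isIso (i.coborderRange.ι.app W')).surjective y
      refine ⟨z, ?_⟩
      have h1 := Scheme.Hom.appLE_comp_appLE i.liftCoborder i.coborderRange.ι W' V U le_rfl hVU.ge
      rw [Scheme.Hom.appLE_eq_app] at h1
      have h2 : (i.liftCoborder ≫ i.coborderRange.ι).appLE W' U
          (by rw [i.liftCoborder_ι]; exact le_rfl) = i.appLE W' U le_rfl := by
        congr 1
        exact i.liftCoborder_ι
      exact (congrArg (fun φ ↦ φ.hom z) (h1.trans h2)).symm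
    obtain ⟨e, he⟩ := exists_finset_mem_of_isPushout hp z
    refine he (((scalar f U).range ⊔ A.invariants k₁.fixingSubgroup U).comap
      (i.appLE W' U le_rfl).hom) (fun y ↦ ?_) fun c _ ↦ ?_
    · refine (le_sup_right : A.invariants _ U ≤ _) fun σ hσ hU ↦ ?_
      have h1 := Scheme.Hom.appLE_comp_appLE i q W W' U le_rfl le_rfl
      have h2 := Scheme.Hom.appLE_comp_appLE (A.act σ) (i ≫ q) W U U le_rfl hU
      have h3 : (A.act σ ≫ i ≫ q).appLE W U (by rw [hinv σ hσ]) =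
          (i ≫ q).appLE W U le_rfl := by
        congr 1
        exact hinv σ hσ
      have h4 := congrArg (fun φ ↦ φ.hom y) (h2.trans h3)
      have h5 := congrArg (fun φ ↦ φ.hom y) h1
      have h6 : (i.appLE W' U le_rfl).hom ((q.appLE W W' le_rfl).hom y) =
        ((i ≫ q).appLE W U le_rfl).hom y := h5
      refine (congrArg ((A.act σ).appLE U U hU).hom h6).trans ?_
      exact h4.trans h6.symm
    · refine (le_sup_left : (scalar f U).range ≤ _) ⟨(ΓSpecIso (.of Ω)).hom.hom c, ?_⟩
      have h1 := Scheme.Hom.appLE_comp_appLE i (Pn.toSpec n Ω) ⊤ W' U le_top le_rfl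
      have h2 : (i ≫ Pn.toSpec n Ω).appLE ⊤ U le_top = f.appLE ⊤ U le_top := by
        congr 1
      have h3 : (ΓSpecIso (.of Ω)).inv.hom ((ΓSpecIso (.of Ω)).hom.hom c) = c := by
        rw [← CommRingCat.comp_apply, Iso.hom_inv_id]
        rfl
      refine (congrArg (f.appLE ⊤ U le_top).hom h3).trans ?_
      exact (congrArg (fun φ ↦ φ.hom c) (h1.trans h2)).symm

/-- Good open subsets cover a scheme with an embedding that is equivariant over a finite normal
extension `k₁` of `k`: intersect the finitely many translates of a good open subset for `k₁` that
contains the translates of a given point. -/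
theorem exists_mem_isGood [CharZero Ω] [IsSeparated f] (k₁ : IntermediateField k Ω)
    [FiniteDimensional k k₁] [Normal k k₁] [Algebra.IsInvariant k₁ Ω (Ω ≃ₐ[k₁] Ω)]
    (i : X ⟶ Pn n Ω) [IsImmersion i]
    (hi : i ≫ Pn.toSpec n Ω = f) (heq : A.EquivariantUnder k₁ i) (x : X) :
    ∃ U : X.Opens, x ∈ U ∧ A.IsGood ⊤ U := by
  classical
  let H := k₁.fixingSubgroup
  have : H.Normal := normal_fixingSubgroup k₁
  let Q := (Ω ≃ₐ[k] Ω) ⧸ H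
  have : Finite Q := finite_quotient_fixingSubgroup k₁
  have hout (σ : Ω ≃ₐ[k] Ω) : ∃ τ ∈ H, σ = (QuotientGroup.mk σ : Q).out * τ :=
    ⟨(QuotientGroup.mk σ : Q).out⁻¹ * σ, QuotientGroup.eq.mp (QuotientGroup.out_eq' _), by simp⟩
  let p : X ⟶ Pn n k₁ := i ≫ Pn.map (algebraMap k₁ Ω)
  have hinv : ∀ σ ∈ H, A.act σ ≫ p = p := fun σ hσ ↦ heq.act_comp_map_eq hσ
  have hT : (Set.range fun ρ ↦ p (A.act ρ x)).Finite := by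
    refine (Set.finite_range fun g : Q ↦ p (A.act g.out x)).subset ?_
    rintro _ ⟨ρ, rfl⟩
    obtain ⟨τ, hτ, h⟩ := hout ρ
    refine ⟨QuotientGroup.mk ρ, ?_⟩
    dsimp only
    conv_rhs => rw [h, A.act_mul, Scheme.Hom.comp_apply]
    exact (congrArg (fun φ : X ⟶ Pn n k₁ ↦ φ (A.act (QuotientGroup.mk ρ : Q).out x))
      (hinv τ hτ)).symm
  have : CharZero k₁ := (algebraMap k₁ Ω).charZero
  have : Infinite k₁ := CharZero.infinite k₁
  obtain ⟨W, hW, hTW, hWi⟩ := exists_isAffineOpen_preimage_le (F := k₁) i.coborderRange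
    (fun σ z hz ↦ mem_coborderRange_of_equivariant i (σ : Ω ≃+* Ω) (A.act (σ.restrictScalars k))
      (heq (σ.restrictScalars k) fun x hx ↦ σ.commutes ⟨x, hx⟩) z hz) hT (by
    rintro _ ⟨ρ, rfl⟩
    exact ⟨i (A.act ρ x), subset_coborder ⟨_, rfl⟩, rfl⟩)
  let U := p ⁻¹ᵁ W
  have hU : A.IsGood H U := isGood_preimage k₁ i hi heq hW hWi
  have hfin : (Set.range fun ρ ↦ A.act ρ ⁻¹ᵁ U).Finite := by
    refine (Set.finite_range fun g : Q ↦ A.act g.out ⁻¹ᵁ U).subset ?_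
    rintro _ ⟨ρ, rfl⟩
    obtain ⟨τ, hτ, h⟩ := hout ρ
    refine ⟨QuotientGroup.mk ρ, ?_⟩
    dsimp only
    conv_rhs => rw [h]
    rw [A.act_mul, Scheme.Hom.comp_preimage, hU.preimage_act τ hτ]
  have hne : hfin.toFinset.Nonempty := ⟨A.act 1 ⁻¹ᵁ U, hfin.mem_toFinset.mpr ⟨1, rfl⟩⟩
  let U' := hfin.toFinset.inf' hne id
  have hmem (y : X) : y ∈ U' ↔ ∀ ρ, A.act ρ y ∈ U := by
    have : y ∈ U' ↔ ∀ V ∈ hfin.toFinset, y ∈ V := by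
      rw [← SetLike.mem_coe, show U' = hfin.toFinset.inf id from Finset.inf'_eq_inf hne id,
        TopologicalSpace.Opens.coe_finset_inf]
      simp [Finset.inf_set_eq_iInter]
    rw [this]
    constructor
    · exact fun h ρ ↦ h _ (hfin.mem_toFinset.mpr ⟨ρ, rfl⟩)
    · intro h V hV
      obtain ⟨ρ, rfl⟩ := hfin.mem_toFinset.mp hV
      exact h ρ
  refine ⟨U', (hmem x).mpr fun ρ ↦ hTW ⟨ρ, rfl⟩, ?_⟩
  have hgood : A.IsGood H U' := by
    refine Finset.inf'_induction hne id (fun V hV V' hV' ↦ hV.inf hV') fun V hV ↦ ?_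
    obtain ⟨ρ, rfl⟩ := hfin.mem_toFinset.mp hV
    exact hU.preimage ρ
  refine hgood.top_of_fixingSubgroup fun σ ↦ ?_
  ext y
  have h1 : y ∈ A.act σ ⁻¹ᵁ U' ↔ A.act σ y ∈ U' := Iff.rfl
  change y ∈ A.act σ ⁻¹ᵁ U' ↔ y ∈ U'
  rw [h1, hmem, hmem]
  constructor
  · intro h ρ
    have := h (σ⁻¹ * ρ)
    rwa [← Scheme.Hom.comp_apply, ← A.act_mul, mul_inv_cancel_left] at this
  · intro h ρ
    rw [← Scheme.Hom.comp_apply, ← A.act_mul]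
    exact h _

end Existence

end Good

/-! ### Rings generated by scalars and invariants -/

section Algebra

variable {k Ω : Type u} [Field k] [Field Ω] [Algebra k Ω]

/-- Elements of a ring with semilinear action that are invariant and linearly independent over `k`
are linearly independent over `Ω`. -/
lemma linearIndepOn_of_invariant [Algebra.IsInvariant k Ω (Ω ≃ₐ[k] Ω)] {B : Type u} [CommRing B]
    [Algebra Ω B] [Algebra k B] [IsScalarTower k Ω B]
    (α : (Ω ≃ₐ[k] Ω) → (B →+* B)) (hα : ∀ σ c, α σ (algebraMap Ω B c) = algebraMap Ω B (σ c))
    {ι : Type*} (v : ι → B) (hv : ∀ σ i, α σ (v i) = v i) (hli : LinearIndependent k v)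
    (t : Finset ι) : ∀ g : ι → Ω, ∑ i ∈ t, g i • v i = 0 → ∀ i ∈ t, g i = 0 := by
  classical
  induction t using Finset.induction_on with
  | empty => simp
  | insert j t hj ih =>
    intro g hg
    have hj0 : g j = 0 := by
      by_contra hgj
      -- normalize the coefficient at `j`; the other coefficients are then invariant
      let g' : ι → Ω := fun i ↦ (g j)⁻¹ * g i
      have hg' : ∑ i ∈ insert j t, g' i • v i = 0 := by
        simp only [g', mul_smul, ← Finset.smul_sum, hg, smul_zero]
      have hg'j : g' j = 1 := inv_mul_cancel₀ hgj
      have hinv : ∀ i ∈ insert j t, ∀ σ : Ω ≃ₐ[k] Ω, σ (g' i) = g' i := by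
        intro i hi σ
        have h1 : ∑ i ∈ insert j t, σ (g' i) • v i = 0 := by
          have := congrArg (α σ) hg'
          rw [map_zero, map_sum] at this
          rw [← this]
          exact Finset.sum_congr rfl fun i _ ↦ by
            rw [Algebra.smul_def, Algebra.smul_def, map_mul (α σ), hα, hv]
        have h2 : ∑ i ∈ t, (σ (g' i) - g' i) • v i = 0 := by
          have h3 : ∑ i ∈ insert j t, (σ (g' i) - g' i) • v i = 0 := by
            simp only [sub_smul, Finset.sum_sub_distrib, h1, hg', sub_zero]
          rwa [Finset.sum_insert hj, hg'j, map_one, sub_self, zero_smul, zero_add] at h3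
        rcases Finset.mem_insert.mp hi with rfl | hi
        · rw [hg'j, map_one]
        · exact sub_eq_zero.mp (ih _ h2 i hi)
      have hc : ∀ i : ι, ∃ c : k, i ∈ insert j t → algebraMap k Ω c = g' i := fun i ↦ by
        by_cases hi : i ∈ insert j t
        · obtain ⟨c, hc⟩ := Algebra.IsInvariant.isInvariant (A := k) (G := Ω ≃ₐ[k] Ω) (g' i)
            (hinv i hi)
          exact ⟨c, fun _ ↦ hc⟩
        · exact ⟨0, fun h ↦ absurd h hi⟩
      choose c hc using hc
      have h4 : ∑ i ∈ insert j t, c i • v i = 0 := by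
        rw [← hg']
        exact Finset.sum_congr rfl fun i hi ↦ by rw [← hc i hi, algebraMap_smul]
      have h5 := linearIndependent_iff'.mp hli _ c h4 j (Finset.mem_insert_self _ _)
      have h6 := hc j (Finset.mem_insert_self _ _)
      rw [h5, map_zero, hg'j] at h6
      exact zero_ne_one h6
    rw [Finset.sum_insert hj, hj0, zero_smul, zero_add] at hg
    intro i hi
    rcases Finset.mem_insert.mp hi with rfl | hi
    · exact hj0
    · exact ih g hg i hi

/-- Galois descent for a ring `B` with semilinear action that is generated by scalars and
invariants: it is the base change to `Ω` of the ring `I` of invariants. -/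
lemma isPushout_of_invariant [Algebra.IsInvariant k Ω (Ω ≃ₐ[k] Ω)] {B : Type u} [CommRing B]
    (s : Ω →+* B) (α : (Ω ≃ₐ[k] Ω) → (B →+* B)) (hα : ∀ σ c, α σ (s c) = s (σ c))
    (I : Subring B) (hI : ∀ b ∈ I, ∀ σ, α σ b = b) (hk : ∀ c : k, s (algebraMap k Ω c) ∈ I)
    (hsup : s.range ⊔ I = ⊤) :
    IsPushout (CommRingCat.ofHom (algebraMap k Ω))
      (CommRingCat.ofHom ((s.comp (algebraMap k Ω)).codRestrict I hk))
      (CommRingCat.ofHom s) (CommRingCat.ofHom I.subtype) := by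
  let _ : Algebra Ω B := s.toAlgebra
  let _ : Algebra k B := (s.comp (algebraMap k Ω)).toAlgebra
  let _ : Algebra k I := ((s.comp (algebraMap k Ω)).codRestrict I hk).toAlgebra
  have : IsScalarTower k Ω B := .of_algebraMap_eq' rfl
  have : IsScalarTower k I B := .of_algebraMap_eq' rfl
  have : Algebra.IsPushout k Ω I B := by
    let b := Module.Basis.ofVectorSpace k I
    let v := fun i ↦ (b i : B)
    have hv : ∀ σ i, α σ (v i) = v i := fun σ i ↦ hI _ (b i).2 σ
    have hli : LinearIndependent k v :=
      b.linearIndependent.map' (IsScalarTower.toAlgHom k I B).toLinearMap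
        (LinearMap.ker_eq_bot.mpr Subtype.val_injective)
    have hli' : LinearIndependent Ω v := linearIndependent_iff'.mpr fun t g hg ↦
      linearIndepOn_of_invariant α hα v hv hli t g hg
    have hIsp : ∀ y ∈ I, y ∈ Submodule.span Ω (Set.range v) := by
      intro y hy
      have h1 : (IsScalarTower.toAlgHom k I B).toLinearMap ⟨y, hy⟩ ∈
          Submodule.map (IsScalarTower.toAlgHom k I B).toLinearMap
            (Submodule.span k (Set.range b)) :=
        Submodule.mem_map_of_mem (b.span_eq ▸ Submodule.mem_top)
      rw [Submodule.map_span, ← Set.range_comp] at h1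
      exact Submodule.span_le_restrictScalars k Ω _ h1
    have hsp : ⊤ ≤ Submodule.span Ω (Set.range v) := by
      intro x _
      have hx : x ∈ Algebra.adjoin Ω (I : Set B) := by
        have : s.range ⊔ I ≤ (Algebra.adjoin Ω (I : Set B)).toSubring := by
          refine sup_le ?_ Algebra.subset_adjoin
          rintro _ ⟨c, rfl⟩
          exact (Algebra.adjoin Ω (I : Set B)).algebraMap_mem c
        exact this (hsup ▸ Subring.mem_top x)
      rw [← Subalgebra.mem_toSubmodule, Algebra.adjoin_eq_span,
        show ((Submonoid.closure (I : Set B) : Submonoid B) : Set B) = I from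
          congrArg SetLike.coe (Submonoid.closure_eq I.toSubmonoid)] at hx
      exact Submodule.span_le.mpr hIsp hx
    let b' := Module.Basis.mk hli' hsp
    refine ⟨?_⟩
    have hb : ((IsScalarTower.toAlgHom k I B).toLinearMap) =
       (Finsupp.linearCombination k b').comp b.repr.toLinearMap := by
      refine b.ext fun i ↦ ?_
      simp [b', v]
      rfl
    rw [hb]
    exact (IsBaseChange.of_basis k b').comp_equiv b.repr _
  exact CommRingCat.isPushout_of_isPushout k Ω I B

end Algebra

/-! ### Quotients of good open subsets -/

section LocalQuotient

open Scheme

variable {k Ω : Type u} [Field k] [Field Ω] [Algebra k Ω]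
  {X : Scheme.{u}} {f : X ⟶ Spec (.of Ω)}

lemma toSpecΓ_scalar (f : X ⟶ Spec (.of Ω)) (U : X.Opens) :
    U.toSpecΓ ≫ Spec.map (CommRingCat.ofHom (scalar f U)) = U.ι ≫ f := by
  have h : CommRingCat.ofHom (scalar f U) = (ΓSpecIso (.of Ω)).inv ≫ f.appLE ⊤ U le_top := rfl
  rw [h, Spec.map_comp]
  refine (Category.assoc _ _ _).symm.trans ?_
  refine (congrArg (· ≫ Spec.map (ΓSpecIso (.of Ω)).inv)
    (Scheme.Opens.toSpecΓ_SpecMap_appLE f ⊤ U le_top)).trans ?_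
  rw [Scheme.Opens.toSpecΓ_top, Category.assoc, Category.assoc, toSpecΓ_SpecMap_ΓSpecIso_inv]
  exact (congrArg (_ ≫ ·) (Category.comp_id _)).trans (Scheme.Hom.resLE_comp_ι f le_top)

variable (A : SemilinearAction k f)

lemma scalar_mem_invariants (U : X.Opens) (c : k) :
    scalar f U (algebraMap k Ω c) ∈ A.invariants ⊤ U := fun σ _ h ↦ by
  rw [appLE_scalar h _ (A.act_comp σ)]
  exact congrArg (scalar f U) (σ.commutes c)

/-- The quotient of a good open subset by the action: the spectrum of its ring of invariants. -/
noncomputable def quotientObj (U : X.Opens) : Scheme.{u} := Spec (.of (A.invariants ⊤ U))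

/-- The structure morphism of the quotient to the spectrum of `k`, the invariants being a
`k`-algebra. -/
noncomputable def quotientStr (U : X.Opens) : quotientObj A U ⟶ Spec (.of k) :=
  Spec.map (CommRingCat.ofHom (((scalar f U).comp (algebraMap k Ω)).codRestrict _
    (scalar_mem_invariants A U)))

/-- The quotient morphism, given by the inclusion of the ring of invariants. -/
noncomputable def toQuotient (U : X.Opens) : (U : Scheme.{u}) ⟶ quotientObj A U :=
  U.toSpecΓ ≫ (Spec.map (CommRingCat.ofHom (A.invariants ⊤ U).subtype) :
    Spec (.of Γ(X, U)) ⟶ Spec (.of (A.invariants ⊤ U)))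

variable {A}

/-- A good open subset is the base change of its quotient. -/
lemma isPullback_toQuotient [Algebra.IsInvariant k Ω (Ω ≃ₐ[k] Ω)] {U : X.Opens}
    (hU : A.IsGood ⊤ U) :
    IsPullback (toQuotient A U) (U.ι ≫ f) (quotientStr A U)
      (Spec.map (CommRingCat.ofHom (algebraMap k Ω))) := by
  have hp := isPushout_of_invariant (scalar f U)
    (fun σ ↦ ((A.act σ).appLE U U (hU.preimage_act σ trivial).ge).hom)
    (fun σ c ↦ appLE_scalar _ _ (A.act_comp σ) c) (A.invariants ⊤ U) (fun b hb σ ↦ hb σ trivial _)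
    (scalar_mem_invariants A U) hU.range_sup
  have : IsIso U.toSpecΓ := hU.isAffineOpen.isoSpec_hom ▸ inferInstance
  exact isPullback_of_isIso_comp (isPullback_SpecMap_of_isPushout _ _ _ _ hp).flip U.toSpecΓ rfl
    (toSpecΓ_scalar f U)

lemma resLE_toQuotient {U : X.Opens} (σ : Ω ≃ₐ[k] Ω) (h : U ≤ A.act σ ⁻¹ᵁ U) :
    (A.act σ).resLE U U h ≫ toQuotient A U = toQuotient A U := by
  have h1 : CommRingCat.ofHom (A.invariants ⊤ U).subtype ≫ (A.act σ).appLE U U h =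
      CommRingCat.ofHom (A.invariants ⊤ U).subtype := by
    ext y
    exact y.2 σ trivial h
  have h2 := Scheme.Opens.toSpecΓ_SpecMap_appLE (A.act σ) U U h
  have h3 := congrArg (fun φ ↦ φ ≫ (Spec.map (CommRingCat.ofHom (A.invariants ⊤ U).subtype) :
    Spec (.of Γ(X, U)) ⟶ Spec (.of (A.invariants ⊤ U)))) h2
  refine (Category.assoc _ _ _).symm.trans (h3.symm.trans ?_)
  refine (Category.assoc _ _ _).trans (congrArg (U.toSpecΓ ≫ ·) ?_)
  exact (Spec.map_comp _ _).symm.trans (congrArg Spec.map h1)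

/-- Restrictions of invariants are invariant. Stability of the larger open subset under the action
is needed, since the condition defining invariants is void for automorphisms that do not preserve
the open subset. -/
lemma map_mem_invariants {U V : X.Opens} (h : U ≤ V) (hV : A.IsGood ⊤ V) (y : A.invariants ⊤ V) :
    (X.presheaf.map (homOfLE h).op).hom y ∈ A.invariants ⊤ U := fun σ _ hU ↦ by
  have h1 := Scheme.Hom.map_appLE (A.act σ) hU (homOfLE h).op
  have h2 := Scheme.Hom.appLE_map (A.act σ) (hV.preimage_act σ trivial).ge (homOfLE h).op
  refine (congrArg (fun φ ↦ φ.hom (y : Γ(X, V))) (h1.trans h2.symm)).trans ?_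
  exact congrArg (X.presheaf.map (homOfLE h).op).hom (y.2 σ trivial _)

variable (A) in
/-- The quotients of good open subsets, as a diagram of schemes. -/
noncomputable def quotientDiagram : {U : X.Opens // A.IsGood ⊤ U} ⥤ Scheme.{u} where
  obj U := quotientObj A U.1
  map {U V} h := Spec.map (CommRingCat.ofHom
    ((((X.presheaf.map (homOfLE h.le).op).hom.comp (A.invariants ⊤ V.1).subtype)).codRestrict _
      (map_mem_invariants h.le V.2)))
  map_id U := by
    refine (congrArg Spec.map ?_).trans (Spec.map_id _)
    refine CommRingCat.hom_ext (RingHom.ext fun y ↦ Subtype.ext ?_)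
    exact congrArg (fun φ ↦ φ.hom (y : Γ(X, U.1))) (X.presheaf.map_id _)
  map_comp {U V W} g h := by
    refine Eq.trans (congrArg Spec.map ?_) (Spec.map_comp _ _)
    refine CommRingCat.hom_ext (RingHom.ext fun y ↦ Subtype.ext ?_)
    exact congrArg (fun φ ↦ φ.hom (y : Γ(X, W.1)))
      (X.presheaf.map_comp (homOfLE (show V.1 ≤ W.1 from h.le)).op
        (homOfLE (show U.1 ≤ V.1 from g.le)).op)

lemma homOfLE_toQuotient {U V : {U : X.Opens // A.IsGood ⊤ U}} (h : U ⟶ V) :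
    X.homOfLE h.le ≫ toQuotient A V.1 = toQuotient A U.1 ≫ (quotientDiagram A).map h := by
  have h2 := Scheme.Opens.toSpecΓ_SpecMap_presheaf_map U.1 V.1 h.le
  have h3 := congrArg (fun φ ↦ φ ≫ (Spec.map (CommRingCat.ofHom (A.invariants ⊤ V.1).subtype) :
    Spec (.of Γ(X, V.1)) ⟶ Spec (.of (A.invariants ⊤ V.1)))) h2
  refine (Category.assoc _ _ _).symm.trans (h3.symm.trans ?_)
  refine (Category.assoc _ _ _).trans (Eq.trans ?_ (Category.assoc _ _ _).symm)
  refine congrArg (U.1.toSpecΓ ≫ ·) ?_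
  refine (Spec.map_comp _ _).symm.trans (Eq.trans (congrArg Spec.map ?_) (Spec.map_comp _ _))
  rfl

lemma quotientDiagram_map_str {U V : {U : X.Opens // A.IsGood ⊤ U}} (h : U ⟶ V) :
    (quotientDiagram A).map h ≫ quotientStr A V.1 = quotientStr A U.1 := by
  refine (Spec.map_comp _ _).symm.trans (congrArg Spec.map ?_)
  refine CommRingCat.hom_ext (RingHom.ext fun c ↦ Subtype.ext ?_)
  have := Scheme.Hom.appLE_map f (U := ⊤) (V := V.1) le_top (homOfLE h.le).op
  exact congrArg (fun φ ↦ φ.hom ((ΓSpecIso (.of Ω)).inv.hom (algebraMap k Ω c))) this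

section Invariant

variable [Algebra.IsInvariant k Ω (Ω ≃ₐ[k] Ω)]

/-- A good open subset of a good open subset is the preimage of its quotient, by comparison of the
two base changes. -/
lemma isPullback_quotientDiagram_map {U V : {U : X.Opens // A.IsGood ⊤ U}} (h : U ⟶ V) :
    IsPullback (X.homOfLE h.le) (toQuotient A U.1) (toQuotient A V.1)
      ((quotientDiagram A).map h) := by
  refine IsPullback.flip (.of_bot (h₃₁ := Spec.map (CommRingCat.ofHom (algebraMap k Ω)))
    (v₂₁ := V.1.ι ≫ f) (v₂₂ := quotientStr A V.1) ?_ (homOfLE_toQuotient h).symm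
    (isPullback_toQuotient V.2))
  have h1 : X.homOfLE h.le ≫ V.1.ι ≫ f = U.1.ι ≫ f := Scheme.homOfLE_ι_assoc ..
  have h2 := quotientDiagram_map_str h
  exact h1.symm ▸ h2.symm ▸ isPullback_toQuotient U.2

lemma fpqc_toQuotient (U : {U : X.Opens // A.IsGood ⊤ U}) :
    Surjective (toQuotient A U.1) ∧ Flat (toQuotient A U.1) ∧ QuasiCompact (toQuotient A U.1) := by
  have hp := isPullback_toQuotient U.2
  refine ⟨MorphismProperty.of_isPullback hp.flip inferInstance,
    MorphismProperty.of_isPullback hp.flip ?_, MorphismProperty.of_isPullback hp.flip inferInstance⟩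
  rw [Flat.SpecMap_iff]
  exact RingHom.flat_algebraMap_iff.mpr inferInstance

/-- The transition morphisms are open immersions by fpqc descent. -/
instance {U V : {U : X.Opens // A.IsGood ⊤ U}} (h : U ⟶ V) :
    IsOpenImmersion ((quotientDiagram A).map h) :=
  MorphismProperty.of_isPullback_of_descendsAlong
    (Q := @Surjective ⊓ @Flat ⊓ @QuasiCompact) (isPullback_quotientDiagram_map h)
    ⟨⟨(fpqc_toQuotient V).1, (fpqc_toQuotient V).2.1⟩, (fpqc_toQuotient V).2.2⟩ inferInstance

lemma exists_preimage_of_isPullback {P Y Z S : Scheme.{u}} {a : P ⟶ Y} {b : P ⟶ Z} {g : Y ⟶ S}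
    {h : Z ⟶ S} (hP : IsPullback a b g h) (y : Y) (z : Z) (e : g y = h z) :
    ∃ p : P, a p = y ∧ b p = z := by
  obtain ⟨w, h1, h2⟩ := Scheme.Pullback.exists_preimage_pullback y z e
  refine ⟨hP.isoPullback.inv w, ?_, ?_⟩
  · rw [← Scheme.Hom.comp_apply, hP.isoPullback_inv_fst, h1]
  · rw [← Scheme.Hom.comp_apply, hP.isoPullback_inv_snd, h2]

/-- The quotients can be glued: points of two of them with the same image in a third come from the
quotient of the intersection, which is again good. -/
instance [IsSeparated f] : (quotientDiagram A ⋙ Scheme.forget).IsLocallyDirected where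
  cond {U V W} fi fj xi xj h := by
    obtain ⟨u, rfl⟩ := (fpqc_toQuotient U).1.surj xi
    have hW : toQuotient A W.1 (X.homOfLE fi.le u) = (quotientDiagram A).map fj xj := by
      refine Eq.trans ?_ h
      exact congrArg (fun φ : (U.1 : Scheme.{u}) ⟶ quotientObj A W.1 ↦ φ u)
        (homOfLE_toQuotient fi)
    obtain ⟨v, hv, rfl⟩ := exists_preimage_of_isPullback (isPullback_quotientDiagram_map fj) _ _ hW
    have hx : U.1.ι u = V.1.ι v := by
      have h1 := congrArg W.1.ι hv
      rw [← Scheme.Hom.comp_apply, ← Scheme.Hom.comp_apply, Scheme.homOfLE_ι,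
        Scheme.homOfLE_ι] at h1
      exact h1.symm
    let l : {U : X.Opens // A.IsGood ⊤ U} := ⟨U.1 ⊓ V.1, U.2.inf V.2⟩
    let w : (l.1 : Scheme.{u}) := ⟨U.1.ι u, u.2, hx ▸ v.2⟩
    let li : l ⟶ U := homOfLE (inf_le_left : U.1 ⊓ V.1 ≤ U.1)
    let lj : l ⟶ V := homOfLE (inf_le_right : U.1 ⊓ V.1 ≤ V.1)
    refine ⟨l, li, lj, toQuotient A l.1 w, ?_, ?_⟩
    · have h1 := congrArg (fun φ : (l.1 : Scheme.{u}) ⟶ quotientObj A U.1 ↦ φ w)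
        (homOfLE_toQuotient li)
      refine h1.symm.trans (congrArg (toQuotient A U.1) ?_)
      apply U.1.ι.isOpenEmbedding.injective
      change (X.homOfLE li.le ≫ U.1.ι) w = _
      rw [Scheme.homOfLE_ι]
      rfl
    · have h1 := congrArg (fun φ : (l.1 : Scheme.{u}) ⟶ quotientObj A V.1 ↦ φ w)
        (homOfLE_toQuotient lj)
      refine h1.symm.trans (congrArg (toQuotient A V.1) ?_)
      apply V.1.ι.isOpenEmbedding.injective
      change (X.homOfLE lj.le ≫ V.1.ι) w = _
      rw [Scheme.homOfLE_ι]
      exact hx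

end Invariant

end LocalQuotient

/-! ### Gluing the quotients -/

section Quotient

open Scheme

variable {k Ω : Type u} [Field k] [Field Ω] [Algebra k Ω]
  {X : Scheme.{u}} {f : X ⟶ Spec (.of Ω)}
  [Algebra.IsInvariant k Ω (Ω ≃ₐ[k] Ω)] [IsSeparated f]

/-- Galois descent for schemes: if a separated `Ω`-scheme with semilinear action is covered by good
open subsets, then it is the base change of a scheme over `k`, which is glued from the spectra of
the rings of invariants. -/
theorem exists_isPullback_of_isGood (A : SemilinearAction k f)
    (hcov : ∀ x : X, ∃ U : X.Opens, x ∈ U ∧ A.IsGood ⊤ U) :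
    ∃ (X₀ : Scheme.{u}) (s : X₀ ⟶ Spec (.of k)) (p : X ⟶ X₀),
      IsPullback p f s (Spec.map (CommRingCat.ofHom (algebraMap k Ω))) ∧
      ∀ σ, A.act σ ≫ p = p := by
  let F := quotientDiagram A
  let ι (U : {U : X.Opens // A.IsGood ⊤ U}) : quotientObj A U.1 ⟶ colimit F := colimit.ι F U
  have hι (U) : IsOpenImmersion (ι U) := inferInstanceAs (IsOpenImmersion (colimit.ι F U))
  have hιw {U V : {U : X.Opens // A.IsGood ⊤ U}} (h : U ⟶ V) :
      X.homOfLE h.le ≫ toQuotient A V.1 ≫ ι V = toQuotient A U.1 ≫ ι U :=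
    (Category.assoc _ _ _).symm.trans ((congrArg (· ≫ ι V) (homOfLE_toQuotient h)).trans
      ((Category.assoc _ _ _).trans (congrArg (toQuotient A U.1 ≫ ·) (colimit.w F h))))
  let s : colimit F ⟶ Spec (.of k) := colimit.desc F ⟨Spec (.of k),
    { app := fun U ↦ quotientStr A U.1
      naturality := fun U V h ↦
        (quotientDiagram_map_str h).trans (Category.comp_id _).symm }⟩
  have hs (U) : ι U ≫ s = quotientStr A U.1 := colimit.ι_desc _ _
  have hO : TopologicalSpace.IsOpenCover fun U : {U : X.Opens // A.IsGood ⊤ U} ↦ U.1 := by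
    refine top_le_iff.mp fun x _ ↦ ?_
    obtain ⟨U, hxU, hU⟩ := hcov x
    exact TopologicalSpace.Opens.mem_iSup.mpr ⟨⟨U, hU⟩, hxU⟩
  let 𝒱 := X.openCoverOfIsOpenCover _ hO
  -- the quotient morphisms agree on overlaps, which are again good
  have hcompat (U V : {U : X.Opens // A.IsGood ⊤ U}) :
      pullback.fst U.1.ι V.1.ι ≫ toQuotient A U.1 ≫ ι U =
        pullback.snd U.1.ι V.1.ι ≫ toQuotient A V.1 ≫ ι V := by
    let l : {U : X.Opens // A.IsGood ⊤ U} := ⟨U.1 ⊓ V.1, U.2.inf V.2⟩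
    let li : l ⟶ U := homOfLE (inf_le_left : U.1 ⊓ V.1 ≤ U.1)
    let lj : l ⟶ V := homOfLE (inf_le_right : U.1 ⊓ V.1 ≤ V.1)
    let e : pullback U.1.ι V.1.ι ⟶ (l.1 : Scheme.{u}) :=
      IsOpenImmersion.lift l.1.ι (pullback.fst U.1.ι V.1.ι ≫ U.1.ι) (by
        rintro _ ⟨z, rfl⟩
        rw [Scheme.Opens.range_ι]
        refine ⟨(pullback.fst U.1.ι V.1.ι z).2, ?_⟩
        rw [pullback.condition]
        exact (pullback.snd U.1.ι V.1.ι z).2)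
    have he : e ≫ l.1.ι = pullback.fst U.1.ι V.1.ι ≫ U.1.ι := IsOpenImmersion.lift_fac _ _ _
    have h1 : pullback.fst U.1.ι V.1.ι = e ≫ X.homOfLE li.le := by
      rw [← cancel_mono U.1.ι, Category.assoc, Scheme.homOfLE_ι, he]
    have h2 : pullback.snd U.1.ι V.1.ι = e ≫ X.homOfLE lj.le := by
      rw [← cancel_mono V.1.ι, Category.assoc, Scheme.homOfLE_ι, he, pullback.condition]
    rw [h1, h2, Category.assoc, Category.assoc, hιw li, hιw lj]
  let p : X ⟶ colimit F := 𝒱.glueMorphisms (fun U ↦ toQuotient A U.1 ≫ ι U) hcompat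
  have hp (U : {U : X.Opens // A.IsGood ⊤ U}) : U.1.ι ≫ p = toQuotient A U.1 ≫ ι U :=
    Scheme.Cover.ι_glueMorphisms 𝒱 _ _ U
  -- the preimage of the quotient of `U` is `U` itself: points of `V` and `U` with the same image
  -- come from a common smaller good open subset, of which `x` is then a member
  have hpre (U : {U : X.Opens // A.IsGood ⊤ U}) : p ⁻¹ᵁ (ι U).opensRange = U.1.ι.opensRange := by
    rw [Scheme.Opens.opensRange_ι]
    refine le_antisymm ?_ fun x hx ↦ ?_
    · rintro x ⟨u, hu⟩
      obtain ⟨V, hxV, hV⟩ := hcov x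
      let V' : {U : X.Opens // A.IsGood ⊤ U} := ⟨V, hV⟩
      let v : (V'.1 : Scheme.{u}) := ⟨x, hxV⟩
      have h1 : ι V' (toQuotient A V'.1 v) = ι U u := by
        have h := congrArg (fun φ : (V'.1 : Scheme.{u}) ⟶ colimit F ↦ φ v) (hp V')
        exact h.symm.trans hu.symm
      obtain ⟨W, fi, fj, w, hw, -⟩ := IsLocallyDirected.ι_eq_ι_iff F |>.mp h1
      obtain ⟨w', hw', -⟩ := exists_preimage_of_isPullback (isPullback_quotientDiagram_map fi) v w
        hw.symm
      have h2 : W.1.ι w' = x := by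
        have h := congrArg V'.1.ι hw'
        rw [← Scheme.Hom.comp_apply, Scheme.homOfLE_ι] at h
        exact h
      have h3 : W.1 ≤ U.1 := fj.le
      exact h3 (h2 ▸ w'.2)
    · refine ⟨toQuotient A U.1 ⟨x, hx⟩, ?_⟩
      exact (congrArg (fun φ : (U.1 : Scheme.{u}) ⟶ colimit F ↦ φ ⟨x, hx⟩) (hp U)).symm
  have hsq (U : {U : X.Opens // A.IsGood ⊤ U}) : IsPullback (toQuotient A U.1) U.1.ι (ι U) p :=
    IsOpenImmersion.isPullback _ _ _ _ (hp U) (hpre U)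
  refine ⟨colimit F, s, p, ?_, fun σ ↦ ?_⟩
  -- being a base change is local on the quotient
  · refine Scheme.isPullback_of_openCover p f s _ (IsLocallyDirected.openCover F) fun U ↦ ?_
    have key (U : {U : X.Opens // A.IsGood ⊤ U}) :
        IsPullback (pullback.snd p (ι U)) (pullback.fst p (ι U) ≫ f) (ι U ≫ s)
          (Spec.map (CommRingCat.ofHom (algebraMap k Ω))) := by
      rw [hs U]
      exact isPullback_of_isIso_comp (isPullback_toQuotient U.2) (hsq U).flip.isoPullback.inv
        (hsq U).flip.isoPullback_inv_snd
        (by rw [← Category.assoc, (hsq U).flip.isoPullback_inv_fst])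
    exact key U
  -- invariance can be checked on the good open subsets
  · have key (U : {U : X.Opens // A.IsGood ⊤ U}) : U.1.ι ≫ A.act σ ≫ p = U.1.ι ≫ p := ?_
    · exact Scheme.Cover.hom_ext 𝒱 _ _ key
    have h1 := resLE_toQuotient (A := A) (U := U.1) σ (U.2.preimage_act σ trivial).ge
    rw [← Scheme.Hom.resLE_comp_ι_assoc (A.act σ) (U.2.preimage_act σ trivial).ge, hp,
      reassoc_of% h1]

end Quotient

/-! ### The semilinear action of a descent system -/

section Translation

variable {k Ω : Type u} [Field k] [Field Ω] [Algebra k Ω] {V : SchemeOver Ω}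

/-- The action of `σ` on the underlying scheme of `V`: the inverse of `f_σ` followed by the
projection `σV → V`. It covers the automorphism of `Spec Ω` given by `σ`. -/
noncomputable def DescentSystem.act (D : DescentSystem k V) (σ : Ω ≃ₐ[k] Ω) : V.left ⟶ V.left :=
  (D.iso σ).inv.left ≫ pullback.fst V.hom (Spec.map (CommRingCat.ofHom (σ : Ω →+* Ω)))

lemma conj_map_left_fst (σ : Ω ≃ₐ[k] Ω) {V W : SchemeOver Ω} (g : V ⟶ W) :
    ((conj σ).map g).left ≫ pullback.fst W.hom (Spec.map (CommRingCat.ofHom (σ : Ω →+* Ω))) =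
      pullback.fst V.hom (Spec.map (CommRingCat.ofHom (σ : Ω →+* Ω))) ≫ g.left :=
  pullback.lift_fst _ _ _

lemma baseChangeComp_hom_left_fst {K K' K'' : Type u} [Field K] [Field K'] [Field K'']
    (φ : K →+* K') (ψ : K' →+* K'') (χ : K →+* K'') (h : ψ.comp φ = χ) (V : SchemeOver K) :
    (baseChangeComp φ ψ χ h V).hom.left ≫ pullback.fst V.hom (Spec.map (CommRingCat.ofHom χ)) =
      pullback.fst ((baseChange φ).obj V).hom (Spec.map (CommRingCat.ofHom ψ)) ≫
        pullback.fst V.hom (Spec.map (CommRingCat.ofHom φ)) := by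
  exact IsPullback.isoPullback_hom_fst _

lemma DescentSystem.act_mul (D : DescentSystem k V) (σ τ : Ω ≃ₐ[k] Ω) :
    D.act (σ * τ) = D.act σ ≫ D.act τ := by
  have h1 : (D.iso σ).inv ≫ (conj σ).map (D.iso τ).inv ≫ (conjConj σ τ V).hom =
      (D.iso (σ * τ)).inv := by
    rw [← cancel_mono (D.iso (σ * τ)).hom, Category.assoc, Category.assoc, D.iso_mul,
      ← Functor.map_comp_assoc, Iso.inv_hom_id, CategoryTheory.Functor.map_id, Category.id_comp,
      Iso.inv_hom_id, Iso.inv_hom_id]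
  have h2 := congrArg (fun φ ↦ φ.left) h1
  have h3 := baseChangeComp_hom_left_fst (τ : Ω →+* Ω) (σ : Ω →+* Ω)
    ((σ * τ : Ω ≃ₐ[k] Ω) : Ω →+* Ω) rfl V
  have h4 := conj_map_left_fst σ (D.iso τ).inv
  unfold DescentSystem.act
  rw [← h2]
  refine (Category.assoc _ _ _).trans ?_
  refine Eq.trans ?_ (Category.assoc _ _ _).symm
  refine congrArg ((D.iso σ).inv.left ≫ ·) ?_
  refine (Category.assoc _ _ _).trans ?_
  refine (congrArg (((conj σ).map (D.iso τ).inv).left ≫ ·) h3).trans ?_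
  refine (Category.assoc _ _ _).symm.trans ?_
  exact (congrArg (· ≫ pullback.fst V.hom (Spec.map (CommRingCat.ofHom (τ : Ω →+* Ω)))) h4).trans
    (Category.assoc _ _ _)

lemma DescentSystem.act_comp (D : DescentSystem k V) (σ : Ω ≃ₐ[k] Ω) :
    D.act σ ≫ V.hom = V.hom ≫ Spec.map (CommRingCat.ofHom (σ : Ω →+* Ω)) := by
  have h1 : (D.iso σ).inv.left ≫
      pullback.snd V.hom (Spec.map (CommRingCat.ofHom (σ : Ω →+* Ω))) = V.hom :=
    Over.w (D.iso σ).inv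
  refine (Category.assoc _ _ _).trans ?_
  refine (congrArg ((D.iso σ).inv.left ≫ ·) pullback.condition).trans ?_
  exact (Category.assoc _ _ _).symm.trans (congrArg (· ≫ _) h1)

/-- The cocycle condition makes the action of `1` idempotent, and it is an isomorphism. -/
lemma DescentSystem.act_one (D : DescentSystem k V) : D.act 1 = 𝟙 V.left := by
  have h1 := D.act_mul 1 1
  rw [mul_one] at h1
  have : IsIso (Spec.map (CommRingCat.ofHom ((1 : Ω ≃ₐ[k] Ω) : Ω →+* Ω))) := by
    have : CommRingCat.ofHom ((1 : Ω ≃ₐ[k] Ω) : Ω →+* Ω) = 𝟙 (CommRingCat.of Ω) := rfl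
    rw [this]
    infer_instance
  have : IsIso (D.act 1) := by
    have h2 : IsIso (pullback.fst V.hom
        (Spec.map (CommRingCat.ofHom ((1 : Ω ≃ₐ[k] Ω) : Ω →+* Ω)))) := inferInstance
    have h3 : IsIso (D.iso 1).inv.left :=
      inferInstanceAs (IsIso ((Over.forget _).map (D.iso 1).inv))
    exact IsIso.comp_isIso
  rw [← cancel_epi (D.act 1), ← h1, Category.comp_id]

/-- The semilinear action attached to a descent system. -/
noncomputable def DescentSystem.toSemilinearAction (D : DescentSystem k V) :
    SemilinearAction k (X := V.left) V.hom where
  act := D.act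
  act_one := D.act_one
  act_mul := D.act_mul
  act_comp := D.act_comp

/-- A point `P` with `f_σ(σP) = P` is fixed by `σ` under the semilinear action. -/
lemma DescentSystem.left_comp_act (D : DescentSystem k V) (σ : Ω ≃ₐ[k] Ω) (P : Point V)
    (h : conjPoint σ P ≫ (D.iso σ).hom = P) :
    P.left ≫ D.act σ = Spec.map (CommRingCat.ofHom (σ : Ω →+* Ω)) ≫ P.left := by
  have h1 : P ≫ (D.iso σ).inv = conjPoint σ P := by rw [Iso.comp_inv_eq, h]
  have h2 : P.left ≫ (D.iso σ).inv.left = (conjPoint σ P).left := congrArg (fun φ ↦ φ.left) h1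
  refine (Category.assoc _ _ _).symm.trans ((congrArg (· ≫ pullback.fst _ _) h2).trans ?_)
  exact pullback.lift_fst _ _ _

end Translation

/-! ### The model over the ground field -/

section Model

variable {k Ω : Type u} [Field k] [Field Ω] [Algebra k Ω]

/-- The isomorphism from the chosen base change `V₀_Ω` to another base change `V` of `V₀`. -/
noncomputable def baseChangeIso {V : SchemeOver Ω} {V₀ : SchemeOver k} {p : V.left ⟶ V₀.left}
    (hp : IsPullback p V.hom V₀.hom (Spec.map (CommRingCat.ofHom (algebraMap k Ω)))) :
    (baseChange (algebraMap k Ω)).obj V₀ ≅ V :=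
  (Over.isoMk hp.isoPullback hp.isoPullback_hom_snd : V ≅ (baseChange (algebraMap k Ω)).obj V₀).symm

lemma baseChangeIso_hom_left_comp {V : SchemeOver Ω} {V₀ : SchemeOver k} {p : V.left ⟶ V₀.left}
    (hp : IsPullback p V.hom V₀.hom (Spec.map (CommRingCat.ofHom (algebraMap k Ω)))) :
    (baseChangeIso hp).hom.left ≫ p =
      pullback.fst V₀.hom (Spec.map (CommRingCat.ofHom (algebraMap k Ω))) :=
  hp.isoPullback_inv_fst

/-- A model through which all automorphisms act trivially splits the descent system. -/
lemma DescentSystem.isSplitBy_baseChangeIso {V : SchemeOver Ω} (D : DescentSystem k V)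
    {V₀ : SchemeOver k} {p : V.left ⟶ V₀.left}
    (hp : IsPullback p V.hom V₀.hom (Spec.map (CommRingCat.ofHom (algebraMap k Ω))))
    (hinv : ∀ σ, D.act σ ≫ p = p) : D.IsSplitBy V₀ (baseChangeIso hp) := by
  intro σ
  let f := baseChangeIso hp
  have key : (conj σ).map f.hom ≫ (D.iso σ).hom = (conjBaseChange σ V₀).hom ≫ f.hom := by
    ext1
    apply hp.hom_ext
    · -- both composites are the projection from `σ(V₀_Ω)` to `V₀`
      have h1 : (D.iso σ).hom.left ≫ p =
          pullback.fst V.hom (Spec.map (CommRingCat.ofHom (σ : Ω →+* Ω))) ≫ p := by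
        have h := congrArg ((D.iso σ).hom.left ≫ ·) (hinv σ)
        have h' : (D.iso σ).hom.left ≫ (D.iso σ).inv.left = 𝟙 _ :=
          congrArg (fun φ ↦ φ.left) (D.iso σ).hom_inv_id
        refine h.symm.trans ?_
        have h'' : (D.iso σ).hom.left ≫ D.act σ =
            pullback.fst V.hom (Spec.map (CommRingCat.ofHom (σ : Ω →+* Ω))) :=
          (Category.assoc _ _ _).symm.trans ((congrArg (· ≫ pullback.fst V.hom _) h').trans
            (Category.id_comp _))
        exact (Category.assoc _ _ _).symm.trans (congrArg (· ≫ p) h'')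
      have h2 := baseChangeIso_hom_left_comp hp
      have h3 := baseChangeComp_hom_left_fst (algebraMap k Ω) (σ : Ω →+* Ω) (algebraMap k Ω)
        (RingHom.ext fun x ↦ σ.commutes x) V₀
      refine (Category.assoc _ _ _).trans ((congrArg (((conj σ).map f.hom).left ≫ ·) h1).trans ?_)
      refine (Category.assoc _ _ _).symm.trans
        ((congrArg (· ≫ p) (conj_map_left_fst σ f.hom)).trans ?_)
      refine (Category.assoc _ _ _).trans ((congrArg (pullback.fst _ _ ≫ ·) h2).trans ?_)
      refine h3.symm.trans (Eq.trans ?_ (Category.assoc _ _ _).symm)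
      exact congrArg ((conjBaseChange σ V₀).hom.left ≫ ·) h2.symm
    · exact (Over.w ((conj σ).map f.hom ≫ (D.iso σ).hom)).trans
        (Over.w ((conjBaseChange σ V₀).hom ≫ f.hom)).symm
  rw [← key]
  exact (Iso.inv_hom_id_assoc ((conj σ).mapIso f) _).symm

/-- Two extensions of a field have a common extension. -/
lemma exists_common_extension (F K : Type u) [Field F] [Algebra k F] [Field K] [Algebra k K] :
    ∃ (E : Type u) (_ : Field E) (φ : F →+* E) (ψ : K →+* E),
      φ.comp (algebraMap k F) = ψ.comp (algebraMap k K) := by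
  obtain ⟨m, hm⟩ := Ideal.exists_maximal (F ⊗[k] K)
  let E := (F ⊗[k] K) ⧸ m
  let _ : Field E := Ideal.Quotient.field m
  let φ : F →+* E := (Ideal.Quotient.mk m).comp Algebra.TensorProduct.includeLeftRingHom
  let ψ : K →+* E := (Ideal.Quotient.mk m).comp
    (Algebra.TensorProduct.includeRight : K →ₐ[k] F ⊗[k] K).toRingHom
  refine ⟨E, inferInstance, φ, ψ, ?_⟩
  · ext c
    simp only [φ, ψ, RingHom.comp_apply]
    congr 1
    exact ((Algebra.TensorProduct.includeLeft (R := k) (S := k) : F →ₐ[k] F ⊗[k] K).commutes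
      c).trans ((Algebra.TensorProduct.includeRight : K →ₐ[k] F ⊗[k] K).commutes c).symm

/-- Geometric reducedness descends along a field extension: the base change to any `K` receives a
scheme theoretically dominant morphism from the base change to a common extension of `K` and `Ω`. -/
lemma geometricallyReduced_of_isPullback {X X₀ : Scheme.{u}} {f : X ⟶ Spec (.of Ω)}
    {s : X₀ ⟶ Spec (.of k)} {p : X ⟶ X₀}
    (hp : IsPullback p f s (Spec.map (CommRingCat.ofHom (algebraMap k Ω))))
    [GeometricallyReduced f] : GeometricallyReduced s := by
  refine ⟨geometrically_iff_of_commRing.mpr fun K _ _ Y a b h ↦ ?_⟩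
  obtain ⟨E, _, φ, ψ, hφψ⟩ := exists_common_extension (k := k) Ω K
  have hX : IsReduced (pullback f (Spec.map (CommRingCat.ofHom φ))) :=
    GeometricallyReduced.geometrically_isReduced (f := f) _ _ _ (.of_hasPullback _ _)
  have h1 := ((IsPullback.of_hasPullback f (Spec.map (CommRingCat.ofHom φ))).flip.paste_vert
    hp.flip).flip
  rw [← Spec.map_comp, ← CommRingCat.ofHom_comp, hφψ, CommRingCat.ofHom_comp,
    Spec.map_comp] at h1
  let q : pullback f (Spec.map (CommRingCat.ofHom φ)) ⟶ Y :=
    h.lift (pullback.fst f (Spec.map (CommRingCat.ofHom φ)) ≫ p)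
      (pullback.snd f (Spec.map (CommRingCat.ofHom φ)) ≫ Spec.map (CommRingCat.ofHom ψ))
      (by rw [h1.w, Category.assoc])
  have hq : IsPullback q (pullback.snd f (Spec.map (CommRingCat.ofHom φ))) b
      (Spec.map (CommRingCat.ofHom ψ)) := by
    refine IsPullback.of_right ?_ (h.lift_snd _ _ _) h
    rw [h.lift_fst]
    exact h1
  have : IsReduced (Spec (.of K)) := inferInstance
  have : IsSchemeTheoreticallyDominant (Spec.map (CommRingCat.ofHom ψ)) := .of_isDominant _
  have : Flat b := MorphismProperty.of_isPullback h (inferInstanceAs (Flat s))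
  have : IsSchemeTheoreticallyDominant q := .of_isPullback hq.flip
  have : QuasiCompact q := MorphismProperty.of_isPullback hq.flip inferInstance
  exact IsSchemeTheoreticallyDominant.isReduced q

/-- A model of a variety is a variety; finiteness properties descend along fpqc coverings. -/
lemma isVariety_of_isPullback {V : SchemeOver Ω} (hV : IsVariety V) {V₀ : SchemeOver k}
    {p : V.left ⟶ V₀.left}
    (hp : IsPullback p V.hom V₀.hom (Spec.map (CommRingCat.ofHom (algebraMap k Ω)))) :
    IsVariety V₀ := by
  have h1 := hV.geometricallyReduced
  have h2 := hV.locallyOfFiniteType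
  have h3 := hV.quasiCompact
  have hflat : Flat (Spec.map (CommRingCat.ofHom (algebraMap k Ω))) := by
    rw [Flat.SpecMap_iff]
    exact RingHom.flat_algebraMap_iff.mpr inferInstance
  have hS : Surjective p := MorphismProperty.of_isPullback hp.flip inferInstance
  have hX : CompactSpace V.left := (quasiCompact_iff_compactSpace (Y := Spec (.of Ω)) V.hom).mp h3
  refine ⟨geometricallyReduced_of_isPullback hp, ?_, ?_⟩
  · exact MorphismProperty.of_isPullback_of_descendsAlong
      (Q := @Surjective ⊓ @Flat ⊓ @QuasiCompact) hp.flip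
      ⟨⟨inferInstance, hflat⟩, inferInstance⟩ h2
  · have : CompactSpace V₀.left := hS.surj.compactSpace p.continuous
    exact (quasiCompact_iff_compactSpace (Y := Spec (.of k)) V₀.hom).mpr this

end Model

end DescentOfVarieties

open DescentOfVarieties in
theorem corollary1p2 {k Ω : Type u} [Field k] [Field Ω] [Algebra k Ω] [IsAlgClosed Ω] [CharZero Ω]
    (htr : Cardinal.aleph0 ≤ Algebra.trdeg k Ω)
    (V : DescentOfVarieties.SchemeOver Ω)
    (hV : DescentOfVarieties.IsVariety V)
    (hVqp : DescentOfVarieties.IsQuasiprojective V)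
    (D : DescentOfVarieties.DescentSystem k V)
    (S : Set (DescentOfVarieties.Point V)) (hS : S.Finite)
    (hrigid : ∀ α : V ≅ V, (∀ P ∈ S, P ≫ α.hom = P) → α = Iso.refl V)
    (hfix : ∃ L : IntermediateField k Ω, L.FG ∧
      ∀ σ ∈ L.fixingSubgroup, ∀ P ∈ S,
        DescentOfVarieties.conjPoint σ P ≫ (D.iso σ).hom = P) :
    D.IsEffective := by
  obtain ⟨n, i, hi⟩ := hVqp
  obtain ⟨L, ⟨s₀, hs₀⟩, hL⟩ := hfix
  have hgr := hV.geometricallyReduced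
  have hqc := hV.quasiCompact
  let f : V.left ⟶ Spec (.of Ω) := V.hom
  have : CompactSpace V.left := (quasiCompact_iff_compactSpace f).mp hqc
  have : AlgebraicGeometry.IsReduced V.left :=
    hgr.geometrically_isReduced (𝟙 (Spec (.of Ω))) (𝟙 V.left) f .of_id_fst
  let A : SemilinearAction k f := D.toSemilinearAction
  let i₀ : V.left ⟶ Pn n Ω := i.left
  have hi₀ : IsImmersion i₀ := hi
  have hi₀f : i₀ ≫ Pn.toSpec n Ω = f := Over.w i
  -- an automorphism that fixes the generators `s₀` of `L` is compatible with the points in `S`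
  obtain ⟨k₁, i', h1, h2, h3, hi'f, heq⟩ := exists_immersion_equivariant_finite htr A i₀ hi₀f
    (S := (fun P : Point V ↦ P.left) '' S) (hS.image _)
    (by rintro _ ⟨P, -, rfl⟩; exact Over.w P)
    (by
      intro α hα hαS
      have h := hrigid (Over.isoMk α hα) fun P hP ↦ by
        ext1
        exact hαS _ ⟨P, hP, rfl⟩
      exact congrArg (fun β ↦ β.hom.left) h)
    s₀ (by
      rintro σ hσ _ ⟨P, hP, rfl⟩
      refine D.left_comp_act σ P (hL σ ?_ P hP)
      rw [← hs₀]
      exact (IntermediateField.mem_fixingSubgroup_iff _ _).mpr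
        ((IntermediateField.forall_mem_adjoin_smul_eq_self_iff k σ).mpr hσ))
  -- `V` is separated because it is a subscheme of projective space
  have hsep : IsSeparated f := hi'f ▸ inferInstance
  have htr₁ : Cardinal.aleph0 ≤ Algebra.trdeg k₁ Ω := by
    have h := trdeg_add_eq k k₁ (A := Ω)
    rw [trdeg_eq_zero, zero_add] at h
    rwa [h]
  have := isInvariant_of_trdeg htr
  have := isInvariant_of_trdeg htr₁
  obtain ⟨X₀, s, p, hp, hinv⟩ := exists_isPullback_of_isGood A fun x ↦
    exists_mem_isGood k₁ i' hi'f heq x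
  have hp' : IsPullback (C := Scheme.{u}) (p : V.left ⟶ (Over.mk s).left) V.hom (Over.mk s).hom
      (Spec.map (CommRingCat.ofHom (algebraMap k Ω))) := hp
  exact ⟨Over.mk s, baseChangeIso hp', isVariety_of_isPullback hV hp',
    D.isSplitBy_baseChangeIso hp' hinv⟩
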